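/- **Symbols.** Let $x_1,x_2,\dots$ be variables and $x_{i\to j}=\prod_{r=i}^{j-1}x_r$. Let $\mathbb H$ be the free commutative $\mathbb Q$-algebra on the symbols $[x_i]_0$ (weight $1$) and $[x_{i_1\to i_2},\dots,x_{i_d\to i_{d+1}}]_{n_1,\dots,n_d}$ (weight $n_1+\dots+n_d$), where $d\ge1$, $1\le i_1<\dots<i_{d+1}$ and all $n_r\geq 1$. Put $[x_{i\to j}]_0=\sum_{r=i}^{j-1}[x_r]_0$. Let $\overline{\mathbb H}\supset\mathbb H$ be the free commutative algebra that has in addition the inverted symbols $[x_{i_d\to i_{d+1}}^{-1},\dots,x_{i_1\to i_2}^{-1}]_{n_d,\dots,n_1}$ as generators. For a word $y_1,\dots,y_d$ (with $y_r=x_{i_r\to i_{r+1}}$, or such a word inverted and reversed) put $$[y_1,\dots,y_d|t_1,\dots,t_d]=\sum_{n_r\ge1}[y_1,\dots,y_d]_{n_1,\dots,n_d}t_1^{n_1-1}\cdots t_d^{n_d-1},\qquad[\emptyset|\emptyset]=1,\qquad y_{i\to j}=\prod_{r=i}^{j-1}y_r .$$ **Inversion.** $\mathrm{INV}\colon\overline{\mathbb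 H}\to\mathbb H$ is the algebra homomorphism that fixes $\mathbb H$ and is given on inverted symbols recursively in $d\ge1$ by $$\begin{aligned}\mathrm{INV}[y_d^{-1},\dots,y_1^{-1}|-t_d,\dots,-t_1]={}&\sum_{j=0}^{d-1}(-1)^{d-1+j}\,\mathrm{INV}[y_j^{-1},\dots,y_1^{-1}|-t_j,\dots,-t_1]\,[y_{j+1},\dots,y_d|t_{j+1},\dots,t_d]\\&+\sum_{j=1}^d\frac{(-1)^{d-1+j}}{t_j}\Big(\mathrm{INV}[y_{j-1}^{-1},\dots,y_1^{-1}|-t_{j-1},\dots,-t_1]\,[y_{j+1},\dots,y_d|t_{j+1},\dots,t_d]\\&\quad-\mathrm{INV}[y_{j-1}^{-1},\dots,y_1^{-1}|t_j-t_{j-1},\dots,t_j-t_1]\,e^{[y_{1\to d+1}]_0t_j}\,[y_{j+1},\dots,y_d|t_{j+1}-t_j,\dots,t_d-t_j]\Big).\end{aligned}$$ **Coproduct.** $\Delta\colon\mathbb H\to\mathbb H\otimes\mathbb H$ is the algebra homomorphism with $\Delta[x_i]_0=[x_i]_0\otimes1+1\otimes[x_i]_0$ for which $\Delta[y_1,\dots,y_d|t_1,\dots,t_d]$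 is obtained by applying $\mathrm{INV}$ to $$\begin{aligned}\sum[y_{i_1\to i_2},\dots,y_{i_k\to i_{k+1}}|t_{j_1},\dots,t_{j_k}]\otimes\prod_{\alpha=0}^k&(-1)^{j_\alpha-i_\alpha}e^{[y_{i_\alpha\to i_{\alpha+1}}]_0t_{j_\alpha}}\,[y_{j_\alpha-1}^{-1},\dots,y_{i_\alpha}^{-1}|t_{j_\alpha}-t_{j_\alpha-1},\dots,t_{j_\alpha}-t_{i_\alpha}]\\&\cdot[y_{j_\alpha+1},\dots,y_{i_{\alpha+1}-1}|t_{j_\alpha+1}-t_{j_\alpha},\dots,t_{i_{\alpha+1}-1}-t_{j_\alpha}],\end{aligned}$$ summed over $0=i_0=j_0<i_1\le j_1<\dots<i_k\le j_k<i_{k+1}=d+1$, $k\ge 0$, where $t_0=0$ (so that the exponential factor for $\alpha=0$ is $1$). **Variation matrix.** Let $\mathbb Z^\infty_{\ge0}=\bigcup_\ell\mathbb Z_{\ge0}^\ell$ with all zero vectors identified. It is identified with the set consisting of $1\in\mathbb H$ (the zero vector) and of all symbols $[x_{i_1\to i_2},\dots,x_{i_d\to i_{d+1}}]_{n_1,\dots,n_d}$,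 such a symbol being the vector of length $i_{d+1}-1$ with entry $n_r$ at the place $i_r$ and $0$ elsewhere; $\|\mathbf k\|$ is the sum of the entries. The variation matrix $V=(V_{v,u})_{v,u\in\mathbb Z^\infty_{\geq0}}$, with entries in $\mathbb H$, is defined by $\Delta(v)=\sum_uu\otimes V_{v,u}$; $V_n$ is its weight $n$ part. **Forms.** Let $\Omega^1$ be the module of algebraic $1$-forms of the polynomial ring $\mathbb Q[u_i,v_{i,j}]$ $(1\le i\le j)$ over $\mathbb Q$. Identify the weight one part $\mathbb H_1$ with the span of the variables by $[x_i]_0=u_i$, $[x_i x_{i+1}\cdots x_j]_1=-v_{i,j}$. Let $\Delta_{1,\dots,1}\colon\mathbb H\to T^*\mathbb H_1$ be the symbol map (the maximal iteration of the coproduct), which is the identity in weights $0$ and $1$ and is $(\Delta_{1,\dots,1}\otimes\mathrm{id})\circ\Delta_{n,1}$ in weight $n+1$, where $\Delta_{n,1}$ is the component of $\Delta$ in $\mathbb H_n\otimes\mathbb H_1$. Let $w\colon\mathbb H\to\Omega^1$ be its composition with the linear map $$T^*\mathbb H_1\to\Omega^1,\qquad f_1\otimes\dots\otimes f_n\mapsto\frac{(-1)^{n+1}}{n!}\sum_{i=1}^n(-1)^{i-1}\binom{n-1}{i-1}f_1\cdots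 \mathrm df_i\cdots f_n .$$ Apply $w$ to matrices entrywise, and let $\Omega=V_1$, with entries regarded as elements of $\mathbb Q[u_i,v_{i,j}]$. **Proposition.** The matrix $V$ is well defined, and each of its rows has only finitely many nonzero entries, so that the matrix products below are finite sums. With $[A,B]=AB-BA$, for all $n\ge1$ $$(n+1)!\,w(V_{n+1})=[\,n!\,w(V_n),\Omega\,].$$ Consequently, for every symbol $s\in\mathbb Z^\infty_{\ge0}$ with $\|s\|\ge2$, $$w(s)=\frac1{\|s\|}\Big(\sum_{u}w(V_{\|s\|-1})_{s,u}\,\Omega_{u,0}-\sum_{u}\Omega_{s,u}\,w(V_{\|s\|-1})_{u,0}\Big),$$ the sums being over $u\in\mathbb Z^\infty_{\geq 0}$. In particular, this holds for $s=[x_1,\dots,x_d]_{\mathbf n}$ with $\mathbf n=(n_1,\dots,n_d)$, all $n_r\geq 1$ and $\|\mathbf n\|\ge2$. -/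

import Mathlib

open scoped TensorProduct

noncomputable section

namespace SymbPolylog

/-! ### The generators

The variables `x_0, x_1, x_2, …` are numbered from `0`, and `x_{p→q} = x_p x_{p+1} ⋯ x_{q-1}`.

A symbol `[x_{i_1→i_2}, …, x_{i_d→i_{d+1}}]_{n_1, …, n_d}` with `d ≥ 1`, `i_1 < ⋯ < i_{d+1}` and
all `n_r ≥ 1` is recorded as the nonzero vector of length `i_{d+1}` whose entry at the position
`i_r` is `n_r` and whose other entries are `0`. -/

/-- A nonzero vector `vec` of nonnegative integers of length `len` (entries at the positions
`0, …, len - 1`), that is, a symbol `[x_{i_1→i_2}, …, x_{i_d→i_{d+1}}]_{n_1, …, n_d}` with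
`{i_1 < ⋯ < i_d}` the support of `vec`, `i_{d+1} = len` and `n_r = vec i_r`. -/
structure Symb where
  len : ℕ
  vec : ℕ →₀ ℕ
  lt_len : ∀ i ∈ vec.support, i < len
  ne_zero : vec ≠ 0

/-- `‖n‖ = n_1 + ⋯ + n_d`. -/
def Symb.norm (s : Symb) : ℕ := s.vec.sum fun _ k => k

/-- The exponents `n_r - 1` with which a symbol occurs in its generating series. -/
def Symb.exps (s : Symb) : ℕ →₀ ℕ := s.vec.mapRange (fun k => k - 1) rfl

/-- The union of all `ℤ^ℓ_{≥0}` with all zero vectors identified; `none` is the zero vector. -/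
abbrev ZInf := Option Symb

/-- Generators of `ℍ`: `log i` is `[x_i]_0`, `poly s` is the symbol `s`. -/
inductive Gen where
  | log (i : ℕ)
  | poly (s : Symb)

/-- Generators of `ℍ̄`: `log i` is `[x_i]_0`, `reg s` is the regular symbol `s`, and, for
`s = [y_1, …, y_d]_{n_1, …, n_d}`, `inv s` is the inverted symbol
`[y_d⁻¹, …, y_1⁻¹]_{n_d, …, n_1}`. -/
inductive GenBar where
  | log (i : ℕ)
  | reg (s : Symb)
  | inv (s : Symb)

/-- The free commutative `ℚ`-algebra `ℍ` of symbolic polylogarithms. -/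
abbrev HSymb := MvPolynomial Gen ℚ

/-- The auxiliary algebra `ℍ̄`, with inverted symbols. -/
abbrev HBar := MvPolynomial GenBar ℚ

/-- The weights of the generators of `ℍ`; `[x_i]_0` has weight `1`. -/
def genWeight : Gen → ℕ
  | .log _ => 1
  | .poly s => s.norm

/-- The projection of `ℍ` onto its weight `n` part. -/
def weightPart (n : ℕ) : HSymb →ₗ[ℚ] HSymb :=
  MvPolynomial.weightedHomogeneousComponent genWeight n

/-- The element `[x_{p→q}]_0 = ∑_{p ≤ r < q} [x_r]_0` of `ℍ`. -/
def logH (p q : ℕ) : HSymb := ∑ r ∈ Finset.Ico p q, MvPolynomial.X (Gen.log r)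

/-- The element `[x_{p→q}]_0 = ∑_{p ≤ r < q} [x_r]_0` of `ℍ̄`. -/
def logBar (p q : ℕ) : HBar := ∑ r ∈ Finset.Ico p q, MvPolynomial.X (GenBar.log r)

/-! ### Generating series

The word `y_1, …, y_d` with `y_r = x_{i_r→i_{r+1}}` is recorded by the set `S = {i_1 < ⋯ < i_d}`
and the end point `e = i_{d+1}`. The formal variable that belongs to the letter `y_r` is the
variable with number `i_r`, written `t_{i_r}`. -/

section Series

variable {R : Type*} [CommRing R]

/-- The value of `g` at the vector `v` of length `e`, with the value `1` for the zero vector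
(the empty symbol). -/
def valueAt (g : Symb → R) (e : ℕ) (v : ℕ →₀ ℕ) : R :=
  open Classical in
  if hv : v = 0 then 1
  else if h : ∀ i ∈ v.support, i < e then g ⟨e, v, h, hv⟩ else 0

/-- `∑_{n_r ≥ 1} g([y_1, …, y_d]_{n_1, …, n_d}) ∏_r t_{i_r} ^ (n_r - 1)`, the generating series
of the word `(S, e)`; it is `1` for the empty word. -/
def genSeries (g : Symb → R) (S : Finset ℕ) (e : ℕ) : MvPowerSeries ℕ R := fun m =>
  open Classical in
  if m.support ⊆ S then valueAt g e (m + Finsupp.indicator S fun _ _ => 1) else 0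

/-- Substitution of `a i` for the variables `t_i` with `i ∈ S`, in a series in these variables. -/
def substOn (S : Finset ℕ) (a : ℕ → MvPowerSeries ℕ R) (f : MvPowerSeries ℕ R) :
    MvPowerSeries ℕ R :=
  MvPowerSeries.subst (fun i => if i ∈ S then a i else 0) f

/-- `exp (a t_j)`. -/
def expSeries [Algebra ℚ R] (a : R) (j : ℕ) : MvPowerSeries ℕ R :=
  PowerSeries.subst (a • (MvPowerSeries.X j : MvPowerSeries ℕ R)) (PowerSeries.exp R)

/-- The quotient of `f` by the variable `t_j`, for a series `f` divisible by `t_j`. -/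
def divVar (j : ℕ) (f : MvPowerSeries ℕ R) : MvPowerSeries ℕ R := fun m =>
  MvPowerSeries.coeff (m + Finsupp.single j 1) f

end Series

/-! ### Inversion -/

/-- `[y_1, …, y_d | t_1, …, t_d]` with coefficients in `ℍ`, for the word `(S, e)`. -/
def seriesH (S : Finset ℕ) (e : ℕ) : MvPowerSeries ℕ HSymb :=
  genSeries (fun s => MvPolynomial.X (Gen.poly s)) S e

open Classical in
/-- The series `INV([y_d⁻¹, …, y_1⁻¹ | -t_d, …, -t_1])` for the word `(S, e)`. The summand of
`s = i_j` collects the terms of the inversion formula in which `y_j` is the first letter kept on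
the right (first term) or the letter left out (second and third term, which have the common
denominator `t_j`). -/
def invSeries (S : Finset ℕ) (e : ℕ) : MvPowerSeries ℕ HSymb :=
  if hS : S.Nonempty then
    ∑ s ∈ S.attach,
      (-1) ^ (S.card + 1 + (S.filter (· < s.1)).card) *
        (invSeries (S.filter (· < s.1)) s.1 * seriesH (S.filter (s.1 ≤ ·)) e
          - divVar s.1
            (invSeries (S.filter (· < s.1)) s.1 * seriesH (S.filter (s.1 < ·)) e
              - substOn (S.filter (· < s.1))
                    (fun i => MvPowerSeries.X i - MvPowerSeries.X s.1)
                    (invSeries (S.filter (· < s.1)) s.1)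
                * expSeries (logH (S.min' hS) e) s.1
                * substOn (S.filter (s.1 < ·))
                    (fun i => MvPowerSeries.X i - MvPowerSeries.X s.1)
                    (seriesH (S.filter (s.1 < ·)) e)))
  else 1
termination_by S.card
decreasing_by
  all_goals
    exact Finset.card_lt_card (Finset.filter_ssubset.2 ⟨s.1, s.2, lt_irrefl _⟩)

/-- `INV : ℍ̄ → ℍ`. It fixes the regular symbols, and the value at an inverted symbol
`[y_d⁻¹, …, y_1⁻¹]_{n_d, …, n_1}` is read off from the series
`INV([y_d⁻¹, …, y_1⁻¹ | -t_d, …, -t_1])`, in which it comes with `∏_r (-t_r) ^ (n_r - 1)`. -/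
def INV : HBar →ₐ[ℚ] HSymb :=
  MvPolynomial.aeval fun
    | .log i => MvPolynomial.X (Gen.log i)
    | .reg s => MvPolynomial.X (Gen.poly s)
    | .inv s => (-1) ^ (s.exps.sum fun _ k => k) *
        MvPowerSeries.coeff s.exps (invSeries s.vec.support s.len)

/-! ### The coproduct -/

/-- The first element of `I`, or the end point `e` if `I` is empty (for `I` below `e`). -/
def firstPt (I : Finset ℕ) (e : ℕ) : ℕ :=
  (insert e I).min' (Finset.insert_nonempty _ _)

/-- The successor of `i` in `I`, or the end point `e` if there is none (for `I` below `e`). -/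
def nextPt (I : Finset ℕ) (e i : ℕ) : ℕ := firstPt (I.filter (i < ·)) e

/-- Generating series of a word of regular symbols in the right factor of `ℍ̄ ⊗ ℍ̄`. -/
def rightReg (S : Finset ℕ) (e : ℕ) : MvPowerSeries ℕ (HBar ⊗[ℚ] HBar) :=
  genSeries (fun s => 1 ⊗ₜ MvPolynomial.X (GenBar.reg s)) S e

/-- The series `∑ [y_d⁻¹, …, y_1⁻¹]_{n_d, …, n_1} ∏_r t_r ^ (n_r - 1)`, that is,
`[y_d⁻¹, …, y_1⁻¹ | t_d, …, t_1]`, in the right factor of `ℍ̄ ⊗ ℍ̄`. -/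
def rightInv (S : Finset ℕ) (e : ℕ) : MvPowerSeries ℕ (HBar ⊗[ℚ] HBar) :=
  genSeries (fun s => 1 ⊗ₜ MvPolynomial.X (GenBar.inv s)) S e

/-- Generating series of a word of regular symbols in the left factor of `ℍ̄ ⊗ ℍ̄`. -/
def leftReg (S : Finset ℕ) (e : ℕ) : MvPowerSeries ℕ (HBar ⊗[ℚ] HBar) :=
  genSeries (fun s => MvPolynomial.X (GenBar.reg s) ⊗ₜ 1) S e

/-- The factor of the coproduct formula that belongs to `i = i_α`, `j = j_α` and `k = i_{α+1}`:
`(-1)^{j_α - i_α} exp([y_{i_α→i_{α+1}}]_0 t_{j_α})`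
`· [y_{j_α-1}⁻¹, …, y_{i_α}⁻¹ | t_{j_α} - t_{j_α-1}, …, t_{j_α} - t_{i_α}]`
`· [y_{j_α+1}, …, y_{i_{α+1}-1} | t_{j_α+1} - t_{j_α}, …, t_{i_{α+1}-1} - t_{j_α}]`. -/
def coprodFactor (S : Finset ℕ) (i j k : ℕ) : MvPowerSeries ℕ (HBar ⊗[ℚ] HBar) :=
  (-1) ^ (S.filter fun s => i ≤ s ∧ s < j).card
    * expSeries (1 ⊗ₜ logBar i k) j
    * substOn (S.filter fun s => i ≤ s ∧ s < j)
        (fun s => MvPowerSeries.X j - MvPowerSeries.X s)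
        (rightInv (S.filter fun s => i ≤ s ∧ s < j) j)
    * substOn (S.filter fun s => j < s ∧ s < k)
        (fun s => MvPowerSeries.X s - MvPowerSeries.X j)
        (rightReg (S.filter fun s => j < s ∧ s < k) k)

/-- The coproduct of `[y_1, …, y_d | t_1, …, t_d]` for the word `(S, e)`: the sum over all subsets
`I = {i_1 < ⋯ < i_k}` of `S` and all `j` with `j_α ∈ S` and `i_α ≤ j_α < i_{α+1}`. The factor
`[y_1, …, y_{i_1-1} | t_1, …, t_{i_1-1}]` is the one for `α = 0`, where `i_0 = j_0 = 0` and
`t_0 = 0`. -/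
def coprodSeries (S : Finset ℕ) (e : ℕ) : MvPowerSeries ℕ (HBar ⊗[ℚ] HBar) :=
  ∑ I ∈ S.powerset,
    ∑ j ∈ I.pi fun i => S.filter fun s => i ≤ s ∧ s < nextPt I e i,
      substOn I (fun i => if h : i ∈ I then MvPowerSeries.X (j i h) else 0) (leftReg I e)
        * (rightReg (S.filter (· < firstPt I e)) (firstPt I e)
          * ∏ i ∈ I.attach, coprodFactor S i.1 (j i.1 i.2) (nextPt I e i.1))

/-- The restriction to `ℍ` of the coproduct of `ℍ̄`. -/
def coprodBar : HSymb →ₐ[ℚ] HBar ⊗[ℚ] HBar :=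
  MvPolynomial.aeval fun
    | .log i => MvPolynomial.X (GenBar.log i) ⊗ₜ 1 + 1 ⊗ₜ MvPolynomial.X (GenBar.log i)
    | .poly s => MvPowerSeries.coeff s.exps (coprodSeries s.vec.support s.len)

/-- The coproduct `Δ` of `ℍ`: the coproduct of `ℍ̄` followed by `INV` (in both tensor factors). -/
def coprod : HSymb →ₐ[ℚ] HSymb ⊗[ℚ] HSymb :=
  (Algebra.TensorProduct.map INV INV).comp coprodBar

/-! ### The variation matrix -/

/-- The monomial of `ℍ` that corresponds to a vector; the zero vector corresponds to `1`. -/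
def ZInf.exponent : ZInf → (Gen →₀ ℕ)
  | none => 0
  | some s => Finsupp.single (Gen.poly s) 1

/-- The element of `ℍ` that corresponds to a vector: `1` or a symbol. -/
def ZInf.elt (v : ZInf) : HSymb := MvPolynomial.monomial v.exponent 1

/-- The variation matrix, defined by `Δ v = ∑_u u ⊗ V_{v,u}`: the entry `V_{v,u}` is the
coefficient in `Δ v` of the monomial `u` of the left tensor factor. -/
def V : Matrix ZInf ZInf HSymb := fun v u =>
  TensorProduct.lid ℚ HSymb
    (TensorProduct.map (MvPolynomial.lcoeff (R := ℚ) u.exponent) LinearMap.id (coprod v.elt))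

/-- The weight `n` part `V_n` of the variation matrix. -/
def VPart (n : ℕ) : Matrix ZInf ZInf HSymb := fun v u => weightPart n (V v u)

/-! ### The symbol map -/

/-- The weight one part `ℍ_1`. -/
abbrev WeightOne : Submodule ℚ HSymb :=
  MvPolynomial.weightedHomogeneousSubmodule ℚ genWeight 1

/-- The projection of `ℍ` onto `ℍ_1`. -/
def toWeightOne : HSymb →ₗ[ℚ] WeightOne :=
  (weightPart 1).codRestrict WeightOne fun x =>
    MvPolynomial.weightedHomogeneousComponent_mem genWeight x 1

/-- `Δ_{1,…,1}` on the weight `n` part, with values in `T^* ℍ_1`. In weight `0` it is the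
identity of `ℚ`, and in weight `n + 1` it is `(Δ_{1,…,1} ⊗ id) ∘ Δ_{n,1}`. -/
def symbolAux : ℕ → HSymb →ₗ[ℚ] TensorAlgebra ℚ WeightOne
  | 0 => Algebra.linearMap ℚ (TensorAlgebra ℚ WeightOne) ∘ₗ MvPolynomial.lcoeff (R := ℚ) 0
  | n + 1 =>
    LinearMap.mul' ℚ (TensorAlgebra ℚ WeightOne) ∘ₗ
      TensorProduct.map (symbolAux n ∘ₗ weightPart n) (TensorAlgebra.ι ℚ ∘ₗ toWeightOne) ∘ₗ
      coprod.toLinearMap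

/-- The symbol map `Δ_{1,…,1} : ℍ → T^* ℍ_1`; its restriction to the weight `n` part is
`symbolAux n`. -/
def symbolMap : HSymb →ₗ[ℚ] TensorAlgebra ℚ WeightOne :=
  (MvPolynomial.basisMonomials Gen ℚ).constr ℚ fun m =>
    symbolAux (Finsupp.weight genWeight m) (MvPolynomial.monomial m 1)

/-! ### The forms -/

/-- The variables `u_i` and `v_{i,j}` with `i ≤ j`. -/
inductive FormVar where
  | u (i : ℕ)
  | v (i j : ℕ) (h : i ≤ j)

/-- The polynomial ring `ℚ[u_i, v_{i,j}]`. -/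
abbrev FormRing := MvPolynomial FormVar ℚ

/-- The algebraic (Kähler) 1-forms of `ℚ[u_i, v_{i,j}]` over `ℚ`. -/
abbrev Form1 := KaehlerDifferential ℚ FormRing

open Classical in
/-- The polynomials that correspond to the generators of weight one: `[x_i]_0` is `u_i` and
`[x_i x_{i+1} ⋯ x_j]_1` is `-v_{i,j}`. Generators of other weights are not used and go to `0`. -/
def genPoly : Gen → FormRing
  | .log i => MvPolynomial.X (.u i)
  | .poly s => ∑ i : Fin s.len,
      if s.vec = Finsupp.single i.1 1 then
        -MvPolynomial.X (.v i.1 (s.len - 1) (by have := i.2; omega))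
      else 0

/-- The identification of `ℍ_1` with the span of the `u_i` and `v_{i,j}`. -/
def weightOnePoly : WeightOne →ₗ[ℚ] FormRing :=
  (MvPolynomial.aeval genPoly : HSymb →ₐ[ℚ] FormRing).toLinearMap ∘ₗ WeightOne.subtype

/-- `f_1 ⊗ ⋯ ⊗ f_n ↦ (f_1 ⋯ f_{i-1}) (f_{i+1} ⋯ f_n) d f_i`. -/
def wordTerm (n : ℕ) (i : Fin n) : MultilinearMap ℚ (fun _ : Fin n => WeightOne) Form1 where
  toFun f := (∏ k ∈ Finset.univ.erase i, weightOnePoly (f k)) •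
    KaehlerDifferential.D ℚ FormRing (weightOnePoly (f i))
  map_update_add' := by
    intro inst f k x y
    obtain rfl : inst = instDecidableEqFin n := Subsingleton.elim _ _
    by_cases hk : k = i
    · subst hk
      have h : ∀ z, (∏ l ∈ Finset.univ.erase k, weightOnePoly (Function.update f k z l)) =
          ∏ l ∈ Finset.univ.erase k, weightOnePoly (f l) := fun z =>
        Finset.prod_congr rfl fun l hl => by
          rw [Function.update_of_ne (Finset.ne_of_mem_erase hl)]
      simp only [h, Function.update_self, map_add, smul_add]
    · have hm : k ∈ Finset.univ.erase i := Finset.mem_erase.2 ⟨hk, Finset.mem_univ _⟩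
      have h : ∀ z, (∏ l ∈ Finset.univ.erase i, weightOnePoly (Function.update f k z l)) =
          weightOnePoly z * ∏ l ∈ (Finset.univ.erase i).erase k, weightOnePoly (f l) := fun z => by
        rw [← Finset.mul_prod_erase _ _ hm, Function.update_self]
        congr 1
        exact Finset.prod_congr rfl fun l hl => by
          rw [Function.update_of_ne (Finset.ne_of_mem_erase hl)]
      simp only [h, Function.update_of_ne (Ne.symm hk), map_add, add_mul, add_smul]
  map_update_smul' := by
    intro inst f k c x
    obtain rfl : inst = instDecidableEqFin n := Subsingleton.elim _ _
    by_cases hk : k = i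
    · subst hk
      have h : ∀ z, (∏ l ∈ Finset.univ.erase k, weightOnePoly (Function.update f k z l)) =
          ∏ l ∈ Finset.univ.erase k, weightOnePoly (f l) := fun z =>
        Finset.prod_congr rfl fun l hl => by
          rw [Function.update_of_ne (Finset.ne_of_mem_erase hl)]
      simp only [h, Function.update_self, map_smul, Derivation.map_smul]
      rw [smul_comm]
    · have hm : k ∈ Finset.univ.erase i := Finset.mem_erase.2 ⟨hk, Finset.mem_univ _⟩
      have h : ∀ z, (∏ l ∈ Finset.univ.erase i, weightOnePoly (Function.update f k z l)) =
          weightOnePoly z * ∏ l ∈ (Finset.univ.erase i).erase k, weightOnePoly (f l) := fun z => by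
        rw [← Finset.mul_prod_erase _ _ hm, Function.update_self]
        congr 1
        exact Finset.prod_congr rfl fun l hl => by
          rw [Function.update_of_ne (Finset.ne_of_mem_erase hl)]
      simp only [h, Function.update_of_ne (Ne.symm hk), map_smul, smul_mul_assoc, smul_assoc]

/-- The restriction of `w` to words of length `n`:
`f_1 ⊗ ⋯ ⊗ f_n ↦`
`((-1)^{n+1} / n!) ∑_{1 ≤ i ≤ n} (-1)^{i-1} (n-1 choose i-1) f_1 ⋯ d f_i ⋯ f_n`
(in the code `i` runs from `0` to `n - 1`). -/
def wordForm (n : ℕ) : MultilinearMap ℚ (fun _ : Fin n => WeightOne) Form1 :=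
  ((-1 : ℚ) ^ (n + 1) / (n.factorial : ℚ)) •
    ∑ i : Fin n, ((-1 : ℚ) ^ (i : ℕ) * ((n - 1).choose i : ℚ)) • wordTerm n i

/-- The map `w : T^* ℍ_1 → Ω¹`. -/
def wTensor : TensorAlgebra ℚ WeightOne →ₗ[ℚ] Form1 :=
  DirectSum.toModule ℚ ℕ Form1 (fun n => PiTensorProduct.lift (wordForm n)) ∘ₗ
    (TensorAlgebra.toDirectSum (R := ℚ) (M := WeightOne)).toLinearMap

/-- The map `w : ℍ → Ω¹`. -/
def w : HSymb →ₗ[ℚ] Form1 := wTensor ∘ₗ symbolMap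

/-! ### Matrices of forms -/

/-- The matrix of forms `w(V_n)`. -/
def wV (n : ℕ) : Matrix ZInf ZInf Form1 := fun v u => w (VPart n v u)

/-- The matrix `Ω = V_1`, with entries regarded as elements of `ℚ[u_i, v_{i,j}]`. -/
def Omega : Matrix ZInf ZInf FormRing := fun v u => weightOnePoly (toWeightOne (V v u))

/-- The product `A B` of a matrix of forms and a matrix of functions. -/
def formMul (A : Matrix ZInf ZInf Form1) (B : Matrix ZInf ZInf FormRing) :
    Matrix ZInf ZInf Form1 := fun v u => ∑ᶠ k, B k u • A v k

/-- The product `B A` of a matrix of functions and a matrix of forms. -/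
def mulForm (B : Matrix ZInf ZInf FormRing) (A : Matrix ZInf ZInf Form1) :
    Matrix ZInf ZInf Form1 := fun v u => ∑ᶠ k, B v k • A k u

/-- The commutator `[A, B] = A B - B A`. -/
def commutator (A : Matrix ZInf ZInf Form1) (B : Matrix ZInf ZInf FormRing) :
    Matrix ZInf ZInf Form1 := formMul A B - mulForm B A

end SymbPolylog

end

/-! For the variation matrix, coassociativity reads `ΔV_{v,u} = ∑_k V_{k,u} ⊗ V_{v,k}`, and only the
part with weight one in the right factor is needed (`coprod_V`). It follows that the symbol of the
weight `n` part of `V_{v,u}` is a sum, over chains of vectors from `v` to `u`, of words in the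
weight one entries of `V`. A letter can be split off such words at either end (`symbolAux_succ_V`,
`symbolAux_succ_V'`). On the other hand, Pascal's rule gives `(n+1)! w(f_1 ⊗ ⋯ ⊗ f_{n+1}) = f_1 · n!
w(f_2 ⊗ ⋯ ⊗ f_{n+1}) - f_{n+1} · n! w(f_1 ⊗ ⋯ ⊗ f_n)` for `n ≥ 1` (`wordForm_succ`). Summed over the
chains this is the commutator with `Ω` (`wV_succ`). The recurrence for a symbol is the column of the
zero vector, because `V_{s,0} = s` (`V_none`).

The main work is coassociativity to first order. Homomorphisms from `ℍ` to a commutative algebra are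
multiplied by convolution (`convHom`). A `Coaction` is a pair of homomorphisms `β₀`, `β₁` that agree
modulo a square zero ideal, where the generating series of `β₁` come from those of `β₀` by an
explicit formula: a logarithmic multiple of the series, a term for each deleted letter, and a term
for each letter merged with its successor. The projection of `ℍ` to weights zero and one satisfies
the formula over the augmentation (`coaction_weightOneHom`). The formula survives the inversion
recursion (`Coaction.inv`), a single block of the coproduct (`Coaction.block`) and the whole
coproduct sum (`Coaction.cop`), so convolution with any `α` on the left preserves it
(`Coaction.conv`). Since `β₀` and the parameters determine `β₁` (`Coaction.unique`), the two
bracketings of a triple convolution agree, and no identity between iterated coproducts has to be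
expanded (`Coaction.coassoc`).

Two further properties of the coproduct enter. The left factors in the coproduct of a vector are
again vectors (`convHom_elt_mem`), which makes `V` well defined with finite rows. The coproduct
respects weights (`ScalesGen.conv`), so the symbol in length `n` depends only on the weight `n`
part. -/

noncomputable section

namespace SymbPolylog

/-! ### Power series: variables that occur, renaming, shifting, division by a variable,
exponentials. -/

section

open MvPowerSeries in
/-- The series `f` involves only the variables with index in `S`. -/
def Supp {R : Type*} [CommRing R] (S : Finset ℕ) (f : MvPowerSeries ℕ R) : Prop :=
  ∀ m, coeff m f ≠ 0 → m.support ⊆ S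

section Series

open MvPowerSeries

variable {R : Type*} [CommRing R]

namespace Supp

variable {S T : Finset ℕ} {f g : MvPowerSeries ℕ R}

theorem mono (hf : Supp S f) (h : S ⊆ T) : Supp T f := fun m hm => (hf m hm).trans h

theorem zero : Supp S (0 : MvPowerSeries ℕ R) := fun m hm => absurd (by simp) hm

theorem C (r : R) : Supp S (MvPowerSeries.C r : MvPowerSeries ℕ R) := fun m hm => by
  classical
  rw [coeff_C] at hm
  have : m = 0 := by by_contra h; simp [h] at hm
  simp [this]

theorem one : Supp S (1 : MvPowerSeries ℕ R) := by simpa using C (S := S) (1 : R)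

theorem X {i : ℕ} (hi : i ∈ S) : Supp S (MvPowerSeries.X i : MvPowerSeries ℕ R) := fun m hm => by
  classical
  rw [coeff_X] at hm
  have : m = Finsupp.single i 1 := by by_contra h; simp [h] at hm
  rw [this]
  exact Finsupp.support_single_subset.trans (by simpa using hi)

theorem add (hf : Supp S f) (hg : Supp S g) : Supp S (f + g) := fun m hm => by
  by_cases h : coeff m f = 0
  · exact hg m (by simpa [h] using hm)
  · exact hf m h

theorem neg (hf : Supp S f) : Supp S (-f) := fun m hm => hf m (by simpa using hm)

theorem sub (hf : Supp S f) (hg : Supp S g) : Supp S (f - g) := by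
  rw [sub_eq_add_neg]; exact hf.add hg.neg

theorem mul (hf : Supp S f) (hg : Supp S g) : Supp S (f * g) := fun m hm => by
  classical
  rw [coeff_mul] at hm
  obtain ⟨p, hp, h⟩ := Finset.exists_ne_zero_of_sum_ne_zero hm
  rw [← Finset.HasAntidiagonal.mem_antidiagonal.1 hp]
  exact Finsupp.support_add.trans
    (Finset.union_subset (hf _ (left_ne_zero_of_mul h)) (hg _ (right_ne_zero_of_mul h)))

theorem pow (hf : Supp S f) (n : ℕ) : Supp S (f ^ n) := by
  induction n with
  | zero => simpa using one
  | succ n ih => rw [pow_succ]; exact ih.mul hf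

theorem sum {ι : Type*} {s : Finset ι} {f : ι → MvPowerSeries ℕ R} (h : ∀ i ∈ s, Supp S (f i)) :
    Supp S (∑ i ∈ s, f i) := by
  classical
  induction s using Finset.induction_on with
  | empty => simpa using zero
  | insert a s ha ih =>
    rw [Finset.sum_insert ha]
    exact (h a (by simp)).add (ih fun i hi => h i (by simp [hi]))

theorem prod {ι : Type*} {s : Finset ι} {f : ι → MvPowerSeries ℕ R} (h : ∀ i ∈ s, Supp S (f i)) :
    Supp S (∏ i ∈ s, f i) := by
  classical
  induction s using Finset.induction_on with
  | empty => simpa using one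
  | insert a s ha ih =>
    rw [Finset.prod_insert ha]
    exact (h a (by simp)).mul (ih fun i hi => h i (by simp [hi]))

theorem map {R' : Type*} [CommRing R'] (φ : R →+* R') (hf : Supp S f) :
    Supp S (MvPowerSeries.map φ f) := fun m hm => hf m fun h => hm (by simp [h])

theorem divVar (hf : Supp S f) (j : ℕ) : Supp S (divVar j f) := fun m hm =>
  (Finsupp.support_mono (by simp : m ≤ m + Finsupp.single j 1)).trans (hf _ hm)

theorem subst {a : ℕ → MvPowerSeries ℕ R} (ha : HasSubst a) (hf : Supp S f)
    (h : ∀ i ∈ S, Supp T (a i)) : Supp T (subst a f) := fun m hm => by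
  rw [coeff_subst ha] at hm
  obtain ⟨d, hd⟩ : ∃ d, coeff d f • coeff m (d.prod fun s e => a s ^ e) ≠ 0 := by
    by_contra! h0
    exact hm (finsum_eq_zero_of_forall_eq_zero h0)
  have h1 : coeff d f ≠ 0 := fun h => hd (by simp [h])
  refine prod (s := d.support) (f := fun i => a i ^ d i)
    (fun i hi => (h i (hf d h1 hi)).pow _) m fun h => hd ?_
  rw [Finsupp.prod, h, smul_zero]

end Supp

theorem supp_genSeries (g : Symb → R) (S : Finset ℕ) (e : ℕ) : Supp S (genSeries g S e) :=
  fun m hm => by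
    by_contra h
    exact hm (if_neg h)

/-- Substitutions that agree on the variables of a series have the same value at it. -/
theorem subst_congr_of_supp {S : Finset ℕ} {a b : ℕ → MvPowerSeries ℕ R} (ha : HasSubst a)
    (hb : HasSubst b) {f : MvPowerSeries ℕ R} (hf : Supp S f) (h : ∀ i ∈ S, a i = b i) :
    subst a f = subst b f := by
  ext m
  rw [coeff_subst ha, coeff_subst hb]
  refine finsum_congr fun d => ?_
  by_cases hd : coeff d f = 0
  · simp [hd]
  · congr 2
    exact Finset.prod_congr rfl fun i hi => by simp only [h i (hf d hd hi)]

/-- Outside a finite set the family is zero or the identity substitution, so the finiteness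
condition on coefficients is inherited from the latter. -/
theorem hasSubst_of_finite {a : ℕ → MvPowerSeries ℕ R} (h0 : ∀ i, constantCoeff (a i) = 0)
    {S : Finset ℕ} (h : ∀ i ∉ S, a i = 0 ∨ a i = X i) : HasSubst a where
  const_coeff i := by simp [h0 i]
  coeff_zero d := by
    refine (Set.Finite.union S.finite_toSet (HasSubst.X.coeff_zero (S := R) d)).subset fun i hi =>
        ?_
    by_cases hS : i ∈ S
    · exact Or.inl hS
    · refine Or.inr ?_
      rcases h i hS with h' | h'
      · simp [h'] at hi
      · simpa [h'] using hi

theorem hasSubst_comp {a b : ℕ → MvPowerSeries ℕ R} (ha : HasSubst a) (hb : HasSubst b) :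
    HasSubst fun i => subst b (a i) := by
  simpa only [substAlgHom_apply] using ha.comp hb

theorem hasSubst_rename (s q : ℕ) :
    HasSubst fun i => (if i = s then X q else X i : MvPowerSeries ℕ R) :=
  hasSubst_of_finite (S := {s}) (fun i => by split_ifs <;> simp) fun i hi => by
    rw [Finset.mem_singleton] at hi; simp [hi]

theorem hasSubst_shift (B : Finset ℕ) (c : ℕ) :
    HasSubst fun i => (if i ∈ B then X i - X c else 0 : MvPowerSeries ℕ R) :=
  hasSubst_of_finite (S := B) (fun i => by split_ifs <;> simp) fun i hi => by simp [hi]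

/-- Substitution of `t_q` for `t_s`. -/
def renameVar (s q : ℕ) : MvPowerSeries ℕ R →ₐ[R] MvPowerSeries ℕ R :=
  substAlgHom (hasSubst_rename s q)

/-- Substitution of `t_i - t_c` for `t_i`, for all `i ∈ B`. -/
def shiftVars (B : Finset ℕ) (c : ℕ) : MvPowerSeries ℕ R →ₐ[R] MvPowerSeries ℕ R :=
  substAlgHom (hasSubst_shift B c)

theorem renameVar_X (s q i : ℕ) :
    renameVar s q (X i : MvPowerSeries ℕ R) = if i = s then X q else X i := by
  rw [renameVar, substAlgHom_X]

@[simp] theorem renameVar_X_self (s q : ℕ) : renameVar s q (X s : MvPowerSeries ℕ R) = X q := by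
  simp [renameVar_X]

theorem renameVar_eq_self {S : Finset ℕ} {f : MvPowerSeries ℕ R} (hf : Supp S f) {s : ℕ}
    (hs : s ∉ S) (q : ℕ) : renameVar s q f = f := by
  rw [renameVar, substAlgHom_apply, subst_congr_of_supp (hasSubst_rename s q) HasSubst.X hf,
    subst_self, id]
  rintro i hi
  rw [if_neg (by rintro rfl; exact hs hi)]

theorem Supp.shiftVars {S : Finset ℕ} {f : MvPowerSeries ℕ R} (hf : Supp S f) (B : Finset ℕ)
    (c : ℕ) : Supp (insert c S) (shiftVars B c f) := by
  rw [SymbPolylog.shiftVars, substAlgHom_apply]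
  refine hf.subst (hasSubst_shift B c) fun i hi => ?_
  split_ifs
  · exact .sub (.X (by simp [hi])) (.X (by simp))
  · exact .zero

/-- As the centre `c` is not renamed and `q` is itself shifted, both sides send `t_s` to `t_q - t_c`
and the other variables of `f` to `t_i - t_c`. -/
theorem renameVar_shiftVars {S B : Finset ℕ} {f : MvPowerSeries ℕ R} (hf : Supp S f) (hSB : S ⊆ B)
    {s q c : ℕ} (hs : s ≠ c) (hq : q ∈ B) :
    renameVar s q (shiftVars B c f) = shiftVars B c (renameVar s q f) := by
  simp only [renameVar, shiftVars, substAlgHom_apply]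
  rw [subst_comp_subst_apply (hasSubst_shift B c) (hasSubst_rename s q),
    subst_comp_subst_apply (hasSubst_rename s q) (hasSubst_shift B c)]
  refine subst_congr_of_supp (hasSubst_comp (hasSubst_shift B c) (hasSubst_rename s q))
    (hasSubst_comp (hasSubst_rename s q) (hasSubst_shift B c)) hf fun i hi => ?_
  simp only [hSB hi, if_true]
  rw [subst_sub (hasSubst_rename s q), subst_X (hasSubst_rename s q),
    subst_X (hasSubst_rename s q), if_neg hs.symm]
  split_ifs
  · rw [subst_X (hasSubst_shift B c), if_pos hq]
  · rw [subst_X (hasSubst_shift B c), if_pos (hSB hi)]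

/-- The variable `t_s` enters only through the centre. This handles a merge in which the
distinguished letter of a block takes part. -/
theorem renameVar_shiftVars_center {S B : Finset ℕ} {f : MvPowerSeries ℕ R} (hf : Supp S f)
    {s : ℕ} (hs : s ∉ S) (q : ℕ) :
    renameVar s q (shiftVars B s f) = shiftVars B q f := by
  simp only [renameVar, shiftVars, substAlgHom_apply]
  rw [subst_comp_subst_apply (hasSubst_shift B s) (hasSubst_rename s q)]
  refine subst_congr_of_supp (hasSubst_comp (hasSubst_shift B s) (hasSubst_rename s q))
    (hasSubst_shift B q) hf fun i hi => ?_
  split_ifs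
  · rw [subst_sub (hasSubst_rename s q), subst_X (hasSubst_rename s q),
      subst_X (hasSubst_rename s q), if_pos rfl, if_neg (by rintro rfl; exact hs hi)]
  · rw [← coe_substAlgHom (hasSubst_rename s q), map_zero]

theorem shiftVars_C (B : Finset ℕ) (c : ℕ) (r : R) :
    shiftVars B c (C r : MvPowerSeries ℕ R) = C r := (shiftVars B c).commutes r

theorem shiftVars_X {B : Finset ℕ} (c : ℕ) {i : ℕ} (hi : i ∈ B) :
    shiftVars B c (X i : MvPowerSeries ℕ R) = X i - X c := by
  rw [shiftVars, substAlgHom_X, if_pos hi]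

theorem hasSubst_on {S : Finset ℕ} {a : ℕ → MvPowerSeries ℕ R}
    (ha : ∀ i ∈ S, constantCoeff (a i) = 0) : HasSubst fun i => if i ∈ S then a i else 0 :=
  hasSubst_of_finite (S := S) (fun i => by split_ifs with h <;> simp [*]) fun i hi => by simp [hi]

theorem substOn_shift {S B : Finset ℕ} {f : MvPowerSeries ℕ R} (hf : Supp S f) (hSB : S ⊆ B)
    (c : ℕ) : substOn S (fun i => X i - X c) f = shiftVars B c f := by
  rw [substOn, shiftVars, substAlgHom_apply]
  refine subst_congr_of_supp (hasSubst_shift S c) (hasSubst_shift B c) hf fun i hi => ?_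
  simp [hi, hSB hi]

theorem map_substOn {R' : Type*} [CommRing R'] (φ : R →+* R') {S : Finset ℕ}
    {a : ℕ → MvPowerSeries ℕ R} (ha : ∀ i ∈ S, constantCoeff (a i) = 0) (f : MvPowerSeries ℕ R) :
    map φ (substOn S a f) = substOn S (fun i => map φ (a i)) (map φ f) := by
  rw [substOn, map_subst (hasSubst_on ha), substOn]
  congr 1
  funext i
  split_ifs <;> simp

theorem map_shiftVars {R' : Type*} [CommRing R'] (φ : R →+* R') (B : Finset ℕ) (c : ℕ)
    (f : MvPowerSeries ℕ R) : map φ (shiftVars B c f) = shiftVars B c (map φ f) := by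
  simp only [shiftVars, substAlgHom_apply]
  rw [map_subst (hasSubst_shift B c)]
  congr 1
  funext i
  split_ifs <;> simp

theorem map_divVar {R' : Type*} [CommRing R'] (φ : R →+* R') (j : ℕ) (f : MvPowerSeries ℕ R) :
    map φ (divVar j f) = divVar j (map φ f) := rfl

theorem map_genSeries {R' : Type*} [CommRing R'] (φ : R →+* R') (g : Symb → R) (S : Finset ℕ)
    (e : ℕ) : map φ (genSeries g S e) = genSeries (fun s => φ (g s)) S e := by
  ext m
  rw [coeff_map]
  simp only [coeff_apply, genSeries, valueAt]
  split_ifs <;> simp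

/-- A variable is a nonzerodivisor over any coefficient ring, including rings with nilpotents.
Identities between quotients by `t_j` may therefore be checked after clearing the denominator. -/
theorem X_mul_cancel {j : ℕ} {f g : MvPowerSeries ℕ R} (h : X j * f = X j * g) : f = g := by
  ext m
  have := congrArg (coeff (Finsupp.single j 1 + m)) h
  simpa [X, coeff_add_monomial_mul] using this

/-- A series that vanishes for `t_j = 0` is divisible by `t_j`. -/
theorem X_mul_divVar {j : ℕ} {f : MvPowerSeries ℕ R} (h : ∀ m : ℕ →₀ ℕ, m j = 0 → coeff m f = 0) :
    X j * divVar j f = f := by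
  classical
  ext m
  by_cases hm : m j = 0
  · rw [h m hm, X, coeff_monomial_mul, if_neg]
    intro hle
    have := hle j
    simp [hm] at this
  · obtain ⟨m, rfl⟩ : ∃ m', m = Finsupp.single j 1 + m' :=
      ⟨m - Finsupp.single j 1, by
        rw [add_tsub_cancel_of_le]; simpa using Nat.one_le_iff_ne_zero.2 hm⟩
    rw [X, coeff_add_monomial_mul, one_mul, add_comm]
    rfl

/-- Substitution of `0` for `t_j`. -/
def killVar (j : ℕ) : MvPowerSeries ℕ R →ₐ[R] MvPowerSeries ℕ R :=
  substAlgHom (a := fun i => if i = j then 0 else X i)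
    (hasSubst_of_finite (S := {j}) (fun i => by split_ifs <;> simp) fun i hi => by
      rw [Finset.mem_singleton] at hi; simp [hi])

theorem hasSubst_kill (j : ℕ) : HasSubst fun i => (if i = j then 0 else X i : MvPowerSeries ℕ R) :=
  hasSubst_of_finite (S := {j}) (fun i => by split_ifs <;> simp) fun i hi => by
    rw [Finset.mem_singleton] at hi; simp [hi]

theorem coeff_killVar {j : ℕ} (f : MvPowerSeries ℕ R) {m : ℕ →₀ ℕ} (hm : m j = 0) :
    coeff m (killVar j f) = coeff m f := by
  classical
  rw [killVar, substAlgHom_apply, coeff_subst (hasSubst_kill j)]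
  rw [finsum_eq_single _ m]
  · have : (m.prod fun s e => (if s = j then 0 else X s : MvPowerSeries ℕ R) ^ e)
        = monomial m 1 := by
      rw [monomial_one_eq]
      refine Finset.prod_congr rfl fun i hi => ?_
      dsimp only
      rw [if_neg (by rintro rfl; simp [hm] at hi)]
    rw [this, coeff_monomial_same, smul_eq_mul, mul_one]
  · intro d hd
    by_cases hj : d j = 0
    · have : (d.prod fun s e => (if s = j then 0 else X s : MvPowerSeries ℕ R) ^ e)
          = monomial d 1 := by
        rw [monomial_one_eq]
        refine Finset.prod_congr rfl fun i hi => ?_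
        dsimp only
        rw [if_neg (by rintro rfl; simp [hj] at hi)]
      rw [this, coeff_monomial_ne hd.symm, smul_zero]
    · have : (d.prod fun s e => (if s = j then 0 else X s : MvPowerSeries ℕ R) ^ e) = 0 :=
        Finset.prod_eq_zero (i := j) (by simpa using hj) (by simp [hj])
      rw [this, map_zero, smul_zero]

theorem X_mul_divVar_of_killVar {j : ℕ} {f : MvPowerSeries ℕ R} (h : killVar j f = 0) :
    X j * divVar j f = f :=
  X_mul_divVar fun m hm => by rw [← coeff_killVar f hm, h, map_zero]

theorem killVar_eq_self {S : Finset ℕ} {f : MvPowerSeries ℕ R} (hf : Supp S f) {j : ℕ}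
    (hj : j ∉ S) : killVar j f = f := by
  rw [killVar, substAlgHom_apply, subst_congr_of_supp (hasSubst_kill j) HasSubst.X hf,
    subst_self, id]
  rintro i hi
  rw [if_neg (by rintro rfl; exact hj hi)]

/-- At `t_j = 0` the shift by `t_j` is trivial. This is the reason why the polar terms of the
inversion formula have no pole. -/
theorem killVar_shiftVars {S B : Finset ℕ} {f : MvPowerSeries ℕ R} (hf : Supp S f) (hSB : S ⊆ B)
    {j : ℕ} (hj : j ∉ S) : killVar j (shiftVars B j f) = f := by
  simp only [killVar, shiftVars, substAlgHom_apply]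
  rw [subst_comp_subst_apply (hasSubst_shift B j) (hasSubst_kill j),
    subst_congr_of_supp (hasSubst_comp (hasSubst_shift B j) (hasSubst_kill j)) HasSubst.X hf,
        subst_self, id]
  intro i hi
  rw [if_pos (hSB hi), subst_sub (hasSubst_kill j), subst_X (hasSubst_kill j),
    subst_X (hasSubst_kill j), if_pos rfl, if_neg (by rintro rfl; exact hj hi), sub_zero]

theorem hasSubst_smul_X (a : R) (j : ℕ) : PowerSeries.HasSubst (a • X j : MvPowerSeries ℕ R) :=
  PowerSeries.HasSubst.of_constantCoeff_zero (by simp)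

end Series

section Exp

open MvPowerSeries

variable {R : Type*} [CommRing R] [Algebra ℚ R]

theorem expSeries_eq (a : R) (j : ℕ) : expSeries a j =
    PowerSeries.subst (X j : MvPowerSeries ℕ R) (PowerSeries.rescale a (PowerSeries.exp R)) := by
  rw [expSeries, PowerSeries.rescale_eq_subst, PowerSeries.subst_comp_subst_apply
    (PowerSeries.HasSubst.smul_X' a) (PowerSeries.HasSubst.X j),
    PowerSeries.subst_smul (PowerSeries.HasSubst.X j), PowerSeries.subst_X (PowerSeries.HasSubst.X
        j)]

theorem expSeries_add (a b : R) (j : ℕ) :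
    expSeries (a + b) j = expSeries a j * expSeries b j := by
  simp only [expSeries_eq]
  rw [← PowerSeries.exp_mul_exp_eq_exp_add, PowerSeries.subst_mul (PowerSeries.HasSubst.X j)]

theorem expSeries_zero (j : ℕ) : expSeries (0 : R) j = 1 := by
  rw [expSeries_eq]
  simp only [PowerSeries.rescale_zero_apply, PowerSeries.constantCoeff_exp, map_one]
  rw [← PowerSeries.coe_substAlgHom (PowerSeries.HasSubst.X j), map_one]

theorem expSeries_of_sq_eq_zero {a : R} (ha : a * a = 0) (j : ℕ) :
    expSeries a j = 1 + C a * X j := by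
  have : PowerSeries.rescale a (PowerSeries.exp R) = 1 + PowerSeries.C a * PowerSeries.X := by
    ext n
    rw [PowerSeries.coeff_rescale, PowerSeries.coeff_exp]
    match n with
    | 0 => simp
    | 1 => simp [PowerSeries.coeff_one]
    | n + 2 =>
      rw [pow_add, pow_two, ha]
      simp [PowerSeries.coeff_one]
  rw [expSeries_eq, this, PowerSeries.subst_add (PowerSeries.HasSubst.X j),
    PowerSeries.subst_mul (PowerSeries.HasSubst.X j), PowerSeries.subst_X (PowerSeries.HasSubst.X
        j),
    PowerSeries.subst_C, ← PowerSeries.coe_substAlgHom (PowerSeries.HasSubst.X j), map_one]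

theorem map_expSeries {R' : Type*} [CommRing R'] [Algebra ℚ R'] (φ : R →+* R') (a : R) (j : ℕ) :
    map φ (expSeries a j) = expSeries (φ a) j := by
  rw [expSeries, PowerSeries.map_subst (hasSubst_smul_X a j), expSeries, PowerSeries.map_exp]
  congr 1
  simp [smul_eq_C_mul]

theorem subst_expSeries {b : ℕ → MvPowerSeries ℕ R} (hb : HasSubst b) (a : R) (j : ℕ) :
    subst b (expSeries a j) = PowerSeries.subst (a • b j) (PowerSeries.exp R) := by
  rw [expSeries, PowerSeries.subst, PowerSeries.subst,
    subst_comp_subst_apply (hasSubst_smul_X a j).const hb]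
  congr 1
  funext i
  rw [subst_smul hb, subst_X hb]

theorem renameVar_expSeries (s q : ℕ) (a : R) (j : ℕ) :
    renameVar s q (expSeries a j) = expSeries a (if j = s then q else j) := by
  rw [renameVar, substAlgHom_apply, subst_expSeries (hasSubst_rename s q), expSeries]
  split_ifs <;> rfl

theorem killVar_expSeries (a : R) (j : ℕ) : killVar j (expSeries a j) = 1 := by
  rw [killVar, substAlgHom_apply, subst_expSeries (hasSubst_kill j), if_pos rfl, smul_zero,
    PowerSeries.subst_zero_eq_C_constantCoeff]
  simp

theorem supp_expSeries {S : Finset ℕ} (a : R) {j : ℕ} (hj : j ∈ S) : Supp S (expSeries a j) := by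
  intro m hm
  by_contra h
  obtain ⟨i, hi, hiS⟩ := Finset.not_subset.1 h
  apply hm
  rw [expSeries, PowerSeries.coeff_subst (hasSubst_smul_X a j)]
  refine finsum_eq_zero_of_forall_eq_zero fun d => ?_
  have : coeff m ((a • X j : MvPowerSeries ℕ R) ^ d) = 0 := by
    by_contra h3
    have h4 : Supp S ((a • X j : MvPowerSeries ℕ R) ^ d) := by
      rw [smul_eq_C_mul]
      exact ((Supp.C a).mul (.X hj)).pow d
    exact hiS (h4 m h3 hi)
  rw [this, smul_zero]

end Exp

end

/-! ### Words with a successor function, and the series of a single block. -/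

section

open MvPowerSeries (X C)

/-- The function `nx` maps each element of `S` to its successor in `S ∪ {e}`, where `S` lies
below `e`. -/
structure IsNext (S : Finset ℕ) (e : ℕ) (nx : ℕ → ℕ) : Prop where
  lt : ∀ s ∈ S, s < e
  lt_nx : ∀ s ∈ S, s < nx s
  mem : ∀ s ∈ S, nx s ∈ S ∨ nx s = e
  le : ∀ s ∈ S, ∀ q ∈ S, s < q → nx s ≤ q

namespace IsNext

variable {S : Finset ℕ} {e : ℕ} {nx : ℕ → ℕ}

/-- The same `nx` serves the letters before `r`, with end point `r`, and (by the next two lemmas)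
the letters from or after `r`, with end point `e`. Keeping `nx` as a parameter lets the formulas for
prefix and suffix be combined without comparing successor functions. -/
theorem below (h : IsNext S e nx) {r : ℕ} (hr : r ∈ S ∨ r = e) :
    IsNext (S.filter (· < r)) r nx where
  lt s hs := (Finset.mem_filter.1 hs).2
  lt_nx s hs := h.lt_nx s (Finset.mem_filter.1 hs).1
  mem s hs := by
    rw [Finset.mem_filter] at hs ⊢
    have h1 : nx s ≤ r := by
      rcases hr with hr | rfl
      · exact h.le s hs.1 r hr hs.2
      · rcases h.mem s hs.1 with h' | h'
        · exact (h.lt _ h').le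
        · exact h'.le
    rcases h1.lt_or_eq with h2 | h2
    · refine Or.inl ⟨?_, h2⟩
      rcases h.mem s hs.1 with h' | h'
      · exact h'
      · rcases hr with hr | hr
        · exact absurd (h.lt r hr) (by omega)
        · omega
    · exact Or.inr h2
  le s hs q hq hsq := h.le s (Finset.mem_filter.1 hs).1 q (Finset.mem_filter.1 hq).1 hsq

theorem above (h : IsNext S e nx) (r : ℕ) : IsNext (S.filter (r < ·)) e nx where
  lt s hs := h.lt s (Finset.mem_filter.1 hs).1
  lt_nx s hs := h.lt_nx s (Finset.mem_filter.1 hs).1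
  mem s hs := by
    rw [Finset.mem_filter] at hs ⊢
    have := h.lt_nx s hs.1
    exact (h.mem s hs.1).imp (fun h' => ⟨h', by omega⟩) id
  le s hs q hq hsq := h.le s (Finset.mem_filter.1 hs).1 q (Finset.mem_filter.1 hq).1 hsq

theorem aboveEq (h : IsNext S e nx) (r : ℕ) : IsNext (S.filter (r ≤ ·)) e nx where
  lt s hs := h.lt s (Finset.mem_filter.1 hs).1
  lt_nx s hs := h.lt_nx s (Finset.mem_filter.1 hs).1
  mem s hs := by
    rw [Finset.mem_filter] at hs ⊢
    have := h.lt_nx s hs.1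
    exact (h.mem s hs.1).imp (fun h' => ⟨h', by omega⟩) id
  le s hs q hq hsq := h.le s (Finset.mem_filter.1 hs).1 q (Finset.mem_filter.1 hq).1 hsq

/-- The intervals `[s, nx s)` tile `[i, e)`; split off the first one and use induction. -/
theorem sum_Ico (h : IsNext S e nx) {M : Type*} [AddCommMonoid M] (f : ℕ → M) {i : ℕ}
    (hi : i ∈ S) (hmin : ∀ s ∈ S, i ≤ s) :
    ∑ s ∈ S, ∑ r ∈ Finset.Ico s (nx s), f r = ∑ r ∈ Finset.Ico i e, f r := by
  classical
  induction hn : S.card using Nat.strong_induction_on generalizing S i with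
  | _ n ih =>
    have h1 : S = insert i (S.filter (i < ·)) := by
      ext s
      simp only [Finset.mem_insert, Finset.mem_filter]
      constructor
      · intro hs
        rcases (hmin s hs).eq_or_lt with h' | h'
        · exact Or.inl h'.symm
        · exact Or.inr ⟨hs, h'⟩
      · rintro (rfl | h') <;> tauto
    have h2 : i ∉ S.filter (i < ·) := by simp
    have h3 : ∑ s ∈ S, ∑ r ∈ Finset.Ico s (nx s), f r = ∑ r ∈ Finset.Ico i (nx i), f r
        + ∑ s ∈ S.filter (i < ·), ∑ r ∈ Finset.Ico s (nx s), f r := by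
      conv_lhs => rw [h1]
      rw [Finset.sum_insert h2]
    rw [h3]
    rcases h.mem i hi with h' | h'
    · have hlt := h.lt_nx i hi
      have hcard : (S.filter (i < ·)).card < S.card :=
        Finset.card_lt_card (Finset.filter_ssubset.2 ⟨i, hi, lt_irrefl _⟩)
      rw [ih _ (hn ▸ hcard) (h.above i) (Finset.mem_filter.2 ⟨h', hlt⟩)
        (fun s hs => h.le i hi s (Finset.mem_filter.1 hs).1 (Finset.mem_filter.1 hs).2) rfl,
        Finset.sum_Ico_consecutive _ hlt.le (h.lt _ h').le]
    · have : S.filter (i < ·) = ∅ := by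
        rw [Finset.filter_eq_empty_iff]
        intro s hs his
        have := h.le i hi s hs his
        have := h.lt s hs
        omega
      rw [this, Finset.sum_empty, add_zero, h']

end IsNext

section Blocks

variable {R : Type*} [CommRing R] [Algebra ℚ R]

/-- The generating series of a word of regular symbols, with coefficients transported by `β`. -/
def regSer (β : HSymb →ₐ[ℚ] R) (S : Finset ℕ) (e : ℕ) : MvPowerSeries ℕ R :=
  MvPowerSeries.map (β : HSymb →+* R) (seriesH S e)

/-- The signed series of a word of inverted symbols, with coefficients transported by `β`. -/
def invSer (β : HSymb →ₐ[ℚ] R) (S : Finset ℕ) (e : ℕ) : MvPowerSeries ℕ R :=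
  (-1) ^ S.card * MvPowerSeries.map (β : HSymb →+* R) (invSeries S e)

/-- The factor of the coproduct formula that belongs to a block `U` of letters with first element
`i` and end point `k`, and to the element `r` of `U`. -/
def blockSer (β : HSymb →ₐ[ℚ] R) (B U : Finset ℕ) (i r k : ℕ) : MvPowerSeries ℕ R :=
  expSeries (β (logH i k)) r * shiftVars B r (invSer β (U.filter (· < r)) r)
    * shiftVars B r (regSer β (U.filter (r < ·)) k)

theorem supp_seriesH (S : Finset ℕ) (e : ℕ) : Supp S (seriesH S e) := supp_genSeries _ S e

theorem supp_invSeries (S : Finset ℕ) (e : ℕ) : Supp S (invSeries S e) := by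
  induction hn : S.card using Nat.strong_induction_on generalizing S e with
  | _ n ih =>
    rw [invSeries]
    split_ifs with hS
    · refine Supp.sum fun s _ => ?_
      have hlt : (S.filter (· < s.1)) ⊆ S := Finset.filter_subset _ _
      have hgt : (S.filter (s.1 < ·)) ⊆ S := Finset.filter_subset _ _
      have hins : ∀ {T : Finset ℕ}, T ⊆ S → insert s.1 T ⊆ S := fun hT =>
        Finset.insert_subset s.2 hT
      have h1 : Supp (S.filter (· < s.1)) (invSeries (S.filter (· < s.1)) s.1) :=
        ih _ (hn ▸ Finset.card_lt_card (Finset.filter_ssubset.2 ⟨s.1, s.2, lt_irrefl _⟩)) _ _ rfl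
      rw [substOn_shift h1 subset_rfl, substOn_shift (supp_seriesH _ e) subset_rfl]
      refine (Supp.one.neg.pow _).mul (((h1.mono hlt).mul
        ((supp_seriesH _ e).mono (Finset.filter_subset _ _))).sub (Supp.divVar ?_ _))
      exact ((h1.mono hlt).mul ((supp_seriesH _ e).mono hgt)).sub
        ((((h1.shiftVars _ _).mono (hins hlt)).mul (supp_expSeries _ s.2)).mul
          (((supp_seriesH _ e).shiftVars _ _).mono (hins hgt)))
    · exact .one

variable (β : HSymb →ₐ[ℚ] R)

theorem supp_regSer (S : Finset ℕ) (e : ℕ) : Supp S (regSer β S e) := (supp_seriesH S e).map _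

theorem supp_invSer (S : Finset ℕ) (e : ℕ) : Supp S (invSer β S e) :=
  (Supp.one.neg.pow _).mul ((supp_invSeries S e).map _)

theorem supp_blockSer {B U : Finset ℕ} {i r k : ℕ} (hr : r ∈ U) :
    Supp U (blockSer β B U i r k) := by
  have hins : ∀ {T : Finset ℕ}, T ⊆ U → insert r T ⊆ U := fun hT => Finset.insert_subset hr hT
  exact ((supp_expSeries _ hr).mul (((supp_invSer β _ _).shiftVars _ _).mono
    (hins (Finset.filter_subset _ _)))).mul (((supp_regSer β _ _).shiftVars _ _).mono
    (hins (Finset.filter_subset _ _)))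

theorem seriesH_empty (e : ℕ) : seriesH ∅ e = 1 := by
  classical
  ext m : 1
  rw [MvPowerSeries.coeff_one]
  by_cases hm : m = 0
  · subst hm
    simp only [seriesH, MvPowerSeries.coeff_apply, genSeries]
    rw [if_pos (by simp), valueAt, dif_pos (by ext; simp)]
    simp
  · rw [if_neg hm]
    simp only [seriesH, MvPowerSeries.coeff_apply, genSeries]
    rw [if_neg (by simpa using hm)]

theorem invSeries_empty (e : ℕ) : invSeries ∅ e = 1 := by
  rw [invSeries, dif_neg (by simp)]

@[simp] theorem regSer_empty (e : ℕ) : regSer β ∅ e = 1 := by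
  rw [regSer, seriesH_empty, map_one]

@[simp] theorem invSer_empty (e : ℕ) : invSer β ∅ e = 1 := by
  rw [invSer, invSeries_empty, map_one]; simp

theorem neg_one_pow_mul_divVar {R : Type*} [CommRing R] (n j : ℕ) (f : MvPowerSeries ℕ R) :
    (-1) ^ n * divVar j f = divVar j ((-1) ^ n * f) := by
  rcases neg_one_pow_eq_or (MvPowerSeries ℕ R) n with h | h <;> rw [h]
  · simp
  · rw [neg_one_mul, neg_one_mul]
    rfl

/-- The recursion for inverted symbols, in terms of blocks. -/
theorem neg_invSer {S B : Finset ℕ} (hSB : S ⊆ B) {i : ℕ} (hi : i ∈ S) (hmin : ∀ s ∈ S, i ≤ s)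
    (e : ℕ) :
    -invSer β S e = ∑ r ∈ S, (invSer β (S.filter (· < r)) r * regSer β (S.filter (r ≤ ·)) e
      - divVar r (invSer β (S.filter (· < r)) r * regSer β (S.filter (r < ·)) e
        - blockSer β B S i r e)) := by
  have hS : S.Nonempty := ⟨i, hi⟩
  have hi' : S.min' hS = i := le_antisymm (S.min'_le i hi) (hmin _ (S.min'_mem hS))
  rw [invSer, invSeries, dif_pos hS, map_sum, Finset.mul_sum, ← Finset.sum_neg_distrib,
    ← Finset.sum_attach S (fun r => invSer β (S.filter (· < r)) r * _ - _)]
  refine Finset.sum_congr rfl fun r _ => ?_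
  have hsub : ∀ (p : ℕ → Prop) [DecidablePred p], S.filter p ⊆ B := fun p _ =>
    (Finset.filter_subset _ _).trans hSB
  rw [substOn_shift (supp_invSeries _ _) (hsub _), substOn_shift (supp_seriesH _ _) (hsub _), hi']
  simp only [map_mul, map_sub, map_pow, map_neg, map_one, map_divVar, map_shiftVars,
    map_expSeries]
  set n := (S.filter (· < r.1)).card
  -- With the sign built into `invSer`, the alternating signs of the recursion reduce to one global
  -- minus: `(-1) ^ n` is absorbed by the inverted word of the `n` letters before `r`.
  have hsgn : ((-1) ^ S.card * (-1) ^ (S.card + 1 + n) : MvPowerSeries ℕ R) = -(-1) ^ n := by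
    rw [pow_add, pow_succ]
    rcases neg_one_pow_eq_or (MvPowerSeries ℕ R) S.card with h | h <;> rw [h] <;> ring
  rw [← mul_assoc, hsgn, neg_mul, neg_neg, mul_sub, neg_one_pow_mul_divVar]
  congr 1
  · rw [invSer, regSer]; ring
  · congr 1
    rw [blockSer]
    simp only [invSer, regSer, map_mul, map_pow, map_neg, map_one, RingHom.coe_coe]
    ring

/-- The quotient by the variable in the recursion for inverted symbols is exact. -/
theorem X_mul_divVar_block {S B : Finset ℕ} (hSB : S ⊆ B) (i r e : ℕ) :
    X r * divVar r (invSer β (S.filter (· < r)) r * regSer β (S.filter (r < ·)) e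
        - blockSer β B S i r e)
      = invSer β (S.filter (· < r)) r * regSer β (S.filter (r < ·)) e - blockSer β B S i r e := by
  have hsub : ∀ (p : ℕ → Prop) [DecidablePred p], S.filter p ⊆ B := fun p _ =>
    (Finset.filter_subset _ _).trans hSB
  -- At `t_r = 0` the exponential is `1` and the shifts disappear, so the two terms of the numerator
  -- cancel.
  refine X_mul_divVar_of_killVar ?_
  rw [blockSer, map_sub, map_mul, map_mul, map_mul, killVar_expSeries,
    killVar_shiftVars (supp_invSer β _ _) (hsub _) (by simp),
    killVar_shiftVars (supp_regSer β _ _) (hsub _) (by simp),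
    killVar_eq_self (supp_invSer β _ _) (by simp), killVar_eq_self (supp_regSer β _ _) (by simp)]
  ring

end Blocks

end

/-! ### First order deformations and their effect on a block. -/

section

open MvPowerSeries (X C)

theorem sum_erase_split {M : Type*} [AddCommMonoid M] (S : Finset ℕ) (r : ℕ) (f : ℕ → M) :
    ∑ s ∈ S.erase r, f s = ∑ s ∈ S.filter (· < r), f s + ∑ s ∈ S.filter (r < ·), f s := by
  rw [← Finset.sum_union]
  · refine Finset.sum_congr ?_ fun _ _ => rfl
    ext s
    simp only [Finset.mem_erase, Finset.mem_union, Finset.mem_filter]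
    constructor
    · rintro ⟨h1, h2⟩
      rcases lt_or_gt_of_ne h1 with h | h
      · exact Or.inl ⟨h2, h⟩
      · exact Or.inr ⟨h2, h⟩
    · rintro (⟨h1, h2⟩ | ⟨h1, h2⟩)
      · exact ⟨by omega, h1⟩
      · exact ⟨by omega, h1⟩
  · rw [Finset.disjoint_filter]
    intro s _ h1 h2
    omega

theorem filter_erase_eq (S : Finset ℕ) (p : ℕ) (q : ℕ → Prop) [DecidablePred q] :
    (S.erase p).filter q = (S.filter q).erase p := by
  ext s; simp only [Finset.mem_filter, Finset.mem_erase]; tauto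

theorem filter_erase_of_not (S : Finset ℕ) {p : ℕ} (q : ℕ → Prop) [DecidablePred q] (h : ¬ q p) :
    (S.erase p).filter q = S.filter q := by
  rw [filter_erase_eq, Finset.erase_eq_of_notMem (by simp [h])]

section Eps

variable {R : Type*} [CommRing R]

/-- The ideal of series with all coefficients in `J`. -/
def seriesIdeal (J : Ideal R) : Ideal (MvPowerSeries ℕ R) :=
  RingHom.ker (MvPowerSeries.map (Ideal.Quotient.mk J))

theorem mem_seriesIdeal {J : Ideal R} {f : MvPowerSeries ℕ R} :
    f ∈ seriesIdeal J ↔ ∀ m, MvPowerSeries.coeff m f ∈ J := by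
  rw [seriesIdeal, RingHom.mem_ker, MvPowerSeries.ext_iff]
  simp [Ideal.Quotient.eq_zero_iff_mem]

theorem seriesIdeal_mul_eq_zero {J : Ideal R} (hJ : ∀ x ∈ J, ∀ y ∈ J, x * y = 0)
    {f g : MvPowerSeries ℕ R} (hf : f ∈ seriesIdeal J) (hg : g ∈ seriesIdeal J) : f * g = 0 := by
  classical
  rw [mem_seriesIdeal] at hf hg
  ext m
  rw [MvPowerSeries.coeff_mul, map_zero]
  exact Finset.sum_eq_zero fun p _ => hJ _ (hf _) _ (hg _)

theorem C_mem_seriesIdeal {J : Ideal R} {x : R} (hx : x ∈ J) :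
    (C x : MvPowerSeries ℕ R) ∈ seriesIdeal J := by
  rw [seriesIdeal, RingHom.mem_ker, MvPowerSeries.map_C, Ideal.Quotient.eq_zero_iff_mem.2 hx,
    map_zero]

theorem shiftVars_mem_seriesIdeal {J : Ideal R} {f : MvPowerSeries ℕ R} (hf : f ∈ seriesIdeal J)
    (B : Finset ℕ) (c : ℕ) : shiftVars B c f ∈ seriesIdeal J := by
  rw [seriesIdeal, RingHom.mem_ker] at *
  rw [map_shiftVars, hf, map_zero]

/-- The product rule modulo a square zero ideal. -/
theorem product_rule {A : Type*} [CommRing A] {K : Ideal A} (hK : ∀ x ∈ K, ∀ y ∈ K, x * y = 0)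
    {x₀ x₁ y₀ y₁ t t' a b : A} (hx : x₁ = (1 + t) * x₀ + a) (hy : y₁ = (1 + t') * y₀ + b)
    (ht : t ∈ K) (ht' : t' ∈ K) (ha : a ∈ K) (hb : b ∈ K) :
    x₁ * y₁ = (1 + (t + t')) * (x₀ * y₀) + (a * y₀ + x₀ * b) := by
  subst hx hy
  linear_combination (x₀ * y₀) * hK t ht t' ht' + x₀ * hK t ht b hb + y₀ * hK a ha t' ht'
    + hK a ha b hb

end Eps

section Coaction

variable {R : Type*} [CommRing R]

/-- `∑_{p ≤ r < q} l r`. -/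
def logI (l : ℕ → R) (p q : ℕ) : R := ∑ r ∈ Finset.Ico p q, l r

/-- `∑_s t_s l_{s→nx s}`. -/
def logSum (l : ℕ → R) (nx : ℕ → ℕ) (S : Finset ℕ) : MvPowerSeries ℕ R :=
  ∑ s ∈ S, C (logI l s (nx s)) * X s

/-- The contribution of deleting a letter. -/
def delSum (lam : ℕ → ℕ → R) (nx : ℕ → ℕ) (S : Finset ℕ) (Y : ℕ → MvPowerSeries ℕ R) :
    MvPowerSeries ℕ R :=
  ∑ p ∈ S, C (lam p (nx p)) * Y p

/-- The contribution of merging a letter with the next one. -/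
def mergeSum (lam : ℕ → ℕ → R) (l : ℕ → R) (nx : ℕ → ℕ) (S : Finset ℕ)
    (Y : ℕ → MvPowerSeries ℕ R) : MvPowerSeries ℕ R :=
  ∑ s ∈ S, C (lam s (nx s) + logI l s (nx s)) * Y s

/-- The homomorphism `β₁` is a first order deformation of `β₀`, given on generating series by the
formula for the component of the coproduct with weight one in the right factor. -/
structure Coaction [Algebra ℚ R] (β₀ β₁ : HSymb →ₐ[ℚ] R) (J : Ideal R) (lam : ℕ → ℕ → R)
    (l : ℕ → R) : Prop where
  sq : ∀ x ∈ J, ∀ y ∈ J, x * y = 0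
  lam_mem : ∀ p q, lam p q ∈ J
  l_mem : ∀ r, l r ∈ J
  log : ∀ r, β₁ (MvPolynomial.X (Gen.log r)) = β₀ (MvPolynomial.X (Gen.log r)) + l r
  reg : ∀ S e nx, IsNext S e nx → regSer β₁ S e = (1 + logSum l nx S) * regSer β₀ S e +
    (delSum lam nx S (fun p => regSer β₀ (S.erase p) e)
      - mergeSum lam l nx S fun s =>
        if nx s ∈ S then renameVar s (nx s) (regSer β₀ (S.erase (nx s)) e) else 0)

variable {J : Ideal R} {lam : ℕ → ℕ → R} {l : ℕ → R}

theorem logI_mem (hl : ∀ r, l r ∈ J) (p q : ℕ) : logI l p q ∈ J :=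
  sum_mem fun r _ => hl r

theorem logSum_mem (hl : ∀ r, l r ∈ J) (nx : ℕ → ℕ) (S : Finset ℕ) :
    logSum l nx S ∈ seriesIdeal J :=
  sum_mem fun _ _ => Ideal.mul_mem_right _ _ (C_mem_seriesIdeal (logI_mem hl _ _))

theorem delSum_mem (hlam : ∀ p q, lam p q ∈ J) (nx : ℕ → ℕ) (S : Finset ℕ)
    (Y : ℕ → MvPowerSeries ℕ R) : delSum lam nx S Y ∈ seriesIdeal J :=
  sum_mem fun _ _ => Ideal.mul_mem_right _ _ (C_mem_seriesIdeal (hlam _ _))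

theorem mergeSum_mem (hlam : ∀ p q, lam p q ∈ J) (hl : ∀ r, l r ∈ J) (nx : ℕ → ℕ) (S : Finset ℕ)
    (Y : ℕ → MvPowerSeries ℕ R) : mergeSum lam l nx S Y ∈ seriesIdeal J :=
  sum_mem fun _ _ => Ideal.mul_mem_right _ _
    (C_mem_seriesIdeal (J.add_mem (hlam _ _) (logI_mem hl _ _)))

variable [Algebra ℚ R] {β₀ β₁ : HSymb →ₐ[ℚ] R}

theorem Coaction.logH (h : Coaction β₀ β₁ J lam l) (p q : ℕ) :
    β₁ (logH p q) = β₀ (logH p q) + logI l p q := by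
  simp only [SymbPolylog.logH, logI, map_sum, h.log, Finset.sum_add_distrib]

/-- The logarithm changes by an element of square zero, whose exponential is linear. The summand `0`
gives the shape that `product_rule` expects. -/
theorem Coaction.expSeries (h : Coaction β₀ β₁ J lam l) (p q r : ℕ) :
    expSeries (β₁ (SymbPolylog.logH p q)) r
      = (1 + C (logI l p q) * X r) * SymbPolylog.expSeries (β₀ (SymbPolylog.logH p q)) r + 0 := by
  rw [h.logH, expSeries_add, expSeries_of_sq_eq_zero
    (h.sq _ (logI_mem h.l_mem _ _) _ (logI_mem h.l_mem _ _)), add_zero, mul_comm]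

/-- The formula of `Coaction.reg`, for words of inverted symbols. -/
def InvFormula (β₀ β₁ : HSymb →ₐ[ℚ] R) (lam : ℕ → ℕ → R) (l : ℕ → R) (S : Finset ℕ) (i e : ℕ)
    (nx : ℕ → ℕ) : Prop :=
  invSer β₁ S e = (1 + logSum l nx S) * invSer β₀ S e +
    (delSum lam nx (S.erase i) (fun p => invSer β₀ (S.erase p) e)
      - mergeSum lam l nx S fun s =>
        if nx s ∈ S then renameVar s (nx s) (invSer β₀ (S.erase (nx s)) e)
        else invSer β₀ (S.filter (· < s)) s)

/-- Apply `product_rule` twice, to the exponential, the inverted prefix and the regular suffix.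
Neither the first letter `i` nor the distinguished letter `r` is ever deleted, and `r` is not merged
with its successor. If `nx s = r`, the boundary term of the formula for the prefix is the block
without `r` in which `s` is distinguished; this accounts for the inner `if`. -/
theorem Coaction.block (h : Coaction β₀ β₁ J lam l) {S B : Finset ℕ} {e : ℕ} {nx : ℕ → ℕ}
    (hn : IsNext S e nx) (hSB : S ⊆ B) {i r : ℕ} (hi : i ∈ S) (hmin : ∀ s ∈ S, i ≤ s)
    (hr : r ∈ S) (hG : InvFormula β₀ β₁ lam l (S.filter (· < r)) i r nx) :
    blockSer β₁ B S i r e = (1 + logSum l nx S) * blockSer β₀ B S i r e +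
      (delSum lam nx ((S.erase i).erase r) (fun p => blockSer β₀ B (S.erase p) i r e)
        - mergeSum lam l nx (S.erase r) fun s =>
          if nx s ∈ S then renameVar s (nx s)
            (blockSer β₀ B (S.erase (nx s)) i (if nx s = r then s else r) e) else 0) := by
  have hir : i ≤ r := hmin r hr
  have hsub : ∀ (p : ℕ → Prop) [DecidablePred p], S.filter p ⊆ B := fun p _ =>
    (Finset.filter_subset _ _).trans hSB
  have hF := h.reg _ _ _ (hn.above r)
  have hsh : ∀ {x₀ x₁ t a : MvPowerSeries ℕ R}, x₁ = (1 + t) * x₀ + a → shiftVars B r x₁ =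
      (1 + shiftVars B r t) * shiftVars B r x₀ + shiftVars B r a := by
    rintro x₀ x₁ t a rfl
    rw [map_add, map_mul, map_add, map_one]
  have hK := fun x hx y hy => seriesIdeal_mul_eq_zero h.sq (f := x) (g := y) hx hy
  have hab : ∀ S' S'' Y Z, delSum lam nx S' Y - mergeSum lam l nx S'' Z ∈ seriesIdeal J :=
    fun _ _ _ _ => sub_mem (delSum_mem h.lam_mem _ _ _) (mergeSum_mem h.lam_mem h.l_mem _ _ _)
  have hlog : ∀ S', logSum l nx S' ∈ seriesIdeal J := logSum_mem h.l_mem nx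
  have h1 := product_rule hK (h.expSeries i e r) (hsh hG)
    (Ideal.mul_mem_right _ _ (C_mem_seriesIdeal (logI_mem h.l_mem _ _)))
    (shiftVars_mem_seriesIdeal (hlog _) _ _) (zero_mem _) (shiftVars_mem_seriesIdeal (hab _ _ _ _)
        _ _)
  have h2 := product_rule hK h1 (hsh hF)
    (add_mem (Ideal.mul_mem_right _ _ (C_mem_seriesIdeal (logI_mem h.l_mem _ _)))
      (shiftVars_mem_seriesIdeal (hlog _) _ _)) (shiftVars_mem_seriesIdeal (hlog _) _ _)
    (add_mem (Ideal.mul_mem_right _ _ (zero_mem _))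
      (Ideal.mul_mem_left _ _ (shiftVars_mem_seriesIdeal (hab _ _ _ _) _ _)))
    (shiftVars_mem_seriesIdeal (hab _ _ _ _) _ _)
  -- The shifted logarithmic terms are `l_{s→nx s} (t_s - t_r)`. Since the intervals tile `[i, e)`,
  -- the exponential supplies `l_{s→nx s} t_r` for every `s`, and all unwanted multiples of `t_r`
  -- cancel.
  have hT : C (logI l i e) * X r + shiftVars B r (logSum l nx (S.filter (· < r)))
      + shiftVars B r (logSum l nx (S.filter (r < ·))) = logSum l nx S := by
    have e1 : (C (logI l i e) : MvPowerSeries ℕ R) = ∑ s ∈ S, C (logI l s (nx s)) := by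
      rw [← map_sum, logI, ← hn.sum_Ico _ hi hmin]; rfl
    have e2 : ∀ (p : ℕ → Prop) [DecidablePred p], shiftVars B r (logSum l nx (S.filter p)) =
        ∑ s ∈ S.filter p, C (logI l s (nx s)) * (X s - X r) := fun p _ => by
      rw [logSum, map_sum]
      refine Finset.sum_congr rfl fun s hs => ?_
      rw [map_mul, shiftVars_C, shiftVars_X _ (hsub _ hs)]
    rw [e1, e2, e2, add_assoc, ← sum_erase_split, logSum, ← Finset.sum_erase_add _ _ hr,
      ← Finset.sum_erase_add _ _ hr, add_mul, Finset.sum_mul]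
    rw [add_right_comm, ← Finset.sum_add_distrib]
    congr 1
    exact Finset.sum_congr rfl fun s _ => by ring
  have hA : ∀ E F : MvPowerSeries ℕ R, F = shiftVars B r (regSer β₀ (S.filter (r < ·)) e) →
      E = SymbPolylog.expSeries (β₀ (SymbPolylog.logH i e)) r →
      E * shiftVars B r (delSum lam nx ((S.filter (· < r)).erase i)
        fun p => invSer β₀ ((S.filter (· < r)).erase p) r) * F =
      ∑ p ∈ (S.erase i).filter (· < r), C (lam p (nx p)) * blockSer β₀ B (S.erase p) i r e := by
    rintro E F rfl rfl
    rw [delSum, map_sum, Finset.mul_sum, Finset.sum_mul, filter_erase_eq]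
    refine Finset.sum_congr rfl fun p hp => ?_
    simp only [Finset.mem_erase, Finset.mem_filter] at hp
    rw [map_mul, shiftVars_C, blockSer, filter_erase_eq, filter_erase_of_not _ _ (by omega)]
    ring
  have hB : ∀ E : MvPowerSeries ℕ R,
      E * shiftVars B r (delSum lam nx (S.filter (r < ·))
        fun p => regSer β₀ ((S.filter (r < ·)).erase p) e) =
      ∑ p ∈ (S.erase i).filter (r < ·), C (lam p (nx p)) *
        (E * shiftVars B r (regSer β₀ ((S.erase p).filter (r < ·)) e)) := by
    intro E
    rw [delSum, map_sum, Finset.mul_sum, filter_erase_of_not _ _ (by omega)]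
    refine Finset.sum_congr rfl fun p hp => ?_
    rw [map_mul, shiftVars_C, filter_erase_eq]
    ring
  have hC : SymbPolylog.expSeries (β₀ (SymbPolylog.logH i e)) r *
        shiftVars B r (mergeSum lam l nx (S.filter (· < r))
          fun s => if nx s ∈ S.filter (· < r)
            then renameVar s (nx s) (invSer β₀ ((S.filter (· < r)).erase (nx s)) r)
            else invSer β₀ ((S.filter (· < r)).filter (· < s)) s) *
        shiftVars B r (regSer β₀ (S.filter (r < ·)) e) =
      ∑ s ∈ S.filter (· < r), C (lam s (nx s) + logI l s (nx s)) *
        (if nx s ∈ S then renameVar s (nx s)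
          (blockSer β₀ B (S.erase (nx s)) i (if nx s = r then s else r) e) else 0) := by
    rw [mergeSum, map_sum, Finset.mul_sum, Finset.sum_mul]
    refine Finset.sum_congr rfl fun s hs => ?_
    obtain ⟨hsS, hsr⟩ := Finset.mem_filter.1 hs
    have hle : nx s ≤ r := hn.le s hsS r hr hsr
    have hns : nx s ∈ S := by
      rcases hn.mem s hsS with h' | h'
      · exact h'
      · have := hn.lt r hr; omega
    have hsn := hn.lt_nx s hsS
    rw [map_mul, shiftVars_C, if_pos hns]
    rcases hle.lt_or_eq with hlt | heq
    · rw [if_pos (Finset.mem_filter.2 ⟨hns, hlt⟩), if_neg hlt.ne, blockSer, map_mul, map_mul,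
        renameVar_expSeries, if_neg (by omega), filter_erase_eq,
        renameVar_shiftVars (supp_invSer _ _ _) ((Finset.erase_subset _ _).trans (hsub _))
          (by omega) (hSB hns), filter_erase_of_not _ _ (by omega),
        renameVar_eq_self ((supp_regSer _ _ _).shiftVars B r) (by simp; omega)]
      ring
    -- Here `nx s = r`: in the word without `r` the distinguished letter is `s`, and renaming `t_s`
    -- to `t_r` moves both the exponential and the centre of the shifts back to `r`.
    · have e1 : (S.filter (· < r)).filter (· < s) = (S.erase r).filter (· < s) := by
        ext q; simp only [Finset.mem_filter, Finset.mem_erase]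
        constructor
        · rintro ⟨⟨_, _⟩, _⟩; exact ⟨⟨by omega, by assumption⟩, by assumption⟩
        · rintro ⟨⟨_, _⟩, _⟩; exact ⟨⟨by assumption, by omega⟩, by assumption⟩
      have e2 : (S.erase r).filter (s < ·) = S.filter (r < ·) := by
        ext q; simp only [Finset.mem_filter, Finset.mem_erase]
        constructor
        · rintro ⟨⟨h1, h2⟩, h3⟩
          have := hn.le s hsS q h2 h3
          exact ⟨h2, by omega⟩
        · rintro ⟨h1, h2⟩; exact ⟨⟨by omega, h1⟩, by omega⟩
      rw [if_neg (by simp [heq]), if_pos heq, heq, blockSer, map_mul, map_mul,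
        renameVar_expSeries, if_pos rfl, e2, ← e1,
        renameVar_shiftVars_center (supp_invSer _ _ _) (by simp),
        renameVar_shiftVars_center (supp_regSer _ _ _) (by simp; omega)]
      ring
  have hD : SymbPolylog.expSeries (β₀ (SymbPolylog.logH i e)) r *
        shiftVars B r (invSer β₀ (S.filter (· < r)) r) *
        shiftVars B r (mergeSum lam l nx (S.filter (r < ·))
          fun s => if nx s ∈ S.filter (r < ·)
            then renameVar s (nx s) (regSer β₀ ((S.filter (r < ·)).erase (nx s)) e) else 0) =
      ∑ s ∈ S.filter (r < ·), C (lam s (nx s) + logI l s (nx s)) *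
        (if nx s ∈ S then renameVar s (nx s)
          (blockSer β₀ B (S.erase (nx s)) i (if nx s = r then s else r) e) else 0) := by
    rw [mergeSum, map_sum, Finset.mul_sum]
    refine Finset.sum_congr rfl fun s hs => ?_
    obtain ⟨hsS, hsr⟩ := Finset.mem_filter.1 hs
    have hsn := hn.lt_nx s hsS
    rw [map_mul, shiftVars_C]
    by_cases hns : nx s ∈ S
    · rw [if_pos (Finset.mem_filter.2 ⟨hns, by omega⟩), if_pos hns, if_neg (by omega), blockSer,
        map_mul, map_mul, renameVar_expSeries, if_neg (by omega),
        filter_erase_of_not _ _ (by omega), filter_erase_eq,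
        renameVar_shiftVars (supp_regSer _ _ _) ((Finset.erase_subset _ _).trans (hsub _))
          (by omega) (hSB hns),
        renameVar_eq_self ((supp_invSer _ _ _).shiftVars B r) (by simp; omega)]
      ring
    · rw [if_neg hns, if_neg (by simp [hns])]
      simp
  rw [hT] at h2
  refine h2.trans ?_
  rw [← blockSer]
  congr 1
  rw [map_sub, map_sub, zero_mul, zero_add, mul_sub, sub_mul, mul_sub, hA _ _ rfl rfl, hC, hD, hB,
    delSum, mergeSum, sum_erase_split, sum_erase_split]
  have hB' : ∑ p ∈ (S.erase i).filter (r < ·), C (lam p (nx p)) *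
        (SymbPolylog.expSeries (β₀ (SymbPolylog.logH i e)) r *
          shiftVars B r (invSer β₀ (S.filter (· < r)) r) *
          shiftVars B r (regSer β₀ ((S.erase p).filter (r < ·)) e)) =
      ∑ p ∈ (S.erase i).filter (r < ·), C (lam p (nx p)) * blockSer β₀ B (S.erase p) i r e := by
    refine Finset.sum_congr rfl fun p hp => ?_
    rw [Finset.mem_filter] at hp
    rw [blockSer, filter_erase_of_not S (· < r) (by omega)]
  rw [hB']
  ring

end Coaction

end

/-! ### The deformation formula for inverted words. -/

section

open MvPowerSeries (X C)

theorem sum_erase_split_le {M : Type*} [AddCommMonoid M] (S : Finset ℕ) (r : ℕ) (f : ℕ → M) :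
    ∑ s ∈ S, f s = ∑ s ∈ S.filter (· < r), f s + ∑ s ∈ S.filter (r ≤ ·), f s := by
  rw [← Finset.sum_filter_add_sum_filter_not S (· < r)]
  simp only [not_lt]

theorem filter_lt_filter_lt (S : Finset ℕ) {s r : ℕ} (h : s ≤ r) :
    (S.filter (· < r)).filter (· < s) = S.filter (· < s) := by
  rw [Finset.filter_filter]
  exact Finset.filter_congr fun q _ => ⟨fun h' => h'.2, fun h' => ⟨by omega, h'⟩⟩

section Inversion

variable {R : Type*} [CommRing R] [Algebra ℚ R]

/-- The product of the series of the letters before and after `r`. -/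
def omitSer (β : HSymb →ₐ[ℚ] R) (S : Finset ℕ) (r e : ℕ) : MvPowerSeries ℕ R :=
  invSer β (S.filter (· < r)) r * regSer β (S.filter (r < ·)) e

/-- The product of the series of the letters before `r` and of the letters from `r` on. -/
def cutSer (β : HSymb →ₐ[ℚ] R) (S : Finset ℕ) (r e : ℕ) : MvPowerSeries ℕ R :=
  invSer β (S.filter (· < r)) r * regSer β (S.filter (r ≤ ·)) e

/-- The polar term of the inversion formula. -/
def polarSer (β : HSymb →ₐ[ℚ] R) (B S : Finset ℕ) (i r e : ℕ) : MvPowerSeries ℕ R :=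
  divVar r (omitSer β S r e - blockSer β B S i r e)

theorem X_mul_polarSer (β : HSymb →ₐ[ℚ] R) {S B : Finset ℕ} (hSB : S ⊆ B) (i r e : ℕ) :
    X r * polarSer β B S i r e = omitSer β S r e - blockSer β B S i r e :=
  X_mul_divVar_block β hSB i r e

theorem neg_invSer' (β : HSymb →ₐ[ℚ] R) {S B : Finset ℕ} (hSB : S ⊆ B) {i : ℕ} (hi : i ∈ S)
    (hmin : ∀ s ∈ S, i ≤ s) (e : ℕ) :
    -invSer β S e = ∑ r ∈ S, (cutSer β S r e - polarSer β B S i r e) :=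
  neg_invSer β hSB hi hmin e

variable {J : Ideal R} {lam : ℕ → ℕ → R} {l : ℕ → R} {β₀ β₁ : HSymb →ₐ[ℚ] R}

theorem renameVar_mul_eq_self {R : Type*} [CommRing R] {S T : Finset ℕ} {f g : MvPowerSeries ℕ R}
    (hf : Supp S f)
    (hg : Supp T g) {s : ℕ} (hs : s ∉ S) (ht : s ∉ T) (q : ℕ) : renameVar s q (f * g) = f * g := by
  rw [map_mul, renameVar_eq_self hf hs, renameVar_eq_self hg ht]

theorem IsNext.filter_erase_lt {S : Finset ℕ} {e : ℕ} {nx : ℕ → ℕ} (hn : IsNext S e nx) {s : ℕ}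
    (hs : s ∈ S) : (S.erase (nx s)).filter (· < s) = S.filter (· < s) :=
  filter_erase_of_not _ _ (by have := hn.lt_nx s hs; omega)

theorem IsNext.filter_gt {S : Finset ℕ} {e : ℕ} {nx : ℕ → ℕ} (hn : IsNext S e nx) {s : ℕ}
    (hs : s ∈ S) : S.filter (s < ·) = S.filter (nx s ≤ ·) := by
  ext q; simp only [Finset.mem_filter]
  have := hn.lt_nx s hs
  exact ⟨fun ⟨h1, h2⟩ => ⟨h1, hn.le s hs q h1 h2⟩, fun ⟨h1, h2⟩ => ⟨h1, by omega⟩⟩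

theorem IsNext.filter_erase_gt {S : Finset ℕ} {e : ℕ} {nx : ℕ → ℕ} (hn : IsNext S e nx) {s : ℕ}
    (hs : s ∈ S) : (S.erase (nx s)).filter (s < ·) = S.filter (nx s < ·) := by
  ext q; simp only [Finset.mem_filter, Finset.mem_erase]
  have := hn.lt_nx s hs
  constructor
  · rintro ⟨⟨h1, h2⟩, h3⟩
    have := hn.le s hs q h2 h3
    exact ⟨h2, by omega⟩
  · rintro ⟨h1, h2⟩; exact ⟨⟨by omega, h1⟩, by omega⟩

theorem IsNext.nx_mem_of_lt {S : Finset ℕ} {e : ℕ} {nx : ℕ → ℕ} (hn : IsNext S e nx) {s r : ℕ}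
    (hs : s ∈ S) (hr : r ∈ S) (hsr : s < r) : nx s ∈ S := by
  have := hn.le s hs r hr hsr
  have := hn.lt r hr
  rcases hn.mem s hs with h | h
  · exact h
  · omega

/-- The product rule for prefix and suffix. The letter `r` is absent, so its logarithmic term is
missing from the multiplier; in `Coaction.block` the exponential provides it. -/
theorem Coaction.omission (h : Coaction β₀ β₁ J lam l) {S : Finset ℕ} {e : ℕ} {nx : ℕ → ℕ}
    (hn : IsNext S e nx) {i r : ℕ} (hmin : ∀ s ∈ S, i ≤ s)
    (hr : r ∈ S) (hG : InvFormula β₀ β₁ lam l (S.filter (· < r)) i r nx) :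
    omitSer β₁ S r e = (1 + (logSum l nx S - C (logI l r (nx r)) * X r)) * omitSer β₀ S r e +
      (delSum lam nx ((S.erase i).erase r) (fun p => omitSer β₀ (S.erase p) r e)
        - mergeSum lam l nx (S.erase r) fun s =>
          if nx s ∈ S then renameVar s (nx s)
            (omitSer β₀ (S.erase (nx s)) (if nx s = r then s else r) e) else 0) := by
  have hir : i ≤ r := hmin r hr
  have hK := fun x hx y hy => seriesIdeal_mul_eq_zero h.sq (f := x) (g := y) hx hy
  have hab : ∀ S' S'' Y Z, delSum lam nx S' Y - mergeSum lam l nx S'' Z ∈ seriesIdeal J :=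
    fun _ _ _ _ => sub_mem (delSum_mem h.lam_mem _ _ _) (mergeSum_mem h.lam_mem h.l_mem _ _ _)
  have hlog : ∀ S', logSum l nx S' ∈ seriesIdeal J := logSum_mem h.l_mem nx
  have h1 := product_rule hK hG (h.reg _ _ _ (hn.above r)) (hlog _) (hlog _) (hab _ _ _ _)
    (hab _ _ _ _)
  have hT : logSum l nx (S.filter (· < r)) + logSum l nx (S.filter (r < ·))
      = logSum l nx S - C (logI l r (nx r)) * X r := by
    rw [logSum, logSum, logSum, ← sum_erase_split, ← Finset.sum_erase_add _ _ hr,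
        add_sub_cancel_right]
  rw [hT] at h1
  refine h1.trans ?_
  rw [← omitSer]
  congr 1
  rw [delSum, delSum, mergeSum, mergeSum, delSum, mergeSum, sum_erase_split (S.erase i),
    sum_erase_split S, sub_mul, mul_sub, filter_erase_eq, filter_erase_of_not _ (r < ·) (by omega)]
  simp only [Finset.mul_sum, Finset.sum_mul]
  have hA : ∀ p ∈ (S.filter (· < r)).erase i, C (lam p (nx p)) *
      invSer β₀ ((S.filter (· < r)).erase p) r * regSer β₀ (S.filter (r < ·)) e
      = C (lam p (nx p)) * omitSer β₀ (S.erase p) r e := by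
    intro p hp
    simp only [Finset.mem_erase, Finset.mem_filter] at hp
    rw [omitSer, filter_erase_eq, filter_erase_of_not _ _ (by omega), mul_assoc]
  have hB : ∀ p ∈ S.filter (r < ·), invSer β₀ (S.filter (· < r)) r *
      (C (lam p (nx p)) * regSer β₀ ((S.filter (r < ·)).erase p) e)
      = C (lam p (nx p)) * omitSer β₀ (S.erase p) r e := by
    intro p hp
    rw [Finset.mem_filter] at hp
    rw [omitSer, filter_erase_of_not _ _ (by omega), filter_erase_eq]
    ring
  have hC : ∀ s ∈ S.filter (· < r), C (lam s (nx s) + logI l s (nx s)) *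
      (if nx s ∈ S.filter (· < r)
        then renameVar s (nx s) (invSer β₀ ((S.filter (· < r)).erase (nx s)) r)
        else invSer β₀ ((S.filter (· < r)).filter (· < s)) s) * regSer β₀ (S.filter (r < ·)) e =
      C (lam s (nx s) + logI l s (nx s)) * (if nx s ∈ S then renameVar s (nx s)
        (omitSer β₀ (S.erase (nx s)) (if nx s = r then s else r) e) else 0) := by
    intro s hs
    obtain ⟨hsS, hsr⟩ := Finset.mem_filter.1 hs
    have hle : nx s ≤ r := hn.le s hsS r hr hsr
    have hns := hn.nx_mem_of_lt hsS hr hsr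
    rw [if_pos hns, mul_assoc]
    congr 1
    rcases hle.lt_or_eq with hlt | heq
    · rw [if_pos (Finset.mem_filter.2 ⟨hns, hlt⟩), if_neg hlt.ne, omitSer, map_mul,
        filter_erase_eq, filter_erase_of_not _ _ (by omega),
        renameVar_eq_self (supp_regSer _ _ _) (by simp; omega)]
    · rw [if_neg (by simp [heq]), if_pos heq, omitSer, hn.filter_erase_lt hsS,
        hn.filter_erase_gt hsS, renameVar_mul_eq_self (supp_invSer _ _ _) (supp_regSer _ _ _)
          (by simp) (by simp; omega), heq, filter_lt_filter_lt S hsr.le]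
  have hD : ∀ s ∈ S.filter (r < ·), invSer β₀ (S.filter (· < r)) r *
      (C (lam s (nx s) + logI l s (nx s)) * (if nx s ∈ S.filter (r < ·)
        then renameVar s (nx s) (regSer β₀ ((S.filter (r < ·)).erase (nx s)) e) else 0)) =
      C (lam s (nx s) + logI l s (nx s)) * (if nx s ∈ S then renameVar s (nx s)
        (omitSer β₀ (S.erase (nx s)) (if nx s = r then s else r) e) else 0) := by
    intro s hs
    obtain ⟨hsS, hsr⟩ := Finset.mem_filter.1 hs
    have hsn := hn.lt_nx s hsS
    by_cases hns : nx s ∈ S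
    · rw [if_pos (Finset.mem_filter.2 ⟨hns, by omega⟩), if_pos hns, if_neg (by omega), omitSer,
        map_mul, filter_erase_of_not _ _ (by omega), filter_erase_eq,
        renameVar_eq_self (supp_invSer _ _ _) (by simp; omega)]
      ring
    · rw [if_neg hns, if_neg (by simp [hns])]
      simp
  rw [Finset.sum_congr rfl hA, Finset.sum_congr rfl hB, Finset.sum_congr rfl hC,
    Finset.sum_congr rfl hD]
  ring

/-- Now `r` begins the regular suffix, and omissions appear in two ways: deletion of `r` leaves the
omission at `r`, while the boundary term of the prefix, for `nx s = r`, is the omission at `s`.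
`Coaction.inv` balances these against the omissions that the polar terms contribute. -/
theorem Coaction.cut (h : Coaction β₀ β₁ J lam l) {S : Finset ℕ} {e : ℕ} {nx : ℕ → ℕ}
    (hn : IsNext S e nx) {i r : ℕ} (hmin : ∀ s ∈ S, i ≤ s)
    (hr : r ∈ S) (hG : InvFormula β₀ β₁ lam l (S.filter (· < r)) i r nx) :
    cutSer β₁ S r e = (1 + logSum l nx S) * cutSer β₀ S r e +
      ((delSum lam nx ((S.erase i).erase r) (fun p => cutSer β₀ (S.erase p) r e)
          + C (lam r (nx r)) * omitSer β₀ S r e)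
        - mergeSum lam l nx S fun s =>
          if nx s ∈ S then if nx s = r then omitSer β₀ S s e else renameVar s (nx s)
            (cutSer β₀ (S.erase (nx s)) r e) else 0) := by
  have hir : i ≤ r := hmin r hr
  have hK := fun x hx y hy => seriesIdeal_mul_eq_zero h.sq (f := x) (g := y) hx hy
  have hab : ∀ S' S'' Y Z, delSum lam nx S' Y - mergeSum lam l nx S'' Z ∈ seriesIdeal J :=
    fun _ _ _ _ => sub_mem (delSum_mem h.lam_mem _ _ _) (mergeSum_mem h.lam_mem h.l_mem _ _ _)
  have hlog : ∀ S', logSum l nx S' ∈ seriesIdeal J := logSum_mem h.l_mem nx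
  have h1 := product_rule hK hG (h.reg _ _ _ (hn.aboveEq r)) (hlog _) (hlog _) (hab _ _ _ _)
    (hab _ _ _ _)
  have hT : logSum l nx (S.filter (· < r)) + logSum l nx (S.filter (r ≤ ·))
      = logSum l nx S := by
    rw [logSum, logSum, logSum, ← sum_erase_split_le]
  rw [hT] at h1
  refine h1.trans ?_
  rw [← cutSer]
  congr 1
  have hge : (S.filter (r ≤ ·)).erase r = S.filter (r < ·) := by
    ext q; simp only [Finset.mem_erase, Finset.mem_filter]
    exact ⟨fun ⟨_, _, _⟩ => ⟨by assumption, by omega⟩, fun ⟨_, _⟩ => ⟨by omega, by assumption,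
        by omega⟩⟩
  have hrm : r ∈ S.filter (r ≤ ·) := by simp [hr]
  rw [delSum, delSum, mergeSum, mergeSum, delSum, mergeSum, sum_erase_split (S.erase i),
    sum_erase_split_le S r (fun s => C (lam s (nx s) + logI l s (nx s)) * _),
    sub_mul, mul_sub, filter_erase_eq, filter_erase_of_not _ (r < ·) (by omega),
    ← Finset.sum_erase_add (S.filter (r ≤ ·)) _ hrm, hge]
  simp only [Finset.mul_sum, Finset.sum_mul, mul_add]
  have hA : ∀ p ∈ (S.filter (· < r)).erase i, C (lam p (nx p)) *
      invSer β₀ ((S.filter (· < r)).erase p) r * regSer β₀ (S.filter (r ≤ ·)) e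
      = C (lam p (nx p)) * cutSer β₀ (S.erase p) r e := by
    intro p hp
    simp only [Finset.mem_erase, Finset.mem_filter] at hp
    rw [cutSer, filter_erase_eq, filter_erase_of_not _ _ (by omega), mul_assoc]
  have hB : ∀ p ∈ S.filter (r < ·), invSer β₀ (S.filter (· < r)) r *
      (C (lam p (nx p)) * regSer β₀ ((S.filter (r ≤ ·)).erase p) e)
      = C (lam p (nx p)) * cutSer β₀ (S.erase p) r e := by
    intro p hp
    rw [Finset.mem_filter] at hp
    rw [cutSer, filter_erase_of_not _ _ (by omega), filter_erase_eq]
    ring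
  have hC : ∀ s ∈ S.filter (· < r), C (lam s (nx s) + logI l s (nx s)) *
      (if nx s ∈ S.filter (· < r)
        then renameVar s (nx s) (invSer β₀ ((S.filter (· < r)).erase (nx s)) r)
        else invSer β₀ ((S.filter (· < r)).filter (· < s)) s) * regSer β₀ (S.filter (r ≤ ·)) e =
      C (lam s (nx s) + logI l s (nx s)) * (if nx s ∈ S then
        if nx s = r then omitSer β₀ S s e else renameVar s (nx s)
            (cutSer β₀ (S.erase (nx s)) r e) else 0) := by
    intro s hs
    obtain ⟨hsS, hsr⟩ := Finset.mem_filter.1 hs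
    have hle : nx s ≤ r := hn.le s hsS r hr hsr
    have hns := hn.nx_mem_of_lt hsS hr hsr
    rw [if_pos hns, mul_assoc]
    congr 1
    rcases hle.lt_or_eq with hlt | heq
    · rw [if_pos (Finset.mem_filter.2 ⟨hns, hlt⟩), if_neg hlt.ne, cutSer, map_mul,
        filter_erase_eq, filter_erase_of_not _ _ (by omega),
        renameVar_eq_self (supp_regSer _ _ _) (by simp; omega)]
    · rw [if_neg (by simp [heq]), if_pos heq, omitSer, hn.filter_gt hsS, heq,
        filter_lt_filter_lt S hsr.le]
  have hD : ∀ s ∈ S.filter (r ≤ ·), invSer β₀ (S.filter (· < r)) r *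
      (C (lam s (nx s) + logI l s (nx s)) * (if nx s ∈ S.filter (r ≤ ·)
        then renameVar s (nx s) (regSer β₀ ((S.filter (r ≤ ·)).erase (nx s)) e) else 0)) =
      C (lam s (nx s) + logI l s (nx s)) * (if nx s ∈ S then
        if nx s = r then omitSer β₀ S s e else renameVar s (nx s)
            (cutSer β₀ (S.erase (nx s)) r e) else 0) := by
    intro s hs
    obtain ⟨hsS, hsr⟩ := Finset.mem_filter.1 hs
    have hsn := hn.lt_nx s hsS
    by_cases hns : nx s ∈ S
    · rw [if_pos (Finset.mem_filter.2 ⟨hns, by omega⟩), if_pos hns, if_neg (by omega), cutSer,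
        map_mul, filter_erase_of_not _ _ (by omega), filter_erase_eq,
        renameVar_eq_self (supp_invSer _ _ _) (by simp; omega)]
      ring
    · rw [if_neg hns, if_neg (by simp [hns])]
      simp
  rw [Finset.sum_congr rfl hA, Finset.sum_congr rfl hB, Finset.sum_congr rfl hC,
    Finset.sum_congr rfl hD, omitSer]
  ring

/-- Multiply by `t_r` and subtract the formula for the block from that for the omission. Their
multipliers differ by `l_{r→nx r} t_r`, which after division by `t_r` is a regular multiple of the
omission. -/
theorem Coaction.polar (h : Coaction β₀ β₁ J lam l) {S B : Finset ℕ} {e : ℕ} {nx : ℕ → ℕ}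
    (hn : IsNext S e nx) (hSB : S ⊆ B) {i r : ℕ} (hi : i ∈ S) (hmin : ∀ s ∈ S, i ≤ s)
    (hr : r ∈ S) (hG : InvFormula β₀ β₁ lam l (S.filter (· < r)) i r nx) :
    polarSer β₁ B S i r e = (1 + logSum l nx S) * polarSer β₀ B S i r e +
      (delSum lam nx ((S.erase i).erase r) (fun p => polarSer β₀ B (S.erase p) i r e)
          - C (logI l r (nx r)) * omitSer β₀ S r e
        - mergeSum lam l nx (S.erase r) fun s =>
          if nx s ∈ S then renameVar s (nx s)
            (polarSer β₀ B (S.erase (nx s)) i (if nx s = r then s else r) e) else 0) := by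
  apply X_mul_cancel (j := r)
  rw [X_mul_polarSer _ hSB, h.omission hn hmin hr hG, h.block hn hSB hi hmin hr hG]
  have h1 : X r * delSum lam nx ((S.erase i).erase r) (fun p => polarSer β₀ B (S.erase p) i r e)
      = delSum lam nx ((S.erase i).erase r) (fun p => omitSer β₀ (S.erase p) r e)
        - delSum lam nx ((S.erase i).erase r) (fun p => blockSer β₀ B (S.erase p) i r e) := by
    rw [delSum, delSum, delSum, Finset.mul_sum, ← Finset.sum_sub_distrib]
    refine Finset.sum_congr rfl fun p _ => ?_
    rw [mul_left_comm, X_mul_polarSer _ ((Finset.erase_subset _ _).trans hSB), mul_sub]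
  have h2 : X r * (mergeSum lam l nx (S.erase r) fun s =>
          if nx s ∈ S then renameVar s (nx s)
            (polarSer β₀ B (S.erase (nx s)) i (if nx s = r then s else r) e) else 0)
      = (mergeSum lam l nx (S.erase r) fun s =>
          if nx s ∈ S then renameVar s (nx s)
            (omitSer β₀ (S.erase (nx s)) (if nx s = r then s else r) e) else 0)
        - mergeSum lam l nx (S.erase r) fun s =>
          if nx s ∈ S then renameVar s (nx s)
            (blockSer β₀ B (S.erase (nx s)) i (if nx s = r then s else r) e) else 0 := by
    rw [mergeSum, mergeSum, mergeSum, Finset.mul_sum, ← Finset.sum_sub_distrib]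
    refine Finset.sum_congr rfl fun s hs => ?_
    rw [mul_left_comm, ← mul_sub]
    congr 1
    split_ifs with hns hsr
    -- The merged word has `s` in place of `r`, so its denominator is `t_s`, which the renaming
    -- turns into `t_r`.
    · have : (X r : MvPowerSeries ℕ R) = renameVar s (nx s) (X s) := by rw [renameVar_X_self, hsr]
      rw [this, ← map_mul, X_mul_polarSer _ ((Finset.erase_subset _ _).trans hSB), map_sub]
    · have : (X r : MvPowerSeries ℕ R) = renameVar s (nx s) (X r) := by
        rw [renameVar_X, if_neg (Finset.ne_of_mem_erase hs).symm]
      rw [this, ← map_mul, X_mul_polarSer _ ((Finset.erase_subset _ _).trans hSB), map_sub]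
    · rw [mul_zero, sub_zero]
  have h3 := X_mul_polarSer β₀ hSB i r e
  linear_combination -h1 + h2 - (1 + logSum l nx S) * h3

/-- Induct on the number of letters and insert the formulas for cut and polar terms into the
recursion. The terms with a deleted or merged letter reassemble, by the recursion for the shorter
words, to inverted words. Deletions from cuts give `lam` times omissions and polar terms give `l`
times omissions; together they match the coefficients `lam + l` of the merge terms. -/
theorem Coaction.inv (h : Coaction β₀ β₁ J lam l) {S : Finset ℕ} {e : ℕ} {nx : ℕ → ℕ}
    (hn : IsNext S e nx) {i : ℕ} (hi : S.Nonempty → i ∈ S) (hmin : ∀ s ∈ S, i ≤ s) :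
    InvFormula β₀ β₁ lam l S i e nx := by
  induction hcard : S.card using Nat.strong_induction_on generalizing S e with
  | _ n ih =>
  rcases S.eq_empty_or_nonempty with rfl | hne
  · simp [InvFormula, logSum, delSum, mergeSum]
  replace hi := hi hne
  have hG : ∀ r ∈ S, InvFormula β₀ β₁ lam l (S.filter (· < r)) i r nx := fun r hr =>
    ih _ (hcard ▸ Finset.card_lt_card (Finset.filter_ssubset.2 ⟨r, hr, lt_irrefl _⟩))
      (hn.below (Or.inl hr))
      (fun ⟨q, hq⟩ => by
        rw [Finset.mem_filter] at hq ⊢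
        exact ⟨hi, (hmin q hq.1).trans_lt hq.2⟩)
      (fun s hs => hmin s (Finset.mem_filter.1 hs).1) rfl
  have hsum : ∀ β : HSymb →ₐ[ℚ] R, -invSer β S e = ∑ r ∈ S, (cutSer β S r e - polarSer β S S i r e)
      :=
    fun β => neg_invSer' β subset_rfl hi hmin e
  have hdel : ∀ p ∈ S.erase i, -invSer β₀ (S.erase p) e =
      ∑ r ∈ S.erase p, (cutSer β₀ (S.erase p) r e - polarSer β₀ S (S.erase p) i r e) := fun p hp =>
    neg_invSer' β₀ (Finset.erase_subset _ _)
      (Finset.mem_erase.2 ⟨(Finset.ne_of_mem_erase hp).symm, hi⟩)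
      (fun s hs => hmin s (Finset.mem_of_mem_erase hs)) e
  -- For a fixed deleted letter `p`, the index `r` runs through the letters of the word without `p`,
  -- so the recursion for that word applies.
  have hD : ∑ r ∈ S, ∑ p ∈ (S.erase i).erase r, C (lam p (nx p)) *
      (cutSer β₀ (S.erase p) r e - polarSer β₀ S (S.erase p) i r e) =
      - delSum lam nx (S.erase i) fun p => invSer β₀ (S.erase p) e := by
    have : ∀ r p, (r ∈ S ∧ p ∈ (S.erase i).erase r) ↔ (r ∈ S.erase p ∧ p ∈ S.erase i) := by
      intro r p; simp only [Finset.mem_erase]; tauto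
    rw [Finset.sum_comm' this, delSum, ← Finset.sum_neg_distrib]
    refine Finset.sum_congr rfl fun p hp => ?_
    rw [← Finset.mul_sum, ← hdel p hp, mul_neg]
  -- Fix `s` and let `r` vary. The cut terms with `r ≠ nx s` run over the merged word, and `r = nx
  -- s` adds an omission. Among the polar terms `r = s` does not occur, and `r = nx s` supplies the
  -- polar term of the merged word at `s`.
  have hM : ∑ r ∈ S, ((mergeSum lam l nx S fun s =>
          if nx s ∈ S then if nx s = r then omitSer β₀ S s e else renameVar s (nx s)
            (cutSer β₀ (S.erase (nx s)) r e) else 0)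
        - mergeSum lam l nx (S.erase r) fun s =>
          if nx s ∈ S then renameVar s (nx s)
            (polarSer β₀ S (S.erase (nx s)) i (if nx s = r then s else r) e) else 0) =
      mergeSum lam l nx S fun s => if nx s ∈ S then omitSer β₀ S s e
        - renameVar s (nx s) (invSer β₀ (S.erase (nx s)) e) else 0 := by
    rw [Finset.sum_sub_distrib]
    simp only [mergeSum]
    have : ∀ r s, (r ∈ S ∧ s ∈ S.erase r) ↔ (r ∈ S.erase s ∧ s ∈ S) := by
      intro r p; simp only [Finset.mem_erase]; tauto
    rw [Finset.sum_comm, Finset.sum_comm' this, ← Finset.sum_sub_distrib]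
    refine Finset.sum_congr rfl fun s hs => ?_
    rw [← Finset.mul_sum, ← Finset.mul_sum, ← mul_sub]
    congr 1
    by_cases hns : nx s ∈ S
    swap
    · simp [hns]
    simp only [if_pos hns]
    have hsn := hn.lt_nx s hs
    have hni : nx s ≠ i := by have := hmin s hs; omega
    have h1 : nx s ∈ S.erase s := Finset.mem_erase.2 ⟨by omega, hns⟩
    have h2 : s ∈ S.erase (nx s) := Finset.mem_erase.2 ⟨by omega, hs⟩
    rw [sub_eq_add_neg (omitSer _ _ _ _), ← map_neg, hdel _ (Finset.mem_erase.2 ⟨hni, hns⟩),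
      map_sum, ← Finset.sum_erase_add S _ hns, if_pos rfl, ← Finset.sum_erase_add _ _ h1,
          if_pos rfl,
      ← Finset.sum_erase_add _ _ h2, ← Finset.sum_erase_add (S.erase (nx s)) _ h2,
      if_neg (by omega), Finset.erase_right_comm (a := s)]
    have h3 : ∀ f g : ℕ → MvPowerSeries ℕ R,
        ∑ r ∈ (S.erase (nx s)).erase s, (if nx s = r then f r else g r)
          = ∑ r ∈ (S.erase (nx s)).erase s, g r := fun f g =>
      Finset.sum_congr rfl fun r hr => if_neg
        (Finset.ne_of_mem_erase (Finset.mem_of_mem_erase hr)).symm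
    have h4 : ∑ r ∈ (S.erase (nx s)).erase s, renameVar s (nx s)
          (polarSer β₀ S (S.erase (nx s)) i (if nx s = r then s else r) e)
        = ∑ r ∈ (S.erase (nx s)).erase s, renameVar s (nx s)
          (polarSer β₀ S (S.erase (nx s)) i r e) :=
      Finset.sum_congr rfl fun r hr => by
        rw [if_neg (Finset.ne_of_mem_erase (Finset.mem_of_mem_erase hr)).symm]
    rw [h3, h4]
    simp only [map_sub, Finset.sum_sub_distrib]
    ring
  -- All omissions cancel except the one at the last letter, which is the inverted word of the
  -- letters before it. This is the boundary term of `InvFormula`.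
  have hO : ∑ s ∈ S, C (lam s (nx s) + logI l s (nx s)) * omitSer β₀ S s e
      - (mergeSum lam l nx S fun s => if nx s ∈ S then omitSer β₀ S s e
        - renameVar s (nx s) (invSer β₀ (S.erase (nx s)) e) else 0) =
      mergeSum lam l nx S fun s =>
        if nx s ∈ S then renameVar s (nx s) (invSer β₀ (S.erase (nx s)) e)
        else invSer β₀ (S.filter (· < s)) s := by
    rw [mergeSum, mergeSum, ← Finset.sum_sub_distrib]
    refine Finset.sum_congr rfl fun s hs => ?_
    rw [← mul_sub]
    congr 1
    split_ifs with hns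
    · rw [sub_sub_cancel]
    · have : S.filter (s < ·) = ∅ := by
        rw [Finset.filter_eq_empty_iff]
        intro q hq hsq
        exact hns (hn.nx_mem_of_lt hs hq hsq)
      rw [sub_zero, omitSer, this, regSer_empty, mul_one]
  have key : -invSer β₁ S e = (1 + logSum l nx S) * -invSer β₀ S e
      - (delSum lam nx (S.erase i) fun p => invSer β₀ (S.erase p) e)
      + (mergeSum lam l nx S fun s =>
        if nx s ∈ S then renameVar s (nx s) (invSer β₀ (S.erase (nx s)) e)
        else invSer β₀ (S.filter (· < s)) s) := by
    rw [← hO, ← hM, hsum β₁, hsum β₀, sub_eq_add_neg _ (delSum _ _ _ _), ← hD, Finset.mul_sum,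
      ← Finset.sum_add_distrib, ← Finset.sum_sub_distrib, ← Finset.sum_add_distrib]
    refine Finset.sum_congr rfl fun r hr => ?_
    rw [h.cut hn hmin hr (hG r hr), h.polar hn subset_rfl hi hmin hr (hG r hr)]
    simp only [mul_sub, Finset.sum_sub_distrib, map_add, delSum]
    ring
  rw [InvFormula]
  linear_combination -key

end Inversion

end

/-! ### The deformation formula for the coproduct sum, and evaluation at counits. -/

section

open MvPowerSeries (X C)

section Coproduct

variable {R : Type*} [CommRing R] [Algebra ℚ R]

/-- The sum over all ways to extend the pairs `(i, a i)`, `i ∈ I`, by pairs `(i_α, t_{j_α})` with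
`i_α, j_α ∈ S` as in the coproduct formula; the value of the left factor is given by `Ψ`. -/
def copSer (Ψ : Finset ℕ → (ℕ → MvPowerSeries ℕ R) → MvPowerSeries ℕ R) (β : HSymb →ₐ[ℚ] R)
    (B S : Finset ℕ) (e : ℕ) (I : Finset ℕ) (a : ℕ → MvPowerSeries ℕ R) : MvPowerSeries ℕ R :=
  regSer β S e * Ψ I a + ∑ i ∈ S.attach, ∑ j ∈ S.filter (i.1 ≤ ·),
    copSer Ψ β B (S.filter (· < i.1)) i.1 (insert i.1 I) (Function.update a i.1 (X j))
      * blockSer β B (S.filter (i.1 ≤ ·)) i.1 j e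
termination_by S.card
decreasing_by
  exact Finset.card_lt_card (Finset.filter_ssubset.2 ⟨i.1, i.2, lt_irrefl _⟩)

variable {Ψ : Finset ℕ → (ℕ → MvPowerSeries ℕ R) → MvPowerSeries ℕ R}

/-- The summand of `copSer` that belongs to the last block. -/
def copTerm (Ψ : Finset ℕ → (ℕ → MvPowerSeries ℕ R) → MvPowerSeries ℕ R) (β : HSymb →ₐ[ℚ] R)
    (B S : Finset ℕ) (e : ℕ) (I : Finset ℕ) (a : ℕ → MvPowerSeries ℕ R) (i j : ℕ) :
    MvPowerSeries ℕ R :=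
  copSer Ψ β B (S.filter (· < i)) i (insert i I) (Function.update a i (X j))
    * blockSer β B (S.filter (i ≤ ·)) i j e

theorem copSer_eq (β : HSymb →ₐ[ℚ] R) (B S : Finset ℕ) (e : ℕ) (I : Finset ℕ)
    (a : ℕ → MvPowerSeries ℕ R) : copSer Ψ β B S e I a = regSer β S e * Ψ I a +
      ∑ i ∈ S, ∑ j ∈ S.filter (i ≤ ·), copTerm Ψ β B S e I a i j := by
  rw [copSer, ← Finset.sum_attach S]
  rfl

/-- Compatibility of a family `Ψ` with changes of variables. -/
def Renames (Ψ : Finset ℕ → (ℕ → MvPowerSeries ℕ R) → MvPowerSeries ℕ R) : Prop :=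
  ∀ s q I a, (∀ i, MvPowerSeries.constantCoeff (a i) = 0) →
    renameVar s q (Ψ I a) = Ψ I fun i => renameVar s q (a i)

theorem constantCoeff_update {R : Type*} [CommRing R] {a : ℕ → MvPowerSeries ℕ R}
    (ha : ∀ i, MvPowerSeries.constantCoeff (a i) = 0) (i j x : ℕ) :
    MvPowerSeries.constantCoeff (Function.update a i (X j) x) = 0 := by
  rw [Function.update_apply]
  split_ifs <;> simp [ha]

theorem renameVar_update {R : Type*} [CommRing R] (s q : ℕ) (a : ℕ → MvPowerSeries ℕ R) (i j : ℕ) :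
    (fun x => renameVar s q (Function.update a i (X j) x)) =
      Function.update (fun x => renameVar s q (a x)) i (X (if j = s then q else j)) := by
  funext x
  rw [Function.update_apply, Function.update_apply]
  split_ifs with h1 h2
  · rw [h2, renameVar_X_self]
  · rw [renameVar_X, if_neg h2]
  · rfl

/-- Blocks and the initial regular word involve only variables of `S`, so a variable outside `S` can
enter only through `a`. -/
theorem renameVar_copSer (hΨ : Renames Ψ) (β : HSymb →ₐ[ℚ] R) {B S : Finset ℕ} (e : ℕ)
    (I : Finset ℕ) {a : ℕ → MvPowerSeries ℕ R}
    (ha : ∀ i, MvPowerSeries.constantCoeff (a i) = 0) {s : ℕ} (hs : s ∉ S) (q : ℕ) :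
    renameVar s q (copSer Ψ β B S e I a) = copSer Ψ β B S e I fun i => renameVar s q (a i) := by
  induction hcard : S.card using Nat.strong_induction_on generalizing S e I a with
  | _ n ih =>
  rw [copSer_eq, copSer_eq, map_add, map_mul, hΨ _ _ _ _ ha,
    renameVar_eq_self (supp_regSer _ _ _) hs, map_sum]
  congr 1
  refine Finset.sum_congr rfl fun i hi => ?_
  rw [map_sum]
  refine Finset.sum_congr rfl fun j hj => ?_
  rw [copTerm, copTerm, map_mul, renameVar_eq_self (supp_blockSer _ hj) (by simp [hs]),
    ih _ (hcard ▸ Finset.card_lt_card (Finset.filter_ssubset.2 ⟨i, hi, lt_irrefl _⟩)) i _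
      (constantCoeff_update ha i j) (by simp [hs]) rfl, renameVar_update, if_neg]
  rintro rfl
  exact hs (Finset.mem_filter.1 hj).1

variable {J : Ideal R} {lam : ℕ → ℕ → R} {l : ℕ → R} {β₀ β₁ : HSymb →ₐ[ℚ] R}

/-- The formula of `Coaction.reg`, for `copSer`. -/
def CopFormula (Ψ : Finset ℕ → (ℕ → MvPowerSeries ℕ R) → MvPowerSeries ℕ R)
    (β₀ β₁ : HSymb →ₐ[ℚ] R) (lam : ℕ → ℕ → R) (l : ℕ → R) (nx : ℕ → ℕ) (B S : Finset ℕ) (e : ℕ)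
    (I : Finset ℕ) (a : ℕ → MvPowerSeries ℕ R) : Prop :=
  copSer Ψ β₁ B S e I a = (1 + logSum l nx S) * copSer Ψ β₀ B S e I a +
    (delSum lam nx S (fun p => copSer Ψ β₀ B (S.erase p) e I a)
      - mergeSum lam l nx S fun s =>
        if nx s ∈ S then renameVar s (nx s) (copSer Ψ β₀ B (S.erase (nx s)) e I a) else 0)

theorem logSum_split {R : Type*} [CommRing R] {l : ℕ → R} (nx : ℕ → ℕ) (S : Finset ℕ) (i : ℕ) :
    logSum l nx (S.filter (· < i)) + logSum l nx (S.filter (i ≤ ·)) = logSum l nx S := by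
  rw [logSum, logSum, logSum, ← sum_erase_split_le]

/-- The product rule for the last block and everything before it. A merge across the border of the
block, `nx s = i`, contributes nothing: the part before the block ends at `i`, and the merge term of
its last letter is zero. The hypothesis `hfix` makes earlier choices of variables insensitive to
renaming. -/
theorem Coaction.copTerm (h : Coaction β₀ β₁ J lam l) (hΨ : Renames Ψ) {B S : Finset ℕ} {e : ℕ}
    {nx : ℕ → ℕ} (hn : IsNext S e nx) (hSB : S ⊆ B) (I : Finset ℕ) {a : ℕ → MvPowerSeries ℕ R}
    (ha : ∀ i, MvPowerSeries.constantCoeff (a i) = 0)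
    (hfix : ∀ s ∈ S, ∀ q x, renameVar s q (a x) = a x) {i j : ℕ} (hi : i ∈ S)
    (hj : j ∈ S.filter (i ≤ ·))
    (hP : CopFormula Ψ β₀ β₁ lam l nx B (S.filter (· < i)) i (insert i I)
      (Function.update a i (X j))) :
    copTerm Ψ β₁ B S e I a i j = (1 + logSum l nx S) * copTerm Ψ β₀ B S e I a i j +
      (delSum lam nx ((S.erase i).erase j) (fun p => copTerm Ψ β₀ B (S.erase p) e I a i j)
        - mergeSum lam l nx (S.erase j) fun s =>
          if nx s ∈ S ∧ nx s ≠ i then renameVar s (nx s)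
            (copTerm Ψ β₀ B (S.erase (nx s)) e I a i (if nx s = j then s else j)) else 0) := by
  have hK := fun x hx y hy => seriesIdeal_mul_eq_zero h.sq (f := x) (g := y) hx hy
  have hab : ∀ S' S'' Y Z, delSum lam nx S' Y - mergeSum lam l nx S'' Z ∈ seriesIdeal J :=
    fun _ _ _ _ => sub_mem (delSum_mem h.lam_mem _ _ _) (mergeSum_mem h.lam_mem h.l_mem _ _ _)
  have hlog : ∀ S', logSum l nx S' ∈ seriesIdeal J := logSum_mem h.l_mem nx
  obtain ⟨hjS, hij⟩ := Finset.mem_filter.1 hj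
  have hn' := hn.aboveEq i
  have hi' : i ∈ S.filter (i ≤ ·) := Finset.mem_filter.2 ⟨hi, le_rfl⟩
  have hmin : ∀ s ∈ S.filter (i ≤ ·), i ≤ s := fun s hs => (Finset.mem_filter.1 hs).2
  have hG : InvFormula β₀ β₁ lam l ((S.filter (i ≤ ·)).filter (· < j)) i j nx :=
    h.inv (hn'.below (Or.inl hj))
      (fun ⟨q, hq⟩ => by
        obtain ⟨hq, hqj⟩ := Finset.mem_filter.1 hq
        exact Finset.mem_filter.2 ⟨hi', (hmin q hq).trans_lt hqj⟩)
      (fun s hs => hmin s (Finset.mem_filter.1 hs).1)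
  have hb := h.block hn' ((Finset.filter_subset _ _).trans hSB) hi' hmin hj hG
  have h1 := product_rule hK hP hb (hlog _) (hlog _) (hab _ _ _ _) (hab _ _ _ _)
  rw [logSum_split] at h1
  refine h1.trans ?_
  rw [← SymbPolylog.copTerm]
  congr 1
  have hge : (S.filter (i ≤ ·)).erase j = (S.erase j).filter (i ≤ ·) := (filter_erase_eq _ _ _).symm
  have hlt : S.filter (· < i) = (S.erase j).filter (· < i) :=
    (filter_erase_of_not _ _ (by omega)).symm
  have hlt' : ((S.erase i).erase j).filter (· < i) = S.filter (· < i) := by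
    rw [filter_erase_of_not _ _ (by omega), filter_erase_of_not _ _ (by omega)]
  have hge' : ((S.erase i).erase j).filter (i ≤ ·) = ((S.filter (i ≤ ·)).erase i).erase j := by
    rw [filter_erase_eq, filter_erase_eq]
  rw [delSum, delSum, mergeSum, mergeSum, delSum, mergeSum,
    sum_erase_split_le ((S.erase i).erase j) i, sum_erase_split_le (S.erase j) i, hlt', hge',
    ← hlt, ← hge, sub_mul, mul_sub]
  simp only [Finset.mul_sum, Finset.sum_mul]
  have hA : ∀ p ∈ S.filter (· < i), C (lam p (nx p)) *
      copSer Ψ β₀ B ((S.filter (· < i)).erase p) i (insert i I) (Function.update a i (X j)) *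
        blockSer β₀ B (S.filter (i ≤ ·)) i j e
      = C (lam p (nx p)) * SymbPolylog.copTerm Ψ β₀ B (S.erase p) e I a i j := by
    intro p hp
    rw [Finset.mem_filter] at hp
    rw [SymbPolylog.copTerm, filter_erase_eq, filter_erase_of_not _ _ (by omega), mul_assoc]
  have hB : ∀ p ∈ ((S.filter (i ≤ ·)).erase i).erase j,
      copSer Ψ β₀ B (S.filter (· < i)) i (insert i I) (Function.update a i (X j)) *
        (C (lam p (nx p)) * blockSer β₀ B ((S.filter (i ≤ ·)).erase p) i j e)
      = C (lam p (nx p)) * SymbPolylog.copTerm Ψ β₀ B (S.erase p) e I a i j := by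
    intro p hp
    simp only [Finset.mem_erase, Finset.mem_filter] at hp
    rw [SymbPolylog.copTerm, filter_erase_eq S p (i ≤ ·), filter_erase_of_not S (· < i) (by omega)]
    ring
  have hC : ∀ s ∈ S.filter (· < i), C (lam s (nx s) + logI l s (nx s)) *
      (if nx s ∈ S.filter (· < i) then renameVar s (nx s) (copSer Ψ β₀ B
        ((S.filter (· < i)).erase (nx s)) i (insert i I) (Function.update a i (X j))) else 0) *
        blockSer β₀ B (S.filter (i ≤ ·)) i j e =
      C (lam s (nx s) + logI l s (nx s)) * (if nx s ∈ S ∧ nx s ≠ i then renameVar s (nx s)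
        (SymbPolylog.copTerm Ψ β₀ B (S.erase (nx s)) e I a i (if nx s = j then s else j)) else 0)
            := by
    intro s hs
    obtain ⟨hsS, hsi⟩ := Finset.mem_filter.1 hs
    have hle : nx s ≤ i := hn.le s hsS i hi hsi
    have hns := hn.nx_mem_of_lt hsS hi hsi
    rw [mul_assoc]
    congr 1
    rcases hle.lt_or_eq with hlt | heq
    · rw [if_pos (Finset.mem_filter.2 ⟨hns, hlt⟩), if_pos ⟨hns, hlt.ne⟩, if_neg (by omega),
        SymbPolylog.copTerm, map_mul, filter_erase_eq, filter_erase_of_not _ _ (by omega),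
        renameVar_eq_self (supp_blockSer _ hj) (by simp; omega)]
    · rw [if_neg (by simp [heq]), if_neg (by simp [heq]), zero_mul]
  have hD : ∀ s ∈ (S.filter (i ≤ ·)).erase j,
      copSer Ψ β₀ B (S.filter (· < i)) i (insert i I) (Function.update a i (X j)) *
      (C (lam s (nx s) + logI l s (nx s)) * (if nx s ∈ S.filter (i ≤ ·) then renameVar s (nx s)
        (blockSer β₀ B ((S.filter (i ≤ ·)).erase (nx s)) i (if nx s = j then s else j) e) else 0)) =
      C (lam s (nx s) + logI l s (nx s)) * (if nx s ∈ S ∧ nx s ≠ i then renameVar s (nx s)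
        (SymbPolylog.copTerm Ψ β₀ B (S.erase (nx s)) e I a i (if nx s = j then s else j)) else 0)
            := by
    intro s hs
    obtain ⟨hsj, hs⟩ := Finset.mem_erase.1 hs
    obtain ⟨hsS, hsi⟩ := Finset.mem_filter.1 hs
    have hsn := hn.lt_nx s hsS
    by_cases hns : nx s ∈ S
    · rw [if_pos (Finset.mem_filter.2 ⟨hns, by omega⟩), 
        if_pos (show nx s ∈ S ∧ nx s ≠ i from ⟨hns, by omega⟩), SymbPolylog.copTerm, map_mul,
        filter_erase_of_not S (· < i) (by omega), filter_erase_eq S _ (i ≤ ·),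
        renameVar_copSer hΨ _ _ _ (constantCoeff_update ha _ _) (by simp; omega), renameVar_update]
      have e1 : (fun x => renameVar s (nx s) (a x)) = a := funext fun x => hfix s hsS _ x
      -- The left factor carries the variable of the distinguished letter of the merged word.
      -- Renaming turns it back into `t_j` in both cases, since `s ≠ j`.
      have e2 : (if (if nx s = j then s else j) = s then nx s else if nx s = j then s else j)
          = j := by
        split_ifs with h1 h2 h3 <;> omega
      rw [e1, e2]
      ring
    · rw [if_neg (by simp [hns]), if_neg (by simp [hns])]
      simp
  rw [Finset.sum_congr rfl hA, Finset.sum_congr rfl hB, Finset.sum_congr rfl hC,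
    Finset.sum_congr rfl hD]
  ring

/-- For `s ≥ i`, exchanging `nx s` for `s` is a bijection between the two index sets. For `s < i`,
the assumption `nx s ≠ i` puts `nx s` below `i`, and neither removal has an effect. -/
theorem IsNext.sum_merge {S : Finset ℕ} {e : ℕ} {nx : ℕ → ℕ} (hn : IsNext S e nx) {M : Type*}
    [AddCommMonoid M] (f : ℕ → M) {s i : ℕ} (hs : s ∈ S) (hns : nx s ∈ S) (hi : i ∈ S)
    (hsi : nx s ≠ i) :
    ∑ j ∈ (S.filter (i ≤ ·)).erase s, f (if nx s = j then s else j) =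
      ∑ j ∈ (S.erase (nx s)).filter (i ≤ ·), f j := by
  have hsn := hn.lt_nx s hs
  rw [filter_erase_eq]
  rcases lt_or_ge s i with hlt | hge
  · have := hn.le s hs i hi hlt
    rw [Finset.erase_eq_of_notMem (by simp; omega), Finset.erase_eq_of_notMem (by simp; omega)]
    refine Finset.sum_congr rfl fun j hj => ?_
    rw [Finset.mem_filter] at hj
    rw [if_neg (by omega)]
  · have h1 : nx s ∈ (S.filter (i ≤ ·)).erase s := by
      simp only [Finset.mem_erase, Finset.mem_filter]; exact ⟨by omega, hns, by omega⟩
    have h2 : s ∈ (S.filter (i ≤ ·)).erase (nx s) := by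
      simp only [Finset.mem_erase, Finset.mem_filter]; exact ⟨by omega, hs, by omega⟩
    rw [← Finset.sum_erase_add _ _ h1, ← Finset.sum_erase_add _ _ h2, if_pos rfl,
      Finset.erase_right_comm]
    congr 1
    exact Finset.sum_congr rfl fun j hj => by
      rw [if_neg (Finset.ne_of_mem_erase (Finset.mem_of_mem_erase hj)).symm]

/-- Induct over the last block. The pairs `(i, j)` avoiding a letter `p` are those that index the
expansion of the word without `p`, and merges are matched by `IsNext.sum_merge`. No boundary terms
remain, so the formula has the same form as the one for regular words. -/
theorem Coaction.cop (h : Coaction β₀ β₁ J lam l) (hΨ : Renames Ψ) {B S : Finset ℕ} {e : ℕ}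
    {nx : ℕ → ℕ} (hn : IsNext S e nx) (hSB : S ⊆ B) (I : Finset ℕ) {a : ℕ → MvPowerSeries ℕ R}
    (ha : ∀ i, MvPowerSeries.constantCoeff (a i) = 0)
    (hfix : ∀ s ∈ S, ∀ q x, renameVar s q (a x) = a x) :
    CopFormula Ψ β₀ β₁ lam l nx B S e I a := by
  induction hcard : S.card using Nat.strong_induction_on generalizing S e I a with
  | _ n ih =>
  have hterm : ∀ i ∈ S, ∀ j ∈ S.filter (i ≤ ·), _ := fun i hi j hj =>
    h.copTerm hΨ hn hSB I ha hfix hi hj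
      (ih _ (hcard ▸ Finset.card_lt_card (Finset.filter_ssubset.2 ⟨i, hi, lt_irrefl _⟩))
        (hn.below (Or.inl hi)) ((Finset.filter_subset _ _).trans hSB) _
        (constantCoeff_update ha i j)
        (fun s hs q x => by
          obtain ⟨hsS, hsi⟩ := Finset.mem_filter.1 hs
          rw [Function.update_apply]
          split_ifs
          · rw [renameVar_X, if_neg]
            rintro rfl
            have := (Finset.mem_filter.1 hj).2
            omega
          · exact hfix s hsS q x) rfl)
  have hD : ∑ i ∈ S, ∑ j ∈ S.filter (i ≤ ·), ∑ p ∈ (S.erase i).erase j, C (lam p (nx p)) *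
      SymbPolylog.copTerm Ψ β₀ B (S.erase p) e I a i j = ∑ p ∈ S, C (lam p (nx p)) *
        ∑ i ∈ S.erase p, ∑ j ∈ (S.erase p).filter (i ≤ ·),
          SymbPolylog.copTerm Ψ β₀ B (S.erase p) e I a i j := by
    have e1 : ∀ i j p, (j ∈ S.filter (i ≤ ·) ∧ p ∈ (S.erase i).erase j) ↔
        (j ∈ (S.erase p).filter (i ≤ ·) ∧ p ∈ S.erase i) := by
      intro i j p; simp only [Finset.mem_erase, Finset.mem_filter]; tauto
    have e2 : ∀ i p, (i ∈ S ∧ p ∈ S.erase i) ↔ (i ∈ S.erase p ∧ p ∈ S) := by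
      intro i p; simp only [Finset.mem_erase]; tauto
    rw [Finset.sum_congr rfl fun i _ => Finset.sum_comm' (e1 i), Finset.sum_comm' e2]
    refine Finset.sum_congr rfl fun p _ => ?_
    simp only [Finset.mul_sum]
  have hM : ∑ i ∈ S, ∑ j ∈ S.filter (i ≤ ·), ∑ s ∈ S.erase j,
        C (lam s (nx s) + logI l s (nx s)) * (if nx s ∈ S ∧ nx s ≠ i then renameVar s (nx s)
          (SymbPolylog.copTerm Ψ β₀ B (S.erase (nx s)) e I a i (if nx s = j then s else j)) else 0)
      = ∑ s ∈ S, C (lam s (nx s) + logI l s (nx s)) * (if nx s ∈ S then renameVar s (nx s)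
        (∑ i ∈ S.erase (nx s), ∑ j ∈ (S.erase (nx s)).filter (i ≤ ·),
          SymbPolylog.copTerm Ψ β₀ B (S.erase (nx s)) e I a i j) else 0) := by
    have e1 : ∀ i j s, (j ∈ S.filter (i ≤ ·) ∧ s ∈ S.erase j) ↔
        (j ∈ (S.filter (i ≤ ·)).erase s ∧ s ∈ S) := by
      intro i j p; simp only [Finset.mem_erase, Finset.mem_filter]; tauto
    rw [Finset.sum_congr rfl fun i _ => Finset.sum_comm' (e1 i), Finset.sum_comm]
    refine Finset.sum_congr rfl fun s hs => ?_
    simp only [← Finset.mul_sum]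
    congr 1
    by_cases hns : nx s ∈ S
    swap
    · simp [hns]
    rw [if_pos hns, ← Finset.sum_erase_add _ _ hns, map_sum]
    simp only [hns, true_and, ne_eq, not_true_eq_false, if_false, Finset.sum_const_zero, add_zero]
    refine Finset.sum_congr rfl fun i hi => ?_
    have hi' := (Finset.ne_of_mem_erase hi).symm
    simp only [hi', not_false_eq_true, if_true]
    rw [map_sum, hn.sum_merge (fun j => renameVar s (nx s)
      (SymbPolylog.copTerm Ψ β₀ B (S.erase (nx s)) e I a i j)) hs hns
      (Finset.mem_of_mem_erase hi) hi']
  have hreg := h.reg S e nx hn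
  rw [CopFormula, copSer_eq, copSer_eq, Finset.sum_congr rfl fun i hi =>
    Finset.sum_congr rfl fun j hj => hterm i hi j hj]
  simp only [Finset.sum_add_distrib, Finset.sum_sub_distrib, ← Finset.mul_sum, delSum, mergeSum]
  rw [hD, hM, hreg]
  have hr1 : (∑ p ∈ S, C (lam p (nx p)) * copSer Ψ β₀ B (S.erase p) e I a) =
      (∑ p ∈ S, C (lam p (nx p)) * regSer β₀ (S.erase p) e) * Ψ I a +
      ∑ p ∈ S, C (lam p (nx p)) *
        ∑ i ∈ S.erase p, ∑ j ∈ (S.erase p).filter (i ≤ ·),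
          SymbPolylog.copTerm Ψ β₀ B (S.erase p) e I a i j := by
    rw [Finset.sum_mul, ← Finset.sum_add_distrib]
    refine Finset.sum_congr rfl fun p _ => ?_
    rw [copSer_eq]
    ring
  have hr2 : (∑ s ∈ S, C (lam s (nx s) + logI l s (nx s)) *
      (if nx s ∈ S then renameVar s (nx s) (copSer Ψ β₀ B (S.erase (nx s)) e I a) else 0)) =
      (∑ s ∈ S, C (lam s (nx s) + logI l s (nx s)) *
        (if nx s ∈ S then renameVar s (nx s) (regSer β₀ (S.erase (nx s)) e) else 0)) * Ψ I a +
      ∑ s ∈ S, C (lam s (nx s) + logI l s (nx s)) * (if nx s ∈ S then renameVar s (nx s)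
        (∑ i ∈ S.erase (nx s), ∑ j ∈ (S.erase (nx s)).filter (i ≤ ·),
          SymbPolylog.copTerm Ψ β₀ B (S.erase (nx s)) e I a i j) else 0) := by
    rw [Finset.sum_mul, ← Finset.sum_add_distrib]
    refine Finset.sum_congr rfl fun s hs => ?_
    rw [mul_assoc, ← mul_add]
    congr 1
    split_ifs with hns
    · rw [copSer_eq, map_add, map_mul, hΨ _ _ _ _ ha]
      congr 3
      exact funext fun x => hfix s hs _ x
    · rw [zero_mul, zero_add]
  rw [hr1, hr2, delSum, mergeSum]
  ring

/-- The homomorphism `β` vanishes on all generators. -/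
def IsCounit (β : HSymb →ₐ[ℚ] R) : Prop := ∀ g, β (MvPolynomial.X g) = 0

theorem IsCounit.logH {β : HSymb →ₐ[ℚ] R} (h : IsCounit β) (p q : ℕ) : β (logH p q) = 0 := by
  rw [SymbPolylog.logH, map_sum]
  exact Finset.sum_eq_zero fun r _ => h _

theorem IsCounit.regSer {β : HSymb →ₐ[ℚ] R} (h : IsCounit β) {S : Finset ℕ} (hS : S.Nonempty)
    (e : ℕ) : regSer β S e = 0 := by
  rw [SymbPolylog.regSer, seriesH, map_genSeries]
  ext m
  simp only [MvPowerSeries.coeff_apply, genSeries, valueAt, map_zero]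
  split_ifs with h1 h2 h3
  · exfalso
    obtain ⟨x, hx⟩ := hS
    have := DFunLike.congr_fun h2 x
    simp [hx] at this
  · exact h _
  · rfl
  · rfl

/-- Cut terms contain a nonempty regular word. In the polar terms both parts vanish by induction,
or, for a word of one letter, the numerator is `1 - 1`. -/
theorem IsCounit.invSer {β : HSymb →ₐ[ℚ] R} (h : IsCounit β) {S : Finset ℕ} (hS : S.Nonempty)
    (e : ℕ) : invSer β S e = 0 := by
  induction hcard : S.card using Nat.strong_induction_on generalizing S e with
  | _ n ih =>
  rw [← neg_eq_zero, neg_invSer' β subset_rfl (S.min'_mem hS) (fun s hs => S.min'_le s hs) e]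
  refine Finset.sum_eq_zero fun r hr => ?_
  have hr' : (S.filter (r ≤ ·)).Nonempty := ⟨r, by simp [hr]⟩
  rw [cutSer, h.regSer hr', mul_zero, polarSer, zero_sub, neg_eq_zero]
  suffices hz : omitSer β S r e - blockSer β S S (S.min' hS) r e = 0 by rw [hz]; rfl
  rw [omitSer, blockSer, h.logH, expSeries_zero]
  rcases (S.filter (· < r)).eq_empty_or_nonempty with h1 | h1
  · rcases (S.filter (r < ·)).eq_empty_or_nonempty with h2 | h2
    · rw [h1, h2]; simp
    · rw [h.regSer h2]; simp
  · rw [ih _ (hcard ▸ Finset.card_lt_card (Finset.filter_ssubset.2 ⟨r, hr, lt_irrefl _⟩)) h1 _ rfl]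
    simp

/-- Only blocks with a single letter survive, and their value is `1`. The last block must thus start
at the largest letter, and in the end every letter of `S` is paired with its own variable. -/
theorem IsCounit.copSer {β : HSymb →ₐ[ℚ] R} (h : IsCounit β) (B S : Finset ℕ) (e : ℕ)
    (I : Finset ℕ) (a : ℕ → MvPowerSeries ℕ R) :
    copSer Ψ β B S e I a = Ψ (S ∪ I) fun x => if x ∈ S then X x else a x := by
  induction hcard : S.card using Nat.strong_induction_on generalizing S e I a with
  | _ n ih =>
  rcases S.eq_empty_or_nonempty with rfl | hS
  · simp [copSer_eq]
  set m := S.max' hS with hm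
  have hmS : m ∈ S := S.max'_mem hS
  have hle : ∀ s ∈ S, s ≤ m := fun s hs => S.le_max' s hs
  rw [copSer_eq, h.regSer hS, zero_mul, zero_add, Finset.sum_eq_single_of_mem m hmS]
  · have h1 : S.filter (m ≤ ·) = {m} := by
      ext s; simp only [Finset.mem_filter, Finset.mem_singleton]
      exact ⟨fun h' => le_antisymm (hle s h'.1) h'.2, by rintro rfl; exact ⟨hmS, le_rfl⟩⟩
    have h2 : S.filter (· < m) = S.erase m := by
      ext s; simp only [Finset.mem_filter, Finset.mem_erase]
      exact ⟨fun h' => ⟨h'.2.ne, h'.1⟩, fun h' => ⟨h'.2, lt_of_le_of_ne (hle s h'.2) h'.1⟩⟩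
    have h3 : ({m} : Finset ℕ).filter (· < m) = ∅ := by simp [Finset.filter_singleton]
    have h4 : ({m} : Finset ℕ).filter (m < ·) = ∅ := by simp [Finset.filter_singleton]
    rw [h1, Finset.sum_singleton, copTerm, h1, blockSer, h3, h4, h2,
      ih _ (hcard ▸ Finset.card_erase_lt_of_mem hmS) _ _ _ _ rfl, h.logH, expSeries_zero]
    simp only [invSer_empty, regSer_empty, map_one, mul_one]
    congr 1
    · ext s; simp only [Finset.mem_union, Finset.mem_insert, Finset.mem_erase]
      by_cases hs : s = m
      · simp [hs, hmS]
      · simp [hs]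
    · funext x
      by_cases hx : x = m
      · simp [hx, hmS]
      · simp [hx]
  · intro i hi him
    refine Finset.sum_eq_zero fun j hj => ?_
    rw [copTerm, blockSer]
    rcases ((S.filter (i ≤ ·)).filter (· < j)).eq_empty_or_nonempty with h1 | h1
    · have hjm : j < m := by
        refine lt_of_le_of_ne (hle j (Finset.mem_filter.1 hj).1) ?_
        rintro rfl
        have : i ∈ (S.filter (i ≤ ·)).filter (· < m) := by
          simp only [Finset.mem_filter]
          exact ⟨⟨hi, le_rfl⟩, lt_of_le_of_ne (hle i hi) him⟩
        rw [h1] at this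
        simp at this
      have h2 : ((S.filter (i ≤ ·)).filter (j < ·)).Nonempty :=
        ⟨m, by simp only [Finset.mem_filter]; exact ⟨⟨hmS, hle i hi⟩, hjm⟩⟩
      rw [h.regSer h2]; simp
    · rw [h.invSer h1]; simp

end Coproduct

end

/-! ### The subset sum of the coproduct formula as a recursion over the last block. -/

section

open MvPowerSeries (X C)

section Combinatorics

theorem firstPt_empty (e : ℕ) : firstPt ∅ e = e := by simp [firstPt]

theorem firstPt_insert (K : Finset ℕ) {i e : ℕ} (h : i < e) :
    firstPt (insert i K) e = firstPt K i := by
  unfold firstPt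
  refine le_antisymm (Finset.min'_le _ _ (Finset.mem_insert_of_mem (Finset.min'_mem _ _)))
    (Finset.le_min' _ _ _ fun x hx => ?_)
  rcases Finset.mem_insert.1 hx with rfl | hx
  · exact (Finset.min'_le _ _ (Finset.mem_insert_self _ _)).trans h.le
  · exact Finset.min'_le _ _ hx

theorem firstPt_le (K : Finset ℕ) (e : ℕ) : firstPt K e ≤ e :=
  Finset.min'_le _ _ (Finset.mem_insert_self _ _)

theorem nextPt_le (I : Finset ℕ) (e i : ℕ) : nextPt I e i ≤ e := firstPt_le _ _

theorem lt_nextPt {I : Finset ℕ} {e i : ℕ} (h : i < e) : i < nextPt I e i := by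
  rw [nextPt, firstPt, Finset.lt_min'_iff]
  intro x hx
  rcases Finset.mem_insert.1 hx with rfl | hx
  · exact h
  · exact (Finset.mem_filter.1 hx).2

theorem isNext_nextPt {S : Finset ℕ} {e : ℕ} (h : ∀ s ∈ S, s < e) : IsNext S e (nextPt S e) where
  lt := h
  lt_nx s hs := lt_nextPt (h s hs)
  mem s _ := by
    have := Finset.min'_mem (insert e (S.filter (s < ·))) (Finset.insert_nonempty _ _)
    rcases Finset.mem_insert.1 this with h' | h'
    · exact Or.inr h'
    · exact Or.inl (Finset.mem_filter.1 h').1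
  le s _ q hq hsq := Finset.min'_le _ _ (Finset.mem_insert_of_mem (Finset.mem_filter.2 ⟨hq, hsq⟩))

/-- Seen from below, a new element `i` acts as the new end point; this drives the recursion in
`sum_eq_copSer`. -/
theorem nextPt_insert {I : Finset ℕ} {i i' e : ℕ} (h : i < e) (h' : i' < i) :
    nextPt (insert i I) e i' = nextPt I i i' := by
  rw [nextPt, Finset.filter_insert, if_pos h', firstPt_insert _ h, nextPt]

theorem nextPt_insert_self {I : Finset ℕ} {i e : ℕ} (hI : ∀ x ∈ I, x < i) :
    nextPt (insert i I) e i = e := by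
  have : (insert i I).filter (i < ·) = ∅ := by
    rw [Finset.filter_eq_empty_iff]
    intro x hx
    rcases Finset.mem_insert.1 hx with rfl | hx
    · exact lt_irrefl _
    · exact (hI x hx).not_gt
  rw [nextPt, this, firstPt_empty]

/-- A sum over subsets, sorted by their largest elements. -/
theorem sum_powerset_max {M : Type*} [AddCommMonoid M] (S : Finset ℕ) (f : Finset ℕ → M) :
    ∑ I ∈ S.powerset, f I = f ∅ + ∑ i ∈ S, ∑ I ∈ (S.filter (· < i)).powerset, f (insert i I) := by
  induction S using Finset.induction_on_max with
  | empty => simp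
  | insert m S hm ih =>
    have hmS : m ∉ S := fun h => lt_irrefl _ (hm m h)
    have h1 : (insert m S).filter (· < m) = S := by
      ext x; simp only [Finset.mem_filter, Finset.mem_insert]
      exact ⟨fun h => h.1.resolve_left h.2.ne, fun h => ⟨Or.inr h, hm x h⟩⟩
    have h2 : ∀ i ∈ S, (insert m S).filter (· < i) = S.filter (· < i) := fun i hi => by
      rw [Finset.filter_insert, if_neg (hm i hi).not_gt]
    have h3 : ∑ i ∈ S, ∑ I ∈ ((insert m S).filter (· < i)).powerset, f (insert i I) =
        ∑ i ∈ S, ∑ I ∈ (S.filter (· < i)).powerset, f (insert i I) :=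
      Finset.sum_congr rfl fun i hi => by rw [h2 i hi]
    rw [Finset.sum_powerset_insert hmS, ih, Finset.sum_insert hmS, h1, h3, add_assoc,
        add_comm (∑ i ∈ S, _)]

theorem sum_pi_insert {M : Type*} [AddCommMonoid M] {I : Finset ℕ} {i : ℕ} (hi : i ∉ I)
    (t : ℕ → Finset ℕ) (f : (∀ x ∈ insert i I, ℕ) → M) :
    ∑ j ∈ (insert i I).pi t, f j = ∑ b ∈ t i, ∑ j ∈ I.pi t, f (Finset.Pi.cons I i b j) := by
  rw [Finset.pi_insert hi, Finset.sum_biUnion]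
  · refine Finset.sum_congr rfl fun b _ => ?_
    rw [Finset.sum_image fun _ _ _ _ h => Finset.Pi.cons_injective hi h]
  · intro b _ b' _ hbb'
    simp only [Function.onFun, Finset.disjoint_left, Finset.mem_image]
    rintro _ ⟨j, _, rfl⟩ ⟨j', _, h⟩
    apply hbb'
    have := congrFun (congrFun h i) (Finset.mem_insert_self i I)
    simpa using this.symm

theorem prod_attach_dite {M : Type*} [CommMonoid M] (I : Finset ℕ) (f : ∀ i ∈ I, M) :
    ∏ i ∈ I.attach, f i.1 i.2 = ∏ i ∈ I, if h : i ∈ I then f i h else 1 := by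
  rw [← Finset.prod_attach I]
  exact Finset.prod_congr rfl fun i _ => by rw [dif_pos i.2]

variable {R : Type*} [CommRing R] [Algebra ℚ R]

/-- The product of the blocks in the coproduct formula, for given `I` and `j`. -/
def blockProd (β : HSymb →ₐ[ℚ] R) (B S : Finset ℕ) (e : ℕ) (I : Finset ℕ) (j : ∀ x ∈ I, ℕ) :
    MvPowerSeries ℕ R :=
  regSer β (S.filter (· < firstPt I e)) (firstPt I e) * ∏ i ∈ I.attach,
    blockSer β B (S.filter fun s => i.1 ≤ s ∧ s < nextPt I e i.1) i.1 (j i.1 i.2) (nextPt I e i.1)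

/-- The values of `j`, extended by `a`. -/
def extendBy {I : Finset ℕ} (j : ∀ x ∈ I, ℕ) (a : ℕ → MvPowerSeries ℕ R) (x : ℕ) :
    MvPowerSeries ℕ R :=
  if h : x ∈ I then X (j x h) else a x

/-- Sort the subsets by their largest element `i`. Its block consists of all letters from `i` on,
and the remaining blocks are those of the word of letters before `i` with end point `i`. The
parameters `I₀` and `a` remember the blocks already removed. -/
theorem sum_eq_copSer (Ψ : Finset ℕ → (ℕ → MvPowerSeries ℕ R) → MvPowerSeries ℕ R)
    (β : HSymb →ₐ[ℚ] R) (B : Finset ℕ) {S : Finset ℕ} {e : ℕ} (hS : ∀ s ∈ S, s < e)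
    (I₀ : Finset ℕ) (a : ℕ → MvPowerSeries ℕ R) :
    ∑ I ∈ S.powerset, ∑ j ∈ I.pi fun i => S.filter fun s => i ≤ s ∧ s < nextPt I e i,
      Ψ (I ∪ I₀) (extendBy j a) * blockProd β B S e I j = copSer Ψ β B S e I₀ a := by
  induction hcard : S.card using Nat.strong_induction_on generalizing S e I₀ a with
  | _ n ih =>
  rw [sum_powerset_max, copSer_eq]
  congr 1
  · have hSe : S.filter (· < e) = S := Finset.filter_true_of_mem hS
    have : ∀ j : (∀ x ∈ (∅ : Finset ℕ), ℕ), extendBy j a = a := fun j => by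
      funext x; simp [extendBy]
    simp [blockProd, firstPt_empty, hSe, this, mul_comm]
  refine Finset.sum_congr rfl fun i hi => ?_
  have hie := hS i hi
  have hfilt : ∀ I ∈ (S.filter (· < i)).powerset, ∀ i' ∈ I,
      (S.filter fun s => i' ≤ s ∧ s < nextPt (insert i I) e i') =
        (S.filter (· < i)).filter fun s => i' ≤ s ∧ s < nextPt I i i' := by
    intro I hI i' hi'
    have hlt := (Finset.mem_filter.1 (Finset.mem_powerset.1 hI hi')).2
    rw [nextPt_insert hie hlt, Finset.filter_filter]
    have := nextPt_le I i i'
    exact Finset.filter_congr fun s _ => ⟨fun h => ⟨by omega, h⟩, fun h => h.2⟩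
  have hfilt' : ∀ I ∈ (S.filter (· < i)).powerset,
      (S.filter fun s => i ≤ s ∧ s < nextPt (insert i I) e i) = S.filter (i ≤ ·) := by
    intro I hI
    rw [nextPt_insert_self fun x hx => (Finset.mem_filter.1 (Finset.mem_powerset.1 hI hx)).2]
    exact Finset.filter_congr fun s hs => ⟨fun h => h.1, fun h => ⟨h, hS s hs⟩⟩
  have hnot : ∀ I ∈ (S.filter (· < i)).powerset, i ∉ I := fun I hI h => by
    have := (Finset.mem_filter.1 (Finset.mem_powerset.1 hI h)).2; omega
  have hih := fun b => ih _
    (hcard ▸ Finset.card_lt_card (Finset.filter_ssubset.2 ⟨i, hi, lt_irrefl _⟩))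
    (S := S.filter (· < i)) (fun s hs => (Finset.mem_filter.1 hs).2) (insert i I₀)
    (Function.update a i (X b)) rfl
  simp only [copTerm, ← hih, Finset.sum_mul]
  rw [Finset.sum_comm]
  refine Finset.sum_congr rfl fun I hI => ?_
  rw [sum_pi_insert (hnot I hI), hfilt' I hI]
  refine Finset.sum_congr rfl fun b _ => ?_
  have hpi : (I.pi fun i' => S.filter fun s => i' ≤ s ∧ s < nextPt (insert i I) e i') =
      I.pi fun i' => (S.filter (· < i)).filter fun s => i' ≤ s ∧ s < nextPt I i i' := by
    ext j
    simp only [Finset.mem_pi]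
    exact forall₂_congr fun i' hi' => by rw [hfilt I hI i' hi']
  rw [hpi]
  refine Finset.sum_congr rfl fun j _ => ?_
  rw [mul_assoc]
  congr 1
  · congr 1
    · ext x; simp only [Finset.mem_union, Finset.mem_insert]; tauto
    · funext x
      by_cases hx : x = i
      · subst hx
        simp [extendBy, hnot I hI]
      · by_cases hxI : x ∈ I
        · simp only [extendBy, hxI, Finset.mem_insert, or_true, dif_pos]
          rw [Finset.Pi.cons_ne (Ne.symm hx)]
        · simp [extendBy, hx, hxI]
  · rw [blockProd, blockProd, firstPt_insert _ hie, mul_assoc]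
    congr 1
    · rw [Finset.filter_filter]
      have := firstPt_le I i
      congr 1
      exact Finset.filter_congr fun s _ => ⟨fun h => ⟨by omega, h⟩, fun h => h.2⟩
    · rw [prod_attach_dite (insert i I) fun x h => blockSer β B
          (S.filter fun s => x ≤ s ∧ s < nextPt (insert i I) e x) x (Finset.Pi.cons I i b j x h)
          (nextPt (insert i I) e x),
        prod_attach_dite I fun x h => blockSer β B
          ((S.filter (· < i)).filter fun s => x ≤ s ∧ s < nextPt I i x) x (j x h) (nextPt I i x),
        Finset.prod_insert (hnot I hI), mul_comm, dif_pos (Finset.mem_insert_self _ _),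
        hfilt' I hI, Finset.Pi.cons_same,
        nextPt_insert_self fun x hx => (Finset.mem_filter.1 (Finset.mem_powerset.1 hI hx)).2]
      congr 1
      refine Finset.prod_congr rfl fun x hx => ?_
      have hlt := (Finset.mem_filter.1 (Finset.mem_powerset.1 hI hx)).2
      rw [dif_pos (Finset.mem_insert_of_mem hx), dif_pos hx, hfilt I hI x hx,
        nextPt_insert hie hlt, Finset.Pi.cons_ne hlt.ne']

end Combinatorics

/-! ### Convolution of homomorphisms and its generating series. -/

section Transport

variable {R : Type*} [CommRing R] [Algebra ℚ R]

/-- The homomorphism `(a ⊗ b) ↦ α (INV a) β (INV b)`. -/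
def liftBar (α β : HSymb →ₐ[ℚ] R) : HBar ⊗[ℚ] HBar →ₐ[ℚ] R :=
  Algebra.TensorProduct.lift (α.comp INV) (β.comp INV) fun _ _ => Commute.all _ _

variable (α β : HSymb →ₐ[ℚ] R)

theorem liftBar_tmul (x y : HBar) : liftBar α β (x ⊗ₜ y) = α (INV x) * β (INV y) :=
  Algebra.TensorProduct.lift_tmul _ _ _ _ _

theorem INV_log (i : ℕ) :
    INV (MvPolynomial.X (GenBar.log i)) = MvPolynomial.X (Gen.log i) := by
  simp [INV]

theorem INV_reg (s : Symb) :
    INV (MvPolynomial.X (GenBar.reg s)) = MvPolynomial.X (Gen.poly s) := by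
  simp [INV]

theorem INV_inv (s : Symb) : INV (MvPolynomial.X (GenBar.inv s)) =
    (-1) ^ (s.exps.sum fun _ k => k) *
      MvPowerSeries.coeff s.exps (invSeries s.vec.support s.len) := by
  simp [INV]

theorem INV_logBar (p q : ℕ) : INV (logBar p q) = logH p q := by
  rw [logBar, logH, map_sum]
  exact Finset.sum_congr rfl fun r _ => INV_log r

theorem regSer_eq_genSeries (S : Finset ℕ) (e : ℕ) :
    regSer β S e = genSeries (fun s => β (MvPolynomial.X (Gen.poly s))) S e := by
  rw [regSer, seriesH, map_genSeries]
  rfl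

theorem map_leftReg (S : Finset ℕ) (e : ℕ) :
    MvPowerSeries.map (liftBar α β : HBar ⊗[ℚ] HBar →+* R) (leftReg S e) = regSer α S e := by
  rw [leftReg, map_genSeries, regSer_eq_genSeries]
  congr 1
  funext s
  simp [liftBar_tmul, INV_reg]

theorem map_rightReg (S : Finset ℕ) (e : ℕ) :
    MvPowerSeries.map (liftBar α β : HBar ⊗[ℚ] HBar →+* R) (rightReg S e) = regSer β S e := by
  rw [rightReg, map_genSeries, regSer_eq_genSeries]
  congr 1
  funext s
  simp [liftBar_tmul, INV_reg]

theorem support_add_indicator {S : Finset ℕ} {m : ℕ →₀ ℕ} (h : m.support ⊆ S) :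
    (m + Finsupp.indicator S fun _ _ => 1).support = S := by
  ext x
  simp only [Finsupp.mem_support_iff, Finsupp.add_apply, Finsupp.indicator_apply]
  by_cases hx : x ∈ S
  · simp [hx]
  · have : m x = 0 := by
      by_contra h'
      exact hx (h (Finsupp.mem_support_iff.2 h'))
    simp [hx, this]

theorem add_indicator_mapRange {S : Finset ℕ} {m : ℕ →₀ ℕ} (h : m.support ⊆ S) :
    (m + Finsupp.indicator S fun _ _ => 1).mapRange (fun k => k - 1) rfl = m := by
  ext x
  simp only [Finsupp.mapRange_apply, Finsupp.add_apply, Finsupp.indicator_apply]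
  by_cases hx : x ∈ S
  · simp [hx]
  · have : m x = 0 := by
      by_contra h'
      exact hx (h (Finsupp.mem_support_iff.2 h'))
    simp [hx, this]

theorem add_indicator_ne_zero {S : Finset ℕ} (hS : S.Nonempty) (m : ℕ →₀ ℕ) :
    (m + Finsupp.indicator S fun _ _ => 1) ≠ 0 := by
  obtain ⟨x, hx⟩ := hS
  intro h
  have := DFunLike.congr_fun h x
  simp [hx] at this

theorem coeff_genSeries {R : Type*} [CommRing R] (g : Symb → R) {S : Finset ℕ} {e : ℕ}
    (hS : S.Nonempty) (hSe : ∀ s ∈ S, s < e) {m : ℕ →₀ ℕ} (hm : m.support ⊆ S) :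
    MvPowerSeries.coeff m (genSeries g S e) =
      g ⟨e, m + Finsupp.indicator S fun _ _ => 1, fun i hi => hSe i
        (by rwa [support_add_indicator hm] at hi), add_indicator_ne_zero hS m⟩ := by
  simp only [MvPowerSeries.coeff_apply, genSeries, valueAt]
  rw [if_pos hm, dif_neg (add_indicator_ne_zero hS m), dif_pos]

/-- The series `invSeries` represents inverted words at the arguments `-t`, whereas `rightInv` has
arguments `t`. The sign in the definition of `INV` is the one produced by rescaling all variables by
`-1`. -/
theorem map_rightInv {S : Finset ℕ} {e : ℕ} (hSe : ∀ s ∈ S, s < e) :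
    MvPowerSeries.map (liftBar α β : HBar ⊗[ℚ] HBar →+* R) (rightInv S e) =
      MvPowerSeries.rescale (fun _ => -1)
        (MvPowerSeries.map (β : HSymb →+* R) (invSeries S e)) := by
  rw [rightInv, map_genSeries]
  rcases S.eq_empty_or_nonempty with rfl | hS
  · have : genSeries (fun s => (liftBar α β : HBar ⊗[ℚ] HBar →+* R)
        (1 ⊗ₜ[ℚ] MvPolynomial.X (GenBar.inv s))) ∅ e = 1 := by
      rw [← map_genSeries]
      classical
      ext m : 1
      rw [MvPowerSeries.coeff_map, MvPowerSeries.coeff_one]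
      by_cases hm : m = 0
      · subst hm
        simp only [MvPowerSeries.coeff_apply, genSeries]
        rw [if_pos (by simp), valueAt, dif_pos (by ext; simp)]
        simp
      · rw [if_neg hm]
        simp only [MvPowerSeries.coeff_apply, genSeries]
        rw [if_neg (by simpa using hm), map_zero]
    rw [this, invSeries_empty, map_one, map_one]
  · ext m
    rw [MvPowerSeries.coeff_rescale, MvPowerSeries.coeff_map]
    by_cases hm : m.support ⊆ S
    · rw [coeff_genSeries _ hS hSe hm]
      simp only [RingHom.coe_coe, liftBar_tmul, map_one, one_mul, INV_inv, Symb.exps,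
        add_indicator_mapRange hm, support_add_indicator hm, map_mul, map_pow, map_neg]
      congr 1
      rw [Finsupp.prod, Finset.prod_pow_eq_pow_sum, Finsupp.sum]
    · have h1 : MvPowerSeries.coeff m (invSeries S e) = 0 := by
        by_contra h
        exact hm (supp_invSeries S e m h)
      have h2 : ∀ g : Symb → R, MvPowerSeries.coeff m (genSeries g S e) = 0 := by
        intro g
        by_contra h
        exact hm (supp_genSeries g S e m h)
      rw [h1, h2, map_zero, mul_zero]

/-- Inverted words enter the coproduct at `t_c - t_i`; the rescaling by `-1` makes this the same
shift `t_i - t_c` as for regular words. -/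
theorem substOn_rescale {R : Type*} [CommRing R] {S B : Finset ℕ} {f : MvPowerSeries ℕ R}
    (hf : Supp S f) (hSB : S ⊆ B) (c : ℕ) :
    substOn S (fun i => X c - X i) (MvPowerSeries.rescale (fun _ => -1) f) = shiftVars B c f := by
  rw [← substOn_shift hf hSB, MvPowerSeries.rescale_eq_subst, substOn, substOn]
  have h1 : MvPowerSeries.HasSubst fun i => (if i ∈ S then X c - X i else 0 : MvPowerSeries ℕ R) :=
    hasSubst_on fun i _ => by simp
  rw [MvPowerSeries.subst_comp_subst_apply (MvPowerSeries.HasSubst.smul_X _) h1]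
  congr 1
  funext i
  rw [Pi.smul_apply', MvPowerSeries.subst_smul h1, MvPowerSeries.subst_X h1]
  split_ifs <;> simp

theorem map_coprodFactor {S B : Finset ℕ} (hSB : S ⊆ B) {i j k : ℕ} (hij : i ≤ j) (hjk : j < k) :
    MvPowerSeries.map (liftBar α β : HBar ⊗[ℚ] HBar →+* R) (coprodFactor S i j k) =
      blockSer β B (S.filter fun s => i ≤ s ∧ s < k) i j k := by
  have e1 : (S.filter fun s => i ≤ s ∧ s < k).filter (· < j) = S.filter fun s => i ≤ s ∧ s < j := by
    rw [Finset.filter_filter]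
    exact Finset.filter_congr fun s _ => ⟨fun h => ⟨h.1.1, h.2⟩, fun h => ⟨⟨h.1, by omega⟩, h.2⟩⟩
  have e2 : (S.filter fun s => i ≤ s ∧ s < k).filter (j < ·) = S.filter fun s => j < s ∧ s < k := by
    rw [Finset.filter_filter]
    exact Finset.filter_congr fun s _ => ⟨fun h => ⟨h.2, h.1.2⟩, fun h => ⟨⟨by omega, h.2⟩, h.1⟩⟩
  rw [coprodFactor, blockSer, e1, e2, map_mul, map_mul, map_mul, map_expSeries,
    map_substOn _ (fun i _ => by simp), map_substOn _ (fun i _ => by simp), map_rightReg,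
    map_rightInv _ _ (fun s hs => (Finset.mem_filter.1 hs).2.2)]
  simp only [map_sub, MvPowerSeries.map_X, RingHom.coe_coe, liftBar_tmul, map_one, one_mul,
    INV_logBar, map_pow, map_neg]
  rw [substOn_rescale (B := B) ((supp_invSeries _ _).map _) ((Finset.filter_subset _ _).trans hSB),
    substOn_shift (B := B) (supp_regSer β _ _) ((Finset.filter_subset _ _).trans hSB), invSer,
    map_mul, map_pow, map_neg, map_one]
  ring

/-- The left factor of the coproduct formula. -/
def leftSer (α : HSymb →ₐ[ℚ] R) (e : ℕ) (I : Finset ℕ) (a : ℕ → MvPowerSeries ℕ R) :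
    MvPowerSeries ℕ R :=
  substOn I a (regSer α I e)

theorem renames_leftSer (e : ℕ) : Renames (leftSer α e) := by
  intro s q I a ha
  rw [leftSer, leftSer, substOn, substOn, renameVar, MvPowerSeries.substAlgHom_apply,
    MvPowerSeries.subst_comp_subst_apply (hasSubst_on fun i _ => ha i) (hasSubst_rename s q)]
  congr 1
  funext i
  split_ifs
  · rw [MvPowerSeries.substAlgHom_apply]
  · rw [← MvPowerSeries.coe_substAlgHom (hasSubst_rename s q), map_zero]

theorem map_coprodSeries {S B : Finset ℕ} {e : ℕ} (hSe : ∀ s ∈ S, s < e) (hSB : S ⊆ B) :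
    MvPowerSeries.map (liftBar α β : HBar ⊗[ℚ] HBar →+* R) (coprodSeries S e) =
      copSer (leftSer α e) β B S e ∅ fun _ => 0 := by
  rw [← sum_eq_copSer _ _ _ hSe, coprodSeries, map_sum]
  refine Finset.sum_congr rfl fun I hI => ?_
  rw [map_sum]
  refine Finset.sum_congr rfl fun j hj => ?_
  rw [map_mul, map_mul, map_prod, map_rightReg, map_substOn, map_leftReg, Finset.union_empty,
    leftSer, blockProd]
  · congr 2
    · funext i
      simp only [extendBy]
      split_ifs <;> simp
    · refine Finset.prod_congr rfl fun i _ => ?_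
      have := Finset.mem_filter.1 (Finset.mem_pi.1 hj i.1 i.2)
      exact map_coprodFactor α β hSB this.2.1 this.2.2
  · intro i hi
    simp [hi]

/-- The homomorphism `(α ⊗ β) ∘ Δ`, followed by multiplication. -/
def convHom (α β : HSymb →ₐ[ℚ] R) : HSymb →ₐ[ℚ] R :=
  (Algebra.TensorProduct.lift α β fun _ _ => Commute.all _ _).comp coprod

theorem convHom_eq : convHom α β = (liftBar α β).comp coprodBar := by
  have : (Algebra.TensorProduct.lift α β fun _ _ => Commute.all _ _).comp
      (Algebra.TensorProduct.map INV INV) = liftBar α β :=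
    Algebra.TensorProduct.ext' fun a b => by simp [liftBar_tmul]
  rw [convHom, coprod, ← AlgHom.comp_assoc, this]

theorem convHom_log (r : ℕ) : convHom α β (MvPolynomial.X (Gen.log r)) =
    α (MvPolynomial.X (Gen.log r)) + β (MvPolynomial.X (Gen.log r)) := by
  rw [convHom_eq]
  simp [coprodBar, liftBar_tmul, INV_log]

theorem Symb.support_exps_subset (s : Symb) : s.exps.support ⊆ s.vec.support :=
  Finsupp.support_mapRange

theorem Symb.exps_add (s : Symb) :
    (s.exps + Finsupp.indicator s.vec.support fun _ _ => 1) = s.vec := by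
  ext x
  simp only [Finsupp.add_apply, Symb.exps, Finsupp.mapRange_apply, Finsupp.indicator_apply,
    Finsupp.mem_support_iff, dite_eq_ite]
  split_ifs with h <;> omega

theorem coeff_exps_genSeries {R : Type*} [CommRing R] (g : Symb → R) (s : Symb) :
    MvPowerSeries.coeff s.exps (genSeries g s.vec.support s.len) = g s := by
  rw [coeff_genSeries g (Finsupp.support_nonempty_iff.2 s.ne_zero) s.lt_len s.support_exps_subset]
  congr 1
  cases s
  simp only [Symb.mk.injEq, true_and]
  exact Symb.exps_add _

theorem coeff_exps_regSer (s : Symb) : MvPowerSeries.coeff s.exps (regSer β s.vec.support s.len)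
    = β (MvPolynomial.X (Gen.poly s)) := by
  rw [regSer_eq_genSeries, coeff_exps_genSeries]

/-- The generating series of the values of `convHom`. -/
theorem regSer_convHom {S B : Finset ℕ} {e : ℕ} (hSe : ∀ s ∈ S, s < e) (hSB : S ⊆ B) :
    regSer (convHom α β) S e = copSer (leftSer α e) β B S e ∅ fun _ => 0 := by
  rcases S.eq_empty_or_nonempty with rfl | hS
  · rw [regSer_empty, copSer_eq]
    simp only [regSer_empty, one_mul, Finset.sum_empty, add_zero, leftSer, substOn]
    rw [← MvPowerSeries.coe_substAlgHom (hasSubst_on (S := ∅) (by simp)), map_one]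
  rw [← map_coprodSeries α β hSe hSB]
  ext m
  by_cases hm : m.support ⊆ S
  · rw [regSer_eq_genSeries, coeff_genSeries _ hS hSe hm, MvPowerSeries.coeff_map, convHom_eq]
    simp [coprodBar, Symb.exps, add_indicator_mapRange hm, support_add_indicator hm]
  · have h1 : MvPowerSeries.coeff m (regSer (convHom α β) S e) = 0 := by
      by_contra h
      exact hm (supp_regSer _ S e m h)
    have h2 : Supp S (coprodSeries S e) := by
      refine Supp.sum fun I hI => Supp.sum fun j hj => ?_
      have hIS := Finset.mem_powerset.1 hI
      have hjm := fun i hi => Finset.mem_filter.1 (Finset.mem_pi.1 hj i hi)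
      refine Supp.mul ?_ (.mul ((supp_genSeries _ _ _).mono (Finset.filter_subset _ _))
        (.prod fun i _ => ?_))
      · refine Supp.subst (hasSubst_on fun i hi => by simp [hi]) (supp_genSeries _ I e) fun i hi =>
          ?_
        simp only [if_pos hi, dif_pos hi]
        exact .X (hjm i hi).1
      · have hji := (hjm i.1 i.2).1
        have hins : ∀ {T : Finset ℕ}, T ⊆ S → insert (j i.1 i.2) T ⊆ S := fun hT =>
          Finset.insert_subset hji hT
        rw [coprodFactor]
        refine (((Supp.one.neg.pow _).mul (supp_expSeries _ hji)).mul ?_).mul ?_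
        · refine Supp.subst (hasSubst_on fun _ _ => by simp) (supp_genSeries _ _ _) fun x hx => ?_
          rw [if_pos hx]
          exact (Supp.X hji).sub (.X (Finset.filter_subset _ _ hx))
        · refine Supp.subst (hasSubst_on fun _ _ => by simp) (supp_genSeries _ _ _) fun x hx => ?_
          rw [if_pos hx]
          exact (Supp.X (Finset.filter_subset _ _ hx)).sub (.X hji)
    rw [h1]
    by_contra h
    exact hm (h2.map _ m (Ne.symm h))

end Transport

end

/-! ### Coassociativity to first order. -/

section

open MvPowerSeries (X C)

section Coassociativity

variable {R : Type*} [CommRing R] [Algebra ℚ R]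
variable {J : Ideal R} {lam : ℕ → ℕ → R} {l : ℕ → R} {β₀ β₁ β₁' : HSymb →ₐ[ℚ] R}

/-- Only the right factor of the convolution is deformed, so this is `Coaction.cop` with the left
factor fixed. The set `S` of the full word serves as the set of shifted variables for all shorter
words. -/
theorem Coaction.conv (h : Coaction β₀ β₁ J lam l) (α : HSymb →ₐ[ℚ] R) :
    Coaction (convHom α β₀) (convHom α β₁) J lam l where
  sq := h.sq
  lam_mem := h.lam_mem
  l_mem := h.l_mem
  log r := by rw [convHom_log, convHom_log, h.log, add_assoc]
  reg S e nx hn := by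
    have h1 := h.cop (renames_leftSer α e) hn (subset_refl S) ∅ (a := fun _ => 0) (by simp)
      (by simp)
    have hsub : ∀ p, S.erase p ⊆ S := fun p => Finset.erase_subset _ _
    have hlt : ∀ p, ∀ s ∈ S.erase p, s < e := fun p s hs => hn.lt s (hsub p hs)
    simp only [CopFormula, ← regSer_convHom α β₁ hn.lt subset_rfl,
      ← regSer_convHom α β₀ hn.lt subset_rfl, ← regSer_convHom α β₀ (hlt _) (hsub _)] at h1
    exact h1

/-- The right counit property of the coproduct. -/
theorem IsCounit.conv {β : HSymb →ₐ[ℚ] R} (h : IsCounit β) (α : HSymb →ₐ[ℚ] R) :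
    convHom α β = α := by
  refine MvPolynomial.algHom_ext fun g => ?_
  cases g with
  | log r => rw [convHom_log, h, add_zero]
  | poly s =>
    rw [← coeff_exps_regSer, regSer_convHom α β s.lt_len subset_rfl, h.copSer,
      ← coeff_exps_regSer, Finset.union_empty, leftSer, substOn]
    congr 1
    rw [subst_congr_of_supp (hasSubst_on fun i hi => by simp [hi]) MvPowerSeries.HasSubst.X
      (supp_regSer _ _ _) fun i hi => by simp only [if_pos hi], MvPowerSeries.subst_self, id]

/-- The left counit property of the coproduct. -/
theorem IsCounit.conv_left {α : HSymb →ₐ[ℚ] R} (h : IsCounit α) (β : HSymb →ₐ[ℚ] R) :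
    convHom α β = β := by
  refine MvPolynomial.algHom_ext fun g => ?_
  cases g with
  | log r => rw [convHom_log, h, zero_add]
  | poly s =>
    -- Once a block has been split off, the left factor is a nonempty word, which a counit sends to
    -- zero.
    have h0 : ∀ (S : Finset ℕ) (e : ℕ) (I : Finset ℕ) (a : ℕ → MvPowerSeries ℕ R), I.Nonempty →
        SymbPolylog.copSer (leftSer α s.len) β s.vec.support S e I a = 0 := by
      intro S
      induction hcard : S.card using Nat.strong_induction_on generalizing S with
      | _ n ih =>
      intro e I a hI
      rw [copSer_eq, leftSer, h.regSer hI]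
      have : substOn I a (0 : MvPowerSeries ℕ R) = 0 := by
        have := MvPowerSeries.subst_coe (R := R) (a := fun i => if i ∈ I then a i else 0) 0
        rwa [map_zero, MvPolynomial.coe_zero] at this
      rw [this, mul_zero, zero_add]
      refine Finset.sum_eq_zero fun i hi => Finset.sum_eq_zero fun j _ => ?_
      rw [copTerm, ih _ (hcard ▸ Finset.card_lt_card
        (Finset.filter_ssubset.2 ⟨i, hi, lt_irrefl _⟩)) _ rfl _ _ _ (Finset.insert_nonempty _ _),
        zero_mul]
    rw [← coeff_exps_regSer, regSer_convHom α β s.lt_len subset_rfl, copSer_eq,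
      Finset.sum_eq_zero fun i hi => Finset.sum_eq_zero fun j _ => by
        rw [copTerm, h0 _ _ _ _ (Finset.insert_nonempty _ _), zero_mul], add_zero, leftSer,
      regSer_empty, ← coeff_exps_regSer, substOn,
      ← MvPowerSeries.coe_substAlgHom (hasSubst_on (S := ∅) (by simp)), map_one, mul_one]

/-- The formula expresses the value of `β₁` at each generator through `β₀`, `lam` and `l` alone. -/
theorem Coaction.unique (h : Coaction β₀ β₁ J lam l) (h' : Coaction β₀ β₁' J lam l) :
    β₁ = β₁' := by
  refine MvPolynomial.algHom_ext fun g => ?_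
  cases g with
  | log r => rw [h.log, h'.log]
  | poly s =>
    have hn := isNext_nextPt s.lt_len
    rw [← coeff_exps_regSer, ← coeff_exps_regSer, h.reg _ _ _ hn, h'.reg _ _ _ hn]

/-- Coassociativity of the coproduct, if the last factor is cut off after weight one. -/
theorem Coaction.coassoc {ε δ : HSymb →ₐ[ℚ] R} (hε : IsCounit ε) (h : Coaction ε δ J lam l)
    (α β : HSymb →ₐ[ℚ] R) :
    convHom α (convHom β δ) = convHom (convHom α β) δ := by
  have h1 := h.conv β
  have h2 := h.conv (convHom α β)
  rw [hε.conv] at h1 h2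
  exact (h1.conv α).unique h2

end Coassociativity

/-! ### The projection to weights zero and one as a deformation of the augmentation. -/

section WeightOne

/-- The projection of `ℍ` onto its parts of weight zero and one. -/
def weightOneHom : HSymb →ₐ[ℚ] DualNumber HSymb :=
  MvPolynomial.aeval fun g =>
    if genWeight g = 1 then TrivSqZeroExt.inr (MvPolynomial.X g) else 0

theorem Symb.norm_eq_sum (s : Symb) : s.norm = ∑ i ∈ s.vec.support, s.vec i := rfl

theorem Symb.card_le_norm (s : Symb) : s.vec.support.card ≤ s.norm := by
  rw [Symb.norm_eq_sum, Finset.card_eq_sum_ones]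
  exact Finset.sum_le_sum fun i hi => Nat.one_le_iff_ne_zero.2 (Finsupp.mem_support_iff.1 hi)

theorem Symb.norm_pos (s : Symb) : 0 < s.norm :=
  lt_of_lt_of_le (Finset.card_pos.2 (Finsupp.support_nonempty_iff.2 s.ne_zero)) s.card_le_norm

theorem Symb.norm_eq (s : Symb) : s.norm = (∑ i ∈ s.vec.support,
    s.exps i) + s.vec.support.card := by
  rw [Symb.norm_eq_sum, Finset.card_eq_sum_ones, ← Finset.sum_add_distrib]
  refine Finset.sum_congr rfl fun i hi => ?_
  rw [Symb.exps, Finsupp.mapRange_apply]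
  have := Finsupp.mem_support_iff.1 hi
  omega

theorem genWeight_pos (g : Gen) : 0 < genWeight g := by
  cases g with
  | log r => exact one_pos
  | poly s => exact s.norm_pos

theorem weightOneHom_X_of_ne {g : Gen} (h : genWeight g ≠ 1) :
    weightOneHom (MvPolynomial.X g) = 0 := by
  rw [weightOneHom, MvPolynomial.aeval_X, if_neg h]

theorem fst_weightOneHom_X (g : Gen) : (weightOneHom (MvPolynomial.X g)).fst = 0 := by
  rw [weightOneHom, MvPolynomial.aeval_X]
  split_ifs <;> simp

variable {R : Type*} [CommRing R] [Algebra ℚ R]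

/-- The ideal generated by the infinitesimal elements. -/
def epsIdeal (f : DualNumber HSymb →ₐ[ℚ] R) : Ideal R :=
  Ideal.map f (RingHom.ker (TrivSqZeroExt.fstHom HSymb HSymb HSymb))

theorem epsIdeal_sq (f : DualNumber HSymb →ₐ[ℚ] R) :
    ∀ x ∈ epsIdeal f, ∀ y ∈ epsIdeal f, x * y = 0 := by
  intro x hx y hy
  have h1 : x * y ∈ epsIdeal f * epsIdeal f := Ideal.mul_mem_mul hx hy
  rw [epsIdeal, ← Ideal.map_mul] at h1
  have h2 : RingHom.ker (TrivSqZeroExt.fstHom HSymb HSymb HSymb) *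
      RingHom.ker (TrivSqZeroExt.fstHom HSymb HSymb HSymb) = ⊥ := by
    rw [eq_bot_iff, Ideal.mul_le]
    intro a ha b hb
    have ha' : a.fst = 0 := ha
    have hb' : b.fst = 0 := hb
    rw [Ideal.mem_bot]
    ext <;> simp [ha', hb']
  rw [h2, Ideal.map_bot, Ideal.mem_bot] at h1
  exact h1

/-- The augmentation of `ℍ`, with values in `R`. -/
def augHom (R : Type*) [CommRing R] [Algebra ℚ R] : HSymb →ₐ[ℚ] R :=
  MvPolynomial.aeval fun _ => 0

theorem isCounit_augHom : IsCounit (augHom R) := fun g => by simp [augHom]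

theorem apply_mem_epsIdeal (f : DualNumber HSymb →ₐ[ℚ] R) {x : HSymb}
    (hx : (weightOneHom x).fst = 0) : f (weightOneHom x) ∈ epsIdeal f :=
  Ideal.mem_map_of_mem _ hx

/-- The coefficient at `m` is the image of a symbol of weight `|S|` plus the degree of `m`. Weight
one occurs only for a single letter and `m = 0`. -/
theorem regSer_weightOneHom_eq_zero (f : DualNumber HSymb →ₐ[ℚ] R) {S : Finset ℕ} {e : ℕ}
    (hS : S.Nonempty) (hSe : ∀ s ∈ S, s < e) {m : ℕ →₀ ℕ}
    (h : m ≠ 0 ∨ 2 ≤ S.card) :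
    MvPowerSeries.coeff m (regSer (f.comp weightOneHom) S e) = 0 := by
  by_cases hm : m.support ⊆ S
  · rw [regSer_eq_genSeries, coeff_genSeries _ hS hSe hm, AlgHom.comp_apply, weightOneHom_X_of_ne,
      map_zero]
    rw [genWeight, Symb.norm_eq]
    simp only [Symb.exps, add_indicator_mapRange hm, support_add_indicator hm]
    have h1 := Finset.card_pos.2 hS
    rcases h with h | h
    · obtain ⟨x, hx⟩ := Finsupp.support_nonempty_iff.2 h
      have h2 := Finset.single_le_sum (f := m) (fun _ _ => Nat.zero_le _) (hm hx)
      have h3 := Finsupp.mem_support_iff.1 hx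
      omega
    · omega
  · by_contra h'
    exact hm (supp_regSer _ S e m h')

/-- The homomorphism onto the parts of weight zero and one is a first order deformation of the
augmentation. -/
theorem coaction_weightOneHom (f : DualNumber HSymb →ₐ[ℚ] R) :
    Coaction (augHom R) (f.comp weightOneHom) (epsIdeal f)
      (fun p q => if p < q then f (weightOneHom (MvPowerSeries.coeff 0 (seriesH {p} q))) else 0)
      (fun r => f (weightOneHom (MvPolynomial.X (Gen.log r)))) where
  sq := epsIdeal_sq f
  lam_mem p q := by
    split_ifs with hpq
    · refine apply_mem_epsIdeal f ?_
      rw [seriesH, coeff_genSeries _ (by simp) (by simpa using hpq) (by simp)]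
      exact fst_weightOneHom_X _
    · exact zero_mem _
  l_mem r := apply_mem_epsIdeal f (fst_weightOneHom_X _)
  log r := by rw [isCounit_augHom, zero_add]; rfl
  reg S e nx hn := by
    rcases S.eq_empty_or_nonempty with rfl | hS
    · simp [logSum, delSum, mergeSum]
    rw [isCounit_augHom.regSer hS, mul_zero, zero_add]
    have hm : (mergeSum (fun p q => if p < q then
        f (weightOneHom (MvPowerSeries.coeff 0 (seriesH {p} q))) else 0)
        (fun r => f (weightOneHom (MvPolynomial.X (Gen.log r)))) nx S fun s =>
        if nx s ∈ S then renameVar s (nx s) (regSer (augHom R) (S.erase (nx s)) e) else 0) = 0 := by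
      refine Finset.sum_eq_zero fun s hs => ?_
      dsimp only
      by_cases hx : nx s ∈ S
      · rw [if_pos hx]
        have hne : (S.erase (nx s)).Nonempty :=
          ⟨s, Finset.mem_erase.2 ⟨(hn.lt_nx s hs).ne, hs⟩⟩
        rw [isCounit_augHom.regSer hne, map_zero, mul_zero]
      · rw [if_neg hx, mul_zero]
    rw [hm, sub_zero]
    -- For one letter, deletion leaves the empty word, so the formula returns `lam` itself. For more
    -- letters every shorter word is nonempty and both sides vanish.
    rcases (Nat.one_le_iff_ne_zero.2 (Finset.card_pos.2 hS).ne').eq_or_lt with h1 | h1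
    · obtain ⟨p, rfl⟩ := Finset.card_eq_one.1 h1.symm
      have hp := hn.lt_nx p (by simp)
      have hnx : nx p = e := (hn.mem p (by simp)).resolve_left (by simp; omega)
      rw [hnx] at hp
      rw [delSum, Finset.sum_singleton, hnx, if_pos hp, Finset.erase_singleton, regSer_empty,
          mul_one]
      classical
      ext m
      rw [MvPowerSeries.coeff_C]
      split_ifs with hm0
      · rw [hm0]
        rw [regSer, MvPowerSeries.coeff_map]; rfl
      · exact regSer_weightOneHom_eq_zero f hS hn.lt (Or.inl hm0)
    · have hd : delSum (fun p q => if p < q then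
          f (weightOneHom (MvPowerSeries.coeff 0 (seriesH {p} q))) else 0) nx S
          (fun p => regSer (augHom R) (S.erase p) e) = 0 := by
        refine Finset.sum_eq_zero fun p hp => ?_
        have hne : (S.erase p).Nonempty := by
          rw [← Finset.card_pos, Finset.card_erase_of_mem hp]; omega
        dsimp only
        rw [isCounit_augHom.regSer hne, mul_zero]
      rw [hd]
      ext m
      rw [regSer_weightOneHom_eq_zero f hS hn.lt (Or.inr h1), map_zero]

end WeightOne

end

/-! ### Compatibility of the coproduct with the grading. -/

section

open MvPowerSeries (X C)

section Scaling

variable {R : Type*} [CommRing R]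

/-- The endomorphism `θ` of the coefficients acts on `f` as rescaling by `c`, up to `c ^ n`. -/
def Scales (θ : R →+* R) (c : R) (n : ℕ) (f : MvPowerSeries ℕ R) : Prop :=
  MvPowerSeries.map θ f = C (c ^ n) * MvPowerSeries.rescale (fun _ => c) f

namespace Scales

variable {θ : R →+* R} {c : R} {n n' : ℕ} {f g : MvPowerSeries ℕ R}

theorem one : Scales θ c 0 1 := by simp [Scales]

theorem add (hf : Scales θ c n f) (hg : Scales θ c n g) : Scales θ c n (f + g) := by
  rw [Scales, map_add, map_add, mul_add, ← hf, ← hg]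

theorem neg (hf : Scales θ c n f) : Scales θ c n (-f) := by
  rw [Scales, map_neg, map_neg, mul_neg, ← hf]

theorem sub (hf : Scales θ c n f) (hg : Scales θ c n g) : Scales θ c n (f - g) := by
  rw [sub_eq_add_neg]
  exact hf.add hg.neg

theorem mul (hf : Scales θ c n f) (hg : Scales θ c n' g) : Scales θ c (n + n') (f * g) := by
  rw [Scales] at *
  rw [map_mul, map_mul, hf, hg, pow_add, map_mul]
  ring

theorem sum {ι : Type*} {s : Finset ι} {f : ι → MvPowerSeries ℕ R}
    (h : ∀ i ∈ s, Scales θ c n (f i)) : Scales θ c n (∑ i ∈ s, f i) := by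
  rw [Scales, map_sum, map_sum, Finset.mul_sum]
  exact Finset.sum_congr rfl h

theorem of_eq (hf : Scales θ c n f) (h : n = n') : Scales θ c n' f := h ▸ hf

theorem rescale_X (j : ℕ) :
    MvPowerSeries.rescale (fun _ => c) (X j : MvPowerSeries ℕ R) = C c * X j := by
  rw [MvPowerSeries.rescale_eq_subst, MvPowerSeries.subst_X (MvPowerSeries.HasSubst.smul_X _),
    Pi.smul_apply', MvPowerSeries.smul_eq_C_mul]

/-- Division by a variable lowers the degree of each monomial by one and keeps its coefficient, so
the offset between weight and degree grows by one. -/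
theorem of_X_mul {j : ℕ} (h : Scales θ c n (X j * f)) : Scales θ c (n + 1) f := by
  rw [Scales, map_mul, map_mul, MvPowerSeries.map_X, rescale_X] at h
  refine X_mul_cancel (j := j) (h.trans ?_)
  rw [pow_succ, map_mul]
  ring

theorem subst {a b : ℕ → MvPowerSeries ℕ R} (ha : MvPowerSeries.HasSubst a)
    (hb : MvPowerSeries.HasSubst b) (hθ : ∀ i, MvPowerSeries.map θ (a i) = b i)
    (hc : ∀ i, MvPowerSeries.rescale (fun _ => c) (a i) = C c * b i) (hf : Scales θ c n f) :
    Scales θ c n (MvPowerSeries.subst a f) := by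
  have h1 : MvPowerSeries.map θ (MvPowerSeries.subst a f) =
      MvPowerSeries.subst b (MvPowerSeries.map θ f) := by
    rw [MvPowerSeries.map_subst ha]
    congr 1
    exact funext hθ
  have hX : MvPowerSeries.HasSubst ((fun _ => c : ℕ → R) • (X : ℕ → MvPowerSeries ℕ R)) :=
    MvPowerSeries.HasSubst.smul_X _
  rw [Scales, h1, hf, ← MvPowerSeries.coe_substAlgHom hb, map_mul,
      show MvPowerSeries.substAlgHom hb (C (c ^ n)) = C (c ^ n) from
      (MvPowerSeries.substAlgHom hb).commutes (c ^ n), MvPowerSeries.coe_substAlgHom hb,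
          MvPowerSeries.rescale_eq_subst,
    MvPowerSeries.rescale_eq_subst, MvPowerSeries.subst_comp_subst_apply hX hb,
    MvPowerSeries.subst_comp_subst_apply ha hX]
  congr 2
  funext i
  rw [← MvPowerSeries.rescale_eq_subst, hc, Pi.smul_apply', MvPowerSeries.subst_smul hb,
    MvPowerSeries.subst_X hb, MvPowerSeries.smul_eq_C_mul]

theorem shiftVars (hf : Scales θ c n f) (B : Finset ℕ) (j : ℕ) :
    Scales θ c n (shiftVars B j f) := by
  rw [SymbPolylog.shiftVars, MvPowerSeries.substAlgHom_apply]
  refine hf.subst (hasSubst_shift B j) (hasSubst_shift B j) (fun i => ?_) fun i => ?_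
  · split_ifs <;> simp
  · split_ifs <;> simp [rescale_X, mul_sub]

end Scales

variable [Algebra ℚ R] {θ : R →ₐ[ℚ] R} {c : ℚ} {β : HSymb →ₐ[ℚ] R}

theorem scales_expSeries {a : R} (h : θ a = c • a) (j : ℕ) :
    Scales (θ : R →+* R) (algebraMap ℚ R c) 0 (expSeries a j) := by
  have hX : MvPowerSeries.HasSubst
      ((fun _ => algebraMap ℚ R c : ℕ → R) • (X : ℕ → MvPowerSeries ℕ R)) :=
    MvPowerSeries.HasSubst.smul_X _
  rw [Scales, map_expSeries, pow_zero, map_one, one_mul, MvPowerSeries.rescale_eq_subst,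
    subst_expSeries hX, expSeries]
  congr 1
  rw [Pi.smul_apply', smul_smul, RingHom.coe_coe, h, Algebra.smul_def c a, mul_comm a]

/-- `θ` multiplies the image of each generator by a power of `c` according to its weight. -/
def ScalesGen (θ : R →ₐ[ℚ] R) (c : ℚ) (β : HSymb →ₐ[ℚ] R) : Prop :=
  ∀ g, θ (β (MvPolynomial.X g)) = c ^ genWeight g • β (MvPolynomial.X g)

theorem ScalesGen.logH (h : ScalesGen θ c β) (p q : ℕ) : θ (β (logH p q)) = c • β (logH p q) := by
  rw [SymbPolylog.logH, map_sum, map_sum, Finset.smul_sum]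
  exact Finset.sum_congr rfl fun r _ => by rw [h, genWeight, pow_one]

/-- The weight of a symbol is the degree of its monomial plus the number of its letters, because the
exponents are `n_r - 1`. -/
theorem ScalesGen.regSer (h : ScalesGen θ c β) {S : Finset ℕ} {e : ℕ} (hSe : ∀ s ∈ S, s < e) :
    Scales (θ : R →+* R) (algebraMap ℚ R c) S.card (regSer β S e) := by
  rcases S.eq_empty_or_nonempty with rfl | hS
  · rw [regSer_empty]
    exact .one
  rw [Scales]
  ext m
  rw [MvPowerSeries.coeff_map, MvPowerSeries.coeff_C_mul, MvPowerSeries.coeff_rescale]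
  by_cases hm : m.support ⊆ S
  · rw [regSer_eq_genSeries, coeff_genSeries _ hS hSe hm, RingHom.coe_coe, h, genWeight,
      Symb.norm_eq]
    simp only [Symb.exps, add_indicator_mapRange hm, support_add_indicator hm]
    rw [Algebra.smul_def, map_pow, add_comm, pow_add, mul_assoc, Finsupp.prod,
      Finset.prod_pow_eq_pow_sum]
    congr 3
    exact (Finset.sum_subset hm fun x _ hx => Finsupp.notMem_support_iff.1 hx).symm
  · have : MvPowerSeries.coeff m (SymbPolylog.regSer β S e) = 0 := by
      by_contra h'
      exact hm (supp_regSer _ S e m h')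
    rw [this, map_zero, mul_zero, mul_zero]

theorem card_filter_lt_add {S : Finset ℕ} {r : ℕ} :
    (S.filter (· < r)).card + (S.filter (r ≤ ·)).card = S.card := by
  rw [← Finset.card_filter_add_card_filter_not (s := S) (· < r)]
  simp only [not_lt]

theorem card_filter_le {S : Finset ℕ} {r : ℕ} (hr : r ∈ S) :
    (S.filter (r ≤ ·)).card = (S.filter (r < ·)).card + 1 := by
  have : S.filter (r ≤ ·) = insert r (S.filter (r < ·)) := by
    ext s
    simp only [Finset.mem_insert, Finset.mem_filter, le_iff_eq_or_lt]
    constructor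
    · rintro ⟨h1, h2⟩; exact h2.imp Eq.symm fun h => ⟨h1, h⟩
    · rintro (rfl | ⟨h1, h2⟩)
      · exact ⟨hr, Or.inl rfl⟩
      · exact ⟨h1, Or.inr h2⟩
  rw [this, Finset.card_insert_of_notMem (by simp)]

theorem ScalesGen.blockSer (h : ScalesGen θ c β) {S : Finset ℕ} {e : ℕ} (hSe : ∀ s ∈ S, s < e)
    (B : Finset ℕ) (i r : ℕ) (hinv : Scales (θ : R →+* R) (algebraMap ℚ R c)
      (S.filter (· < r)).card (invSer β (S.filter (· < r)) r)) :
    Scales (θ : R →+* R) (algebraMap ℚ R c) ((S.filter (· < r)).card + (S.filter (r < ·)).card)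
      (blockSer β B S i r e) := by
  have h1 := (scales_expSeries (h.logH i e) r).mul (hinv.shiftVars B r)
  rw [zero_add] at h1
  exact h1.mul ((h.regSer fun s hs => hSe s (Finset.mem_filter.1 hs).1).shiftVars B r)

/-- The numerator of a polar term has one letter fewer, and the division by `t_r` makes up for it.
-/
theorem ScalesGen.invSer (h : ScalesGen θ c β) {S : Finset ℕ} {e : ℕ} (hSe : ∀ s ∈ S, s < e) :
    Scales (θ : R →+* R) (algebraMap ℚ R c) S.card (invSer β S e) := by
  induction hcard : S.card using Nat.strong_induction_on generalizing S e with
  | _ n ih =>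
  rcases S.eq_empty_or_nonempty with rfl | hS
  · rw [invSer_empty, ← hcard]
    exact .one
  rw [← neg_neg (SymbPolylog.invSer β S e),
    neg_invSer' β subset_rfl (S.min'_mem hS) (fun s hs => S.min'_le s hs) e, ← hcard]
  refine (Scales.sum fun r hr => ?_).neg
  have h1 := ih (S.filter (· < r)).card
    (hcard ▸ Finset.card_lt_card (Finset.filter_ssubset.2 ⟨r, hr, lt_irrefl _⟩))
    (fun s hs => (Finset.mem_filter.1 hs).2) rfl
  have h2 : ∀ (p : ℕ → Prop) [DecidablePred p], ∀ s ∈ S.filter p, s < e := fun p _ s hs =>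
    hSe s (Finset.mem_filter.1 hs).1
  have hle := card_filter_le hr
  have hadd := card_filter_lt_add (S := S) (r := r)
  refine Scales.sub ((h1.mul (h.regSer (h2 _))).of_eq hadd) ?_
  refine Scales.of_eq (Scales.of_X_mul (j := r) (n := (S.filter (· < r)).card + (S.filter (r <
      ·)).card) ?_) (by omega)
  rw [X_mul_polarSer β subset_rfl]
  exact (h1.mul (h.regSer (h2 _))).sub (h.blockSer hSe _ _ _ h1)

/-- A block contributes one less than its number of letters, since the distinguished letter is left
out; the missing unit is the letter that the block adds to `I`. -/
theorem ScalesGen.copSer {Ψ : Finset ℕ → (ℕ → MvPowerSeries ℕ R) → MvPowerSeries ℕ R}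
    (h : ScalesGen θ c β)
    {E : ℕ} (hΨ : ∀ I a, (∀ i ∈ I, i < E) → (∀ i, MvPowerSeries.constantCoeff (a i) = 0) →
      (∀ i, MvPowerSeries.rescale (fun _ => algebraMap ℚ R c) (a i) =
        C (algebraMap ℚ R c) * MvPowerSeries.map (θ : R →+* R) (a i)) →
      Scales (θ : R →+* R) (algebraMap ℚ R c) I.card (Ψ I a))
    (B S : Finset ℕ) (e : ℕ) (hSe : ∀ s ∈ S, s < e) (heE : e ≤ E) (I : Finset ℕ)
    (hI : ∀ s ∈ S, ∀ i ∈ I, s < i) (hIE : ∀ i ∈ I, i < E)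
    (a : ℕ → MvPowerSeries ℕ R)
    (ha : ∀ i, MvPowerSeries.constantCoeff (a i) = 0)
    (ha' : ∀ i, MvPowerSeries.rescale (fun _ => algebraMap ℚ R c) (a i) =
        C (algebraMap ℚ R c) * MvPowerSeries.map (θ : R →+* R) (a i)) :
    Scales (θ : R →+* R) (algebraMap ℚ R c) (S.card + I.card) (copSer Ψ β B S e I a) := by
  induction hcard : S.card using Nat.strong_induction_on generalizing S e I a with
  | _ n ih =>
  rw [copSer_eq, ← hcard]
  refine ((h.regSer hSe).mul (hΨ I a hIE ha ha')).add (Scales.sum fun i hi => Scales.sum fun j hj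
      => ?_)
  obtain ⟨hjS, hij⟩ := Finset.mem_filter.1 hj
  have hiI : i ∉ I := fun h' => lt_irrefl _ (hI i hi i h')
  have h1 := ih _ (hcard ▸ Finset.card_lt_card (Finset.filter_ssubset.2 ⟨i, hi, lt_irrefl _⟩))
    (S.filter (· < i)) i (fun s hs => (Finset.mem_filter.1 hs).2) ((hSe i hi).le.trans heE)
    (insert i I)
    (fun s hs x hx => by
      rcases Finset.mem_insert.1 hx with rfl | hx
      · exact (Finset.mem_filter.1 hs).2
      · exact hI s (Finset.mem_filter.1 hs).1 x hx)
    (fun x hx => by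
      rcases Finset.mem_insert.1 hx with rfl | hx
      · exact (hSe x hi).trans_le heE
      · exact hIE x hx)
    (Function.update a i (X j)) (constantCoeff_update ha i j) (fun x => by
      rw [Function.update_apply]
      split_ifs
      · rw [Scales.rescale_X, MvPowerSeries.map_X]
      · exact ha' x) rfl
  have h2 := h.blockSer (S := S.filter (i ≤ ·)) (e := e)
    (fun s hs => hSe s (Finset.mem_filter.1 hs).1) B i j
    (h.invSer fun s hs => (Finset.mem_filter.1 hs).2)
  refine (h1.mul h2).of_eq ?_
  rw [Finset.card_insert_of_notMem hiI]
  have e1 := card_filter_lt_add (S := S) (r := i)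
  have e2 := card_filter_lt_add (S := S.filter (i ≤ ·)) (r := j)
  have e3 := card_filter_le hj
  omega

theorem ScalesGen.leftSer {α : HSymb →ₐ[ℚ] R} (h : ScalesGen θ c α) (e : ℕ) (I : Finset ℕ)
    (hI : ∀ i ∈ I, i < e) (a : ℕ → MvPowerSeries ℕ R)
    (ha : ∀ i, MvPowerSeries.constantCoeff (a i) = 0)
    (ha' : ∀ i, MvPowerSeries.rescale (fun _ => algebraMap ℚ R c) (a i) =
        C (algebraMap ℚ R c) * MvPowerSeries.map (θ : R →+* R) (a i)) :
    Scales (θ : R →+* R) (algebraMap ℚ R c) I.card (leftSer α e I a) := by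
  refine (h.regSer hI).subst (b := fun i => if i ∈ I then MvPowerSeries.map (θ : R →+* R) (a i)
    else 0) (hasSubst_on fun i _ => ha i) (hasSubst_on fun i _ => ?_) (fun i => ?_) fun i => ?_
  · rw [MvPowerSeries.constantCoeff_map, ha, map_zero]
  · split_ifs <;> simp
  · split_ifs
    · exact ha' i
    · simp

/-- Compatibility of the coproduct with the weights. -/
theorem ScalesGen.conv {α : HSymb →ₐ[ℚ] R} (hα : ScalesGen θ c α) (hβ : ScalesGen θ c β) :
    ScalesGen θ c (convHom α β) := by
  intro g
  cases g with
  | log r => rw [convHom_log, map_add, hα, hβ, smul_add]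
  | poly s =>
    have h := congrArg (MvPowerSeries.coeff s.exps) (hβ.copSer (E := s.len)
      (fun I a hI => hα.leftSer s.len I hI a) s.vec.support s.vec.support s.len s.lt_len le_rfl ∅
      (by simp) (by simp) (fun _ => 0) (by simp) (by simp))
    rw [← regSer_convHom α β s.lt_len subset_rfl, MvPowerSeries.coeff_map,
        MvPowerSeries.coeff_C_mul,
      MvPowerSeries.coeff_rescale, coeff_exps_regSer, Finset.card_empty, add_zero, Finsupp.prod,
      Finset.prod_pow_eq_pow_sum, ← mul_assoc, ← pow_add,
      Finset.sum_subset s.support_exps_subset fun x _ hx => Finsupp.notMem_support_iff.1 hx,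
      add_comm, ← s.norm_eq, ← map_pow, ← Algebra.smul_def] at h
    exact h

end Scaling

end

/-! ### The left factors of the coproduct of a vector. -/

section

open MvPowerSeries (X C)

section LeftFactors

variable {R : Type*} [CommRing R] [Algebra ℚ R]

/-- The sums of products of a vector (in the image of `α`) and an element of the image of `β`. -/
def leftSpan (α β : HSymb →ₐ[ℚ] R) : AddSubgroup R :=
  AddSubgroup.closure {x | ∃ (u : ZInf) (h : HSymb), x = α u.elt * β h}

variable {α β : HSymb →ₐ[ℚ] R}

theorem mul_mem_leftSpan {x : R} (hx : x ∈ leftSpan α β) (h : HSymb) :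
    x * β h ∈ leftSpan α β := by
  induction hx using AddSubgroup.closure_induction with
  | mem x hx =>
    obtain ⟨u, h', rfl⟩ := hx
    exact AddSubgroup.subset_closure ⟨u, h' * h, by rw [map_mul, mul_assoc]⟩
  | zero => rw [zero_mul]; exact zero_mem _
  | add x y _ _ hx hy => rw [add_mul]; exact add_mem hx hy
  | neg x _ hx => rw [neg_mul]; exact neg_mem hx

/-- The coefficients of `f` belong to the additive group `M`. -/
def CoeffsIn {R : Type*} [CommRing R] (M : AddSubgroup R) (f : MvPowerSeries ℕ R) : Prop :=
  ∀ m, MvPowerSeries.coeff m f ∈ M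

theorem CoeffsIn.mul_map {f : MvPowerSeries ℕ R} (hf : CoeffsIn (leftSpan α β) f)
    (g : MvPowerSeries ℕ HSymb) :
    CoeffsIn (leftSpan α β) (f * MvPowerSeries.map (β : HSymb →+* R) g) := by
  classical
  intro m
  rw [MvPowerSeries.coeff_mul]
  refine sum_mem fun p _ => ?_
  rw [MvPowerSeries.coeff_map]
  exact mul_mem_leftSpan (hf _) _

theorem CoeffsIn.add {R : Type*} [CommRing R] {M : AddSubgroup R} {f g : MvPowerSeries ℕ R} (hf :
    CoeffsIn M f)
    (hg : CoeffsIn M g) : CoeffsIn M (f + g) := fun m => by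
  rw [map_add]
  exact add_mem (hf m) (hg m)

theorem CoeffsIn.sum {R : Type*} [CommRing R] {M : AddSubgroup R} {ι : Type*} {s : Finset ι} {f : ι
    → MvPowerSeries ℕ R}
    (h : ∀ i ∈ s, CoeffsIn M (f i)) : CoeffsIn M (∑ i ∈ s, f i) := fun m => by
  rw [map_sum]
  exact sum_mem fun i hi => h i hi m

theorem CoeffsIn.subst {f : MvPowerSeries ℕ R} (hf : CoeffsIn (leftSpan α β) f)
    {a : ℕ → MvPowerSeries ℕ HSymb} (ha : MvPowerSeries.HasSubst a) :
    CoeffsIn (leftSpan α β)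
      (MvPowerSeries.subst (fun i => MvPowerSeries.map (β : HSymb →+* R) (a i)) f) := by
  intro m
  have ha' : MvPowerSeries.HasSubst fun i => MvPowerSeries.map (β : HSymb →+* R) (a i) := by
    refine ⟨fun i => ?_, fun d => ?_⟩
    · rw [MvPowerSeries.constantCoeff_map]
      exact (ha.const_coeff i).map _
    · refine (ha.coeff_zero d).subset fun i hi h => hi ?_
      simp only [MvPowerSeries.coeff_map, h, map_zero]
  rw [MvPowerSeries.coeff_subst ha']
  refine finsum_induction (· ∈ leftSpan α β) (zero_mem _) (fun _ _ => add_mem) fun d => ?_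
  have h : (d.prod fun i n => MvPowerSeries.map (β : HSymb →+* R) (a i) ^ n) =
      MvPowerSeries.map (β : HSymb →+* R) (d.prod fun i n => a i ^ n) := by
    rw [Finsupp.prod, Finsupp.prod, map_prod]
    exact Finset.prod_congr rfl fun i _ => (map_pow _ _ _).symm
  rw [h, MvPowerSeries.coeff_map, smul_eq_mul]
  exact mul_mem_leftSpan (hf d) _

theorem invSer_eq_map (S : Finset ℕ) (e : ℕ) :
    invSer β S e = MvPowerSeries.map (β : HSymb →+* R) ((-1) ^ S.card * invSeries S e) := by
  rw [invSer, map_mul, map_pow, map_neg, map_one]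

theorem blockSer_mem_range (B U : Finset ℕ) (i r k : ℕ) :
    ∃ g, blockSer β B U i r k = MvPowerSeries.map (β : HSymb →+* R) g := by
  refine ⟨expSeries (logH i k) r * shiftVars B r ((-1) ^ (U.filter (· < r)).card *
    invSeries (U.filter (· < r)) r) * shiftVars B r (seriesH (U.filter (r < ·)) k), ?_⟩
  rw [map_mul, map_mul, map_expSeries, map_shiftVars, map_shiftVars, ← invSer_eq_map]
  rfl

theorem coeffsIn_regSer (S : Finset ℕ) (e : ℕ) (hSe : ∀ s ∈ S, s < e) :
    CoeffsIn (leftSpan α β) (regSer α S e) := by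
  intro m
  by_cases hm : m.support ⊆ S
  · rcases S.eq_empty_or_nonempty with rfl | hS
    · obtain rfl : m = 0 := by simpa using hm
      rw [regSer_empty, MvPowerSeries.coeff_zero_one]
      exact AddSubgroup.subset_closure ⟨none, 1, by simp [ZInf.elt, ZInf.exponent]⟩
    · rw [regSer_eq_genSeries, coeff_genSeries _ hS hSe hm]
      have h : ∀ s : Symb, α (MvPolynomial.X (Gen.poly s)) ∈ leftSpan α β := fun s =>
        AddSubgroup.subset_closure ⟨some s, 1, by rw [map_one, mul_one]; rfl⟩
      exact h _
  · have : MvPowerSeries.coeff m (regSer α S e) = 0 := by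
      by_contra h'
      exact hm (supp_regSer _ S e m h')
    rw [this]
    exact zero_mem _

/-- Each summand has exactly one left word, and all else has coefficients in the image of `β`. The
substituted series are taken over `ℍ` and mapped by `β` so that substitution stays inside the span.
-/
theorem coeffsIn_copSer {Ψ : Finset ℕ → (ℕ → MvPowerSeries ℕ R) → MvPowerSeries ℕ R} {E : ℕ}
    (hΨ : ∀ (I : Finset ℕ) (a : ℕ → MvPowerSeries ℕ HSymb), (∀ i ∈ I, i < E) →
      (∀ i, MvPowerSeries.constantCoeff (a i) = 0) →
      CoeffsIn (leftSpan α β) (Ψ I fun i => MvPowerSeries.map (β : HSymb →+* R) (a i)))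
    (B S : Finset ℕ) (e : ℕ) (hSe : ∀ s ∈ S, s < e) (heE : e ≤ E) (I : Finset ℕ)
    (hIE : ∀ i ∈ I, i < E) (a : ℕ → MvPowerSeries ℕ HSymb)
    (ha : ∀ i, MvPowerSeries.constantCoeff (a i) = 0) :
    CoeffsIn (leftSpan α β)
      (copSer Ψ β B S e I fun i => MvPowerSeries.map (β : HSymb →+* R) (a i)) := by
  induction hcard : S.card using Nat.strong_induction_on generalizing S e I a with
  | _ n ih =>
  rw [copSer_eq, mul_comm]
  refine ((hΨ I a hIE ha).mul_map _).add (CoeffsIn.sum fun i hi => CoeffsIn.sum fun j _ => ?_)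
  have h1 := ih _ (hcard ▸ Finset.card_lt_card (Finset.filter_ssubset.2 ⟨i, hi, lt_irrefl _⟩))
    (S.filter (· < i)) i (fun s hs => (Finset.mem_filter.1 hs).2) ((hSe i hi).le.trans heE)
    (insert i I)
    (fun x hx => by
      rcases Finset.mem_insert.1 hx with rfl | hx
      · exact (hSe x hi).trans_le heE
      · exact hIE x hx)
    (Function.update a i (X j)) (constantCoeff_update ha i j) rfl
  have h2 : (fun x => MvPowerSeries.map (β : HSymb →+* R) (Function.update a i (X j) x)) =
      Function.update (fun x => MvPowerSeries.map (β : HSymb →+* R) (a x)) i (X j) := by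
    funext x
    rw [Function.update_apply, Function.update_apply]
    split_ifs <;> simp
  rw [h2] at h1
  obtain ⟨g, hg⟩ := blockSer_mem_range (β := β) B (S.filter (i ≤ ·)) i j e
  rw [copTerm, hg]
  exact h1.mul_map g

theorem coeffsIn_leftSer (E : ℕ) (I : Finset ℕ) (a : ℕ → MvPowerSeries ℕ HSymb)
    (hI : ∀ i ∈ I, i < E) (ha : ∀ i, MvPowerSeries.constantCoeff (a i) = 0) :
    CoeffsIn (leftSpan α β)
      (leftSer α E I fun i => MvPowerSeries.map (β : HSymb →+* R) (a i)) := by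
  have h := (coeffsIn_regSer (α := α) (β := β) I E hI).subst (a := fun i => if i ∈ I then a i else
      0)
    (hasSubst_on fun i _ => ha i)
  have h2 : (fun i => MvPowerSeries.map (β : HSymb →+* R) (if i ∈ I then a i else 0)) =
      fun i => if i ∈ I then MvPowerSeries.map (β : HSymb →+* R) (a i) else 0 := by
    funext x
    split_ifs <;> simp
  rw [h2] at h
  exact h

/-- The left factors of the coproduct of a vector are vectors. -/
theorem convHom_elt_mem (α β : HSymb →ₐ[ℚ] R) (v : ZInf) :
    convHom α β v.elt ∈ leftSpan α β := by
  cases v with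
  | none =>
    refine AddSubgroup.subset_closure ⟨none, 1, ?_⟩
    simp [ZInf.elt, ZInf.exponent]
  | some s =>
    have h := coeffsIn_copSer (fun I a hI ha => coeffsIn_leftSer (α := α) (β := β) s.len I a hI ha)
      s.vec.support s.vec.support s.len s.lt_len le_rfl ∅ (by simp) (fun _ => 0) (by simp) s.exps
    simp only [map_zero] at h
    rw [← regSer_convHom α β s.lt_len subset_rfl, coeff_exps_regSer] at h
    exact h

end LeftFactors

end

/-! ### The variation matrix: expansion, counit properties, coproduct of its entries. -/

section

section VariationMatrix

theorem ZInf.exponent_injective : Function.Injective ZInf.exponent := by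
  intro u v h
  cases u with
  | none =>
    cases v with
    | none => rfl
    | some s => exact absurd h.symm (by simp [ZInf.exponent])
  | some s =>
    cases v with
    | none => exact absurd h (by simp [ZInf.exponent])
    | some t =>
      have := (Finsupp.single_left_inj one_ne_zero).1 h
      rw [Gen.poly.inj this]

/-- The coefficient of the vector `u` in the left factor. -/
def leftCoeff (M : Type*) [AddCommGroup M] [Module ℚ M] (u : ZInf) : HSymb ⊗[ℚ] M →ₗ[ℚ] M :=
  TensorProduct.lid ℚ M ∘ₗ
    TensorProduct.map (MvPolynomial.lcoeff (R := ℚ) u.exponent) LinearMap.id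

theorem leftCoeff_tmul {M : Type*} [AddCommGroup M] [Module ℚ M] (u : ZInf) (x : HSymb) (m : M) :
    leftCoeff M u (x ⊗ₜ m) = MvPolynomial.coeff u.exponent x • m := by
  simp [leftCoeff]

theorem leftCoeff_elt_tmul {M : Type*} [AddCommGroup M] [Module ℚ M] [DecidableEq ZInf] (u v : ZInf)
    (m : M) : leftCoeff M u (v.elt ⊗ₜ m) = if v = u then m else 0 := by
  classical
  rw [leftCoeff_tmul, ZInf.elt, MvPolynomial.coeff_monomial]
  by_cases h : v = u
  · rw [if_pos (by rw [h]), if_pos h, one_smul]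
  · rw [if_neg (fun h' => h (ZInf.exponent_injective h')), if_neg h, zero_smul]

theorem V_eq (v u : ZInf) : V v u = leftCoeff HSymb u (coprod v.elt) := rfl

open Algebra.TensorProduct (includeLeft includeRight)

theorem coprod_eq_convHom : coprod = convHom (includeLeft : HSymb →ₐ[ℚ] HSymb ⊗[ℚ] HSymb)
    includeRight := by
  rw [convHom, Algebra.TensorProduct.lift_includeLeft_includeRight, AlgHom.id_comp]

/-- The left factors are vectors, and distinct vectors are distinct monomials. Reading off
coefficients hence recovers the expansion, and only finitely many vectors occur. -/
theorem coprod_elt_eq_sum (v : ZInf) : ∃ F : Finset ZInf, (∀ u, V v u ≠ 0 → u ∈ F) ∧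
    coprod v.elt = ∑ u ∈ F, u.elt ⊗ₜ[ℚ] V v u := by
  classical
  have h : coprod v.elt ∈ leftSpan (includeLeft : HSymb →ₐ[ℚ] HSymb ⊗[ℚ] HSymb) includeRight := by
    rw [coprod_eq_convHom]
    exact convHom_elt_mem _ _ v
  suffices H : ∀ x ∈ leftSpan (includeLeft : HSymb →ₐ[ℚ] HSymb ⊗[ℚ] HSymb) includeRight,
      ∃ (F : Finset ZInf) (c : ZInf → HSymb), x = ∑ u ∈ F, u.elt ⊗ₜ[ℚ] c u by
    obtain ⟨F, c, hc⟩ := H _ h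
    have hV : ∀ u, V v u = if u ∈ F then c u else 0 := by
      intro u
      simp only [V_eq, hc, map_sum, leftCoeff_elt_tmul, Finset.sum_ite_eq']
    refine ⟨F, fun u hu => ?_, hc.trans (Finset.sum_congr rfl fun u hu => ?_)⟩
    · by_contra h'
      exact hu (by rw [hV, if_neg h'])
    · rw [hV, if_pos hu]
  intro x hx
  induction hx using AddSubgroup.closure_induction with
  | mem x hx =>
    obtain ⟨u, h, rfl⟩ := hx
    exact ⟨{u}, fun _ => h, by simp⟩
  | zero => exact ⟨∅, 0, by simp⟩
  | add x y _ _ hx hy =>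
    obtain ⟨F, c, rfl⟩ := hx
    obtain ⟨G, d, rfl⟩ := hy
    refine ⟨F ∪ G, fun u => (if u ∈ F then c u else 0) + if u ∈ G then d u else 0, ?_⟩
    simp only [TensorProduct.tmul_add, Finset.sum_add_distrib]
    congr 1
    · rw [← Finset.sum_subset Finset.subset_union_left fun u _ hu => by simp [hu]]
      exact Finset.sum_congr rfl fun u hu => by rw [if_pos hu]
    · rw [← Finset.sum_subset Finset.subset_union_right fun u _ hu => by simp [hu]]
      exact Finset.sum_congr rfl fun u hu => by rw [if_pos hu]
  | neg x _ hx =>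
    obtain ⟨F, c, rfl⟩ := hx
    exact ⟨F, fun u => -c u, by simp [TensorProduct.tmul_neg]⟩

theorem finite_row (v : ZInf) : {u | V v u ≠ 0}.Finite := by
  obtain ⟨F, hF, -⟩ := coprod_elt_eq_sum v
  exact F.finite_toSet.subset hF

/-- The support of a row of the variation matrix. -/
def row (v : ZInf) : Finset ZInf := (finite_row v).toFinset

theorem mem_row {v u : ZInf} : u ∈ row v ↔ V v u ≠ 0 := by simp [row]

theorem coprod_elt (v : ZInf) : coprod v.elt = ∑ u ∈ row v, u.elt ⊗ₜ[ℚ] V v u := by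
  obtain ⟨F, hF, h⟩ := coprod_elt_eq_sum v
  rw [h]
  refine (Finset.sum_subset (fun u hu => hF u (mem_row.1 hu)) fun u _ hu => ?_).symm
  rw [not_not.1 (mt mem_row.2 hu), TensorProduct.tmul_zero]

theorem finsum_eq_sum_row {M : Type*} [AddCommMonoid M] (v : ZInf) {f : ZInf → M}
    (hf : ∀ u, V v u = 0 → f u = 0) : ∑ᶠ u, f u = ∑ u ∈ row v, f u :=
  finsum_eq_sum_of_support_subset f fun u hu => by
    rw [Finset.mem_coe, mem_row]
    exact fun h => hu (hf u h)

theorem coprod_elt_finsum (v : ZInf) : coprod v.elt = ∑ᶠ u : ZInf, u.elt ⊗ₜ[ℚ] V v u := by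
  rw [coprod_elt, finsum_eq_sum_row v fun u hu => by rw [hu, TensorProduct.tmul_zero]]

variable {R : Type*} [CommRing R] [Algebra ℚ R]

theorem convHom_elt (α β : HSymb →ₐ[ℚ] R) (v : ZInf) :
    convHom α β v.elt = ∑ u ∈ row v, α u.elt * β (V v u) := by
  rw [convHom, AlgHom.comp_apply, coprod_elt, map_sum]
  exact Finset.sum_congr rfl fun u _ => by rw [Algebra.TensorProduct.lift_tmul]

theorem comp_convHom {R' : Type*} [CommRing R'] [Algebra ℚ R'] (f : R →ₐ[ℚ] R')
    (α β : HSymb →ₐ[ℚ] R) : f.comp (convHom α β) = convHom (f.comp α) (f.comp β) := by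
  rw [convHom, convHom, ← AlgHom.comp_assoc]
  congr 1
  exact Algebra.TensorProduct.ext' fun a b => by simp

theorem augHom_eq (x : HSymb) : augHom R x = algebraMap ℚ R (MvPolynomial.coeff 0 x) := by
  rw [augHom, MvPolynomial.aeval_zero', MvPolynomial.constantCoeff_eq]

/-- The right counit property, compared at the coefficient of the vector `u`: in weight zero `V` is
the identity matrix. -/
theorem coeff_zero_V (v u : ZInf) [Decidable (v = u)] :
    MvPolynomial.coeff 0 (V v u) = if v = u then 1 else 0 := by
  classical
  have h := congrArg (fun f => MvPolynomial.coeff u.exponent (f v.elt))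
    ((isCounit_augHom (R := HSymb)).conv (AlgHom.id ℚ HSymb))
  simp only [convHom_elt, AlgHom.id_apply, augHom_eq, MvPolynomial.coeff_sum] at h
  have h1 : ∀ k : ZInf, MvPolynomial.coeff u.exponent
      (k.elt * algebraMap ℚ HSymb (MvPolynomial.coeff 0 (V v k))) =
      if k = u then MvPolynomial.coeff 0 (V v k) else 0 := by
    intro k
    rw [mul_comm, MvPolynomial.algebraMap_eq, MvPolynomial.coeff_C_mul, ZInf.elt,
      MvPolynomial.coeff_monomial]
    by_cases hk : k = u
    · rw [if_pos (by rw [hk]), if_pos hk, mul_one]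
    · rw [if_neg fun h' => hk (ZInf.exponent_injective h'), if_neg hk, mul_zero]
  simp only [h1, Finset.sum_ite_eq'] at h
  have h2 : MvPolynomial.coeff 0 (V v u) = MvPolynomial.coeff u.exponent v.elt := by
    rw [← h]
    split_ifs with hu
    · rfl
    · rw [not_not.1 (mt mem_row.2 hu), MvPolynomial.coeff_zero]
  rw [h2, ZInf.elt, MvPolynomial.coeff_monomial]
  by_cases hk : v = u
  · rw [if_pos (by rw [hk]), if_pos hk]
  · rw [if_neg fun h' => hk (ZInf.exponent_injective h'), if_neg hk]

/-- The first column of the variation matrix. -/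
theorem V_none (v : ZInf) : V v none = v.elt := by
  have h := congrArg (fun f => f v.elt)
    ((isCounit_augHom (R := HSymb)).conv_left (AlgHom.id ℚ HSymb))
  simp only [convHom_elt, AlgHom.id_apply, augHom_eq] at h
  rw [← h]
  have h1 : ∀ k : ZInf, MvPolynomial.coeff 0 k.elt = if k = none then 1 else 0 := by
    classical
    intro k
    rw [ZInf.elt, MvPolynomial.coeff_monomial]
    cases k with
    | none => simp [ZInf.exponent]
    | some s => simp [ZInf.exponent]
  classical
  rw [Finset.sum_eq_single none]
  · simp [h1]
  · intro k _ hk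
    rw [h1, if_neg hk, map_zero, zero_mul]
  · intro hn
    rw [not_not.1 (mt mem_row.2 hn), mul_zero]

end VariationMatrix

section FirstOrder

theorem weightPart_monomial (n : ℕ) (d : Gen →₀ ℕ) (c : ℚ) :
    weightPart n (MvPolynomial.monomial d c) =
      if Finsupp.weight genWeight d = n then MvPolynomial.monomial d c else 0 := by
  split_ifs with h
  · exact (MvPolynomial.isWeightedHomogeneous_monomial _ _ _ h).weightedHomogeneousComponent_same
  · exact (MvPolynomial.isWeightedHomogeneous_monomial _ _ _ rfl).weightedHomogeneousComponent_ne
      n (Ne.symm h)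

theorem fst_weightOneHom (x : HSymb) :
    (weightOneHom x).fst = MvPolynomial.C (MvPolynomial.coeff 0 x) := by
  have : (TrivSqZeroExt.fstHom ℚ HSymb HSymb).comp weightOneHom = augHom HSymb :=
    MvPolynomial.algHom_ext fun g => by
      rw [isCounit_augHom]
      exact fst_weightOneHom_X g
  exact (congrArg (fun f => f x) this).trans (augHom_eq x)

theorem weight_eq_zero {d : Gen →₀ ℕ} (h : Finsupp.weight genWeight d = 0) : d = 0 := by
  ext g
  by_contra hg
  have := Finsupp.le_weight_of_ne_zero' genWeight hg
  have := genWeight_pos g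
  omega

/-- The infinitesimal part is a derivation over the augmentation. It kills products of generators,
and all generators have positive weight. -/
theorem snd_weightOneHom (x : HSymb) : (weightOneHom x).snd = weightPart 1 x := by
  induction x using MvPolynomial.induction_on with
  | C a =>
    rw [← MvPolynomial.algebraMap_eq, AlgHom.commutes, TrivSqZeroExt.algebraMap_eq_inl']
    rw [MvPolynomial.algebraMap_eq, MvPolynomial.C_apply, weightPart_monomial]
    simp
  | add p q hp hq => rw [map_add, TrivSqZeroExt.snd_add, hp, hq, map_add]
  | mul_X p g _ =>
    rw [map_mul, TrivSqZeroExt.snd_mul, fst_weightOneHom, fst_weightOneHom_X, MulOpposite.op_zero,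
      zero_smul, add_zero, weightOneHom, MvPolynomial.aeval_X]
    classical
    ext e
    rw [weightPart, MvPolynomial.coeff_weightedHomogeneousComponent, MvPolynomial.coeff_mul_X',
      smul_eq_mul, MvPolynomial.coeff_C_mul]
    by_cases hg : g ∈ e.support
    · obtain ⟨d, rfl⟩ : ∃ d, e = d + Finsupp.single g 1 := by
        refine ⟨e - Finsupp.single g 1, (tsub_add_cancel_of_le ?_).symm⟩
        rw [Finsupp.single_le_iff]
        exact Nat.one_le_iff_ne_zero.2 (Finsupp.mem_support_iff.1 hg)
      rw [if_pos hg, add_tsub_cancel_right, map_add, Finsupp.weight_single, one_smul]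
      by_cases h1 : genWeight g = 1
      · rw [if_pos h1, TrivSqZeroExt.snd_inr, MvPolynomial.coeff_X, h1]
        by_cases hd : d = 0
        · simp [hd]
        · rw [if_neg, if_neg, mul_zero]
          · exact fun h => hd (weight_eq_zero (by omega))
          · intro h
            exact hd (by simpa using h)
      · rw [if_neg h1, TrivSqZeroExt.snd_zero, MvPolynomial.coeff_zero, mul_zero, if_neg]
        have := genWeight_pos g
        omega
    · rw [if_neg hg, ite_self]
      split_ifs with h1
      · rw [TrivSqZeroExt.snd_inr, MvPolynomial.coeff_X, if_neg, mul_zero]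
        rintro rfl
        simp at hg
      · simp

theorem toWeightOne_weightPart (x : HSymb) : toWeightOne (weightPart 1 x) = toWeightOne x := by
  apply Subtype.ext
  exact (MvPolynomial.weightedHomogeneousComponent_isWeightedHomogeneous 1
      x).weightedHomogeneousComponent_same

open Algebra.TensorProduct (includeLeft includeRight)

/-- Evaluate both bracketings of the triple convolution at `v` and compare the coefficients of the
vector `u` in the leftmost factor. The maps `L` are these coefficient functionals; `convHom_V`
supplies them on `ℍ ⊗ D`. -/
theorem convHom_V_of_section {R D : Type*} [CommRing R] [Algebra ℚ R] [CommRing D] [Algebra ℚ D]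
    (α : HSymb →ₐ[ℚ] R) (ι : D →ₐ[ℚ] R) (L : ZInf → R →+ D)
    (hL : ∀ (u k : ZInf) (y : D), (k = u → L u (α k.elt * ι y) = y) ∧
      (k ≠ u → L u (α k.elt * ι y) = 0))
    (β : HSymb →ₐ[ℚ] D) (f : DualNumber HSymb →ₐ[ℚ] D) (v u : ZInf) :
    convHom β (f.comp weightOneHom) (V v u) = ∑ k ∈ row v, β (V k u) * f (weightOneHom (V v k)) :=
        by
  have hsum : ∀ (k : ZInf) (y : ZInf → D), (V k u = 0 → y u = 0) →
      L u (∑ l ∈ row k, α l.elt * ι (y l)) = y u := by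
    intro k y hy
    rw [map_sum, Finset.sum_eq_single u]
    · exact (hL u u _).1 rfl
    · exact fun l _ hl => (hL u l _).2 hl
    · intro hu
      rw [(hL u u _).1 rfl, hy (not_not.1 (mt mem_row.2 hu))]
  have h : L u (convHom α (convHom (ι.comp β) ((ι.comp f).comp weightOneHom)) v.elt) =
      L u (convHom (convHom α (ι.comp β)) ((ι.comp f).comp weightOneHom) v.elt) := by
    rw [(coaction_weightOneHom (ι.comp f)).coassoc isCounit_augHom α (ι.comp β)]
  have h1 : convHom (ι.comp β) ((ι.comp f).comp weightOneHom) =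
      ι.comp (convHom β (f.comp weightOneHom)) := by
    rw [comp_convHom, AlgHom.comp_assoc]
  rw [h1, convHom_elt, convHom_elt] at h
  refine ((hsum v _ fun h0 => by rw [h0, map_zero]).symm.trans h).trans ?_
  rw [map_sum]
  refine Finset.sum_congr rfl fun k _ => ?_
  rw [convHom_elt, Finset.sum_mul, ← hsum k (fun l => β (V k l) * f (weightOneHom (V v k)))
    fun h0 => by rw [h0, map_zero, zero_mul]]
  congr 1
  refine Finset.sum_congr rfl fun l _ => ?_
  rw [map_mul, ← mul_assoc]
  rfl

theorem convHom_V {D : Type*} [CommRing D] [Algebra ℚ D] (β : HSymb →ₐ[ℚ] D)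
    (f : DualNumber HSymb →ₐ[ℚ] D) (v u : ZInf) :
    convHom β (f.comp weightOneHom) (V v u) =
      ∑ k ∈ row v, β (V k u) * f (weightOneHom (V v k)) := by
  classical
  refine convHom_V_of_section (R := HSymb ⊗[ℚ] D) includeLeft includeRight
    (fun u => (leftCoeff D u).toAddMonoidHom) (fun u k y => ?_) β f v u
  have : leftCoeff D u (k.elt ⊗ₜ y) = if k = u then y else 0 := leftCoeff_elt_tmul u k y
  constructor
  · intro h
    rw [if_pos h] at this
    simpa using this
  · intro h
    rw [if_neg h] at this
    simpa using this

/-- The algebra of dual numbers over `ℍ`. -/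
def DualSymb : Type := DualNumber HSymb

instance : CommRing DualSymb := inferInstanceAs (CommRing (DualNumber HSymb))

instance : Algebra ℚ DualSymb := inferInstanceAs (Algebra ℚ (DualNumber HSymb))

/-- The identity map to `DualSymb`. -/
def toDualSymb : DualNumber HSymb →ₐ[ℚ] DualSymb := AlgHom.id ℚ (DualNumber HSymb)

/-- The weight one part of the infinitesimal part. -/
def sndDualSymb : DualSymb →ₗ[ℚ] WeightOne where
  toFun x := toWeightOne (TrivSqZeroExt.snd (R := HSymb) (M := HSymb) x)
  map_add' x _ := map_add toWeightOne (TrivSqZeroExt.snd (R := HSymb) (M := HSymb) x) _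
  map_smul' c x := map_smul toWeightOne c (TrivSqZeroExt.snd (R := HSymb) (M := HSymb) x)

theorem sndDualSymb_weightOneHom (x : HSymb) :
    sndDualSymb (toDualSymb (weightOneHom x)) = toWeightOne x := by
  rw [← toWeightOne_weightPart x, ← snd_weightOneHom]
  rfl

/-- The products of the entries of the variation matrix with those of its weight one part give the
coproduct of its entries. -/
theorem coprod_V (v u : ZInf) :
    TensorProduct.map LinearMap.id toWeightOne (coprod (V v u)) =
      ∑ k ∈ row v, V k u ⊗ₜ[ℚ] toWeightOne (V v k) := by
  -- The universal case: `β` is the left inclusion, `f` is the inclusion of the dual numbers on the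
  -- right, and the infinitesimal part is the weight one component.
  have h := congrArg (TensorProduct.map LinearMap.id sndDualSymb) (convHom_V (D := HSymb ⊗[ℚ]
      DualSymb)
    includeLeft (includeRight.comp toDualSymb) v u)
  rw [map_sum] at h
  have h0 : convHom (R := HSymb ⊗[ℚ] DualSymb) includeLeft
      ((includeRight.comp toDualSymb).comp weightOneHom) =
      (Algebra.TensorProduct.map (AlgHom.id ℚ HSymb) (toDualSymb.comp weightOneHom)).comp
        coprod := by
    rw [convHom]
    congr 1
    exact Algebra.TensorProduct.ext' fun a b => by simp
  have h1 : TensorProduct.map LinearMap.id sndDualSymb ∘ₗ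
      (Algebra.TensorProduct.map (AlgHom.id ℚ HSymb) (toDualSymb.comp weightOneHom)).toLinearMap =
      TensorProduct.map (LinearMap.id (R := ℚ) (M := HSymb)) toWeightOne :=
    TensorProduct.ext' fun a b => by
      simp only [LinearMap.comp_apply, AlgHom.toLinearMap_apply, Algebra.TensorProduct.map_tmul,
        TensorProduct.map_tmul, AlgHom.id_apply, LinearMap.id_apply, AlgHom.comp_apply,
        sndDualSymb_weightOneHom]
  rw [h0] at h
  rw [← h1]
  refine h.trans (Finset.sum_congr rfl fun k _ => ?_)
  simp [sndDualSymb_weightOneHom]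

end FirstOrder

end

/-! ### The symbols of the entries of the variation matrix. -/

section

section Symbol

/-- The endomorphism of `ℍ` that multiplies elements of weight `n` by `2 ^ n`. -/
def doubling : HSymb →ₐ[ℚ] HSymb :=
  MvPolynomial.aeval fun g => (2 : ℚ) ^ genWeight g • MvPolynomial.X g

theorem doubling_monomial (d : Gen →₀ ℕ) (c : ℚ) :
    doubling (MvPolynomial.monomial d c) =
      (2 : ℚ) ^ Finsupp.weight genWeight d • MvPolynomial.monomial d c := by
  rw [doubling, MvPolynomial.aeval_monomial, MvPolynomial.monomial_eq, MvPolynomial.algebraMap_eq,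
    Finsupp.weight_apply, Finsupp.prod, Finsupp.prod, Finsupp.sum, ← Finset.prod_pow_eq_pow_sum,
    ← mul_smul_comm, Finset.prod_congr rfl fun g _ => smul_pow _ _ _, Finset.prod_smul]
  congr 3
  exact funext fun g => by rw [← pow_mul, smul_eq_mul, mul_comm]

theorem weightPart_doubling (n : ℕ) (x : HSymb) :
    weightPart n (doubling x) = (2 : ℚ) ^ n • weightPart n x := by
  induction x using MvPolynomial.induction_on' with
  | monomial d c =>
    rw [doubling_monomial, map_smul, weightPart_monomial]
    split_ifs with h
    · rw [h]
    · rw [smul_zero, smul_zero]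
  | add p q hp hq => rw [map_add, map_add, hp, hq, map_add, smul_add]

theorem toWeightOne_doubling (x : HSymb) :
    toWeightOne (doubling x) = (2 : ℚ) • toWeightOne x :=
  Subtype.ext ((weightPart_doubling 1 x).trans (by rw [pow_one]; rfl))

theorem coprod_doubling (x : HSymb) :
    coprod (doubling x) = Algebra.TensorProduct.map doubling doubling (coprod x) := by
  have h : ScalesGen (Algebra.TensorProduct.map doubling doubling) 2 coprod := by
    rw [coprod_eq_convHom]
    refine ScalesGen.conv (fun g => ?_) fun g => ?_
    · simp [doubling, TensorProduct.smul_tmul']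
    · simp [doubling, TensorProduct.tmul_smul]
  have h1 : coprod.comp doubling =
      (Algebra.TensorProduct.map doubling doubling).comp coprod :=
    MvPolynomial.algHom_ext fun g => by
      rw [AlgHom.comp_apply, AlgHom.comp_apply, h, doubling, MvPolynomial.aeval_X, map_smul]
  exact congrArg (fun F => F x) h1

theorem symbolAux_succ (n : ℕ) (x : HSymb) : symbolAux (n + 1) x =
    LinearMap.mul' ℚ (TensorAlgebra ℚ WeightOne)
      (TensorProduct.map (symbolAux n ∘ₗ weightPart n) (TensorAlgebra.ι ℚ ∘ₗ toWeightOne)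
        (coprod x)) := rfl

theorem symbolAux_doubling (n : ℕ) (x : HSymb) :
    symbolAux (n + 1) (doubling x) = (2 : ℚ) ^ (n + 1) • symbolAux (n + 1) x := by
  rw [symbolAux_succ, symbolAux_succ, coprod_doubling]
  generalize coprod x = y
  induction y using TensorProduct.induction_on with
  | zero => simp
  | tmul a b =>
    rw [Algebra.TensorProduct.map_tmul, TensorProduct.map_tmul, TensorProduct.map_tmul]
    simp only [LinearMap.comp_apply, weightPart_doubling, toWeightOne_doubling, map_smul,
      LinearMap.mul'_apply, smul_mul_smul_comm, pow_succ]
  | add a b ha hb => simp only [map_add, ha, hb, smul_add]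

/-- The map in length `n` sees only weight `n`. In positive length, doubling a monomial of weight
`d` multiplies its image both by `2 ^ d` and by `2 ^ n`, so for `d ≠ n` the image vanishes. -/
theorem symbolAux_weightPart (n : ℕ) (x : HSymb) : symbolAux n (weightPart n x) = symbolAux n x :=
    by
  induction x using MvPolynomial.induction_on' with
  | monomial d c =>
    rw [weightPart_monomial]
    split_ifs with h
    · rfl
    rw [map_zero]
    cases n with
    | zero =>
      have : d ≠ 0 := by
        rintro rfl
        exact h (map_zero _)
      classical
      simp [symbolAux, MvPolynomial.coeff_monomial, this]
    | succ n =>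
      have h1 := symbolAux_doubling n (MvPolynomial.monomial d c)
      rw [doubling_monomial, map_smul, ← sub_eq_zero, ← sub_smul] at h1
      refine ((smul_eq_zero.1 h1).resolve_left ?_).symm
      exact fun h2 => h (pow_right_injective₀ (two_pos (α := ℚ)) (by norm_num) (sub_eq_zero.1 h2))
  | add p q hp hq => rw [map_add, map_add, hp, hq, map_add]

theorem symbolMap_weightPart (n : ℕ) (x : HSymb) :
    symbolMap (weightPart n x) = symbolAux n x := by
  rw [← symbolAux_weightPart]
  induction x using MvPolynomial.induction_on' with
  | monomial d c =>
    rw [weightPart_monomial]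
    split_ifs with h
    · rw [← mul_one c, ← smul_eq_mul, ← MvPolynomial.smul_monomial, map_smul, map_smul]
      congr 1
      have := (MvPolynomial.basisMonomials Gen ℚ).constr_basis ℚ (fun m =>
        symbolAux (Finsupp.weight genWeight m) (MvPolynomial.monomial m 1)) d
      rw [MvPolynomial.coe_basisMonomials, h] at this
      exact this
    · rw [map_zero, map_zero]
  | add p q hp hq => rw [map_add, map_add, hp, hq, map_add]

/-- The weight one entries of the variation matrix. -/
def omega (v u : ZInf) : WeightOne := toWeightOne (V v u)

theorem symbolAux_zero_V (v u : ZInf) [Decidable (v = u)] :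
    symbolAux 0 (V v u) = if v = u then 1 else 0 := by
  have : symbolAux 0 (V v u) = algebraMap ℚ _ (MvPolynomial.coeff 0 (V v u)) := rfl
  rw [this, coeff_zero_V]
  split_ifs <;> simp

/-- The recursion of the symbol map combined with `coprod_V`. Words are read from `u` to `v`, so the
last letter belongs to the first step of the chain out of `v`. -/
theorem symbolAux_succ_V (n : ℕ) (v u : ZInf) : symbolAux (n + 1) (V v u) =
    ∑ k ∈ row v, symbolAux n (V k u) * TensorAlgebra.ι ℚ (omega v k) := by
  have h1 : TensorProduct.map (symbolAux n ∘ₗ weightPart n) (TensorAlgebra.ι ℚ ∘ₗ toWeightOne) =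
      TensorProduct.map (symbolAux n ∘ₗ weightPart n) (TensorAlgebra.ι ℚ (M := WeightOne)) ∘ₗ
        TensorProduct.map LinearMap.id toWeightOne := by
    rw [← TensorProduct.map_comp, LinearMap.comp_id]
  rw [symbolAux_succ, h1, LinearMap.comp_apply, coprod_V, map_sum, map_sum]
  refine Finset.sum_congr rfl fun k _ => ?_
  rw [TensorProduct.map_tmul, LinearMap.mul'_apply, LinearMap.comp_apply, symbolAux_weightPart]
  rfl

theorem sum_row_of_subset {M : Type*} [AddCommMonoid M] {v : ZInf} {F : Finset ZInf}
    (hF : row v ⊆ F) {f : ZInf → M} (hf : ∀ u, V v u = 0 → f u = 0) :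
    ∑ u ∈ row v, f u = ∑ u ∈ F, f u :=
  Finset.sum_subset hF fun u _ hu => hf u (not_not.1 (mt mem_row.2 hu))

theorem omega_eq_zero {v u : ZInf} (h : V v u = 0) : omega v u = 0 := by
  rw [omega, h, map_zero]

theorem self_mem_row (v : ZInf) : v ∈ row v := by
  classical
  rw [mem_row]
  intro h
  have := coeff_zero_V v v
  rw [h, if_pos rfl, MvPolynomial.coeff_zero] at this
  exact zero_ne_one this

/-- Splitting off the first letter instead needs no further coassociativity: the previous lemma
already determines the symbol as a sum over chains, and the two ends of a chain play symmetric
roles. -/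
theorem symbolAux_succ_V' (n : ℕ) (v u : ZInf) : symbolAux (n + 1) (V v u) =
    ∑ k ∈ row v, TensorAlgebra.ι ℚ (omega k u) * symbolAux n (V v k) := by
  classical
  induction n generalizing v u with
  | zero =>
    rw [symbolAux_succ_V, Finset.sum_eq_single u, Finset.sum_eq_single v, symbolAux_zero_V,
      symbolAux_zero_V, if_pos rfl, if_pos rfl, one_mul, mul_one]
    · intro k _ hk
      rw [symbolAux_zero_V, if_neg hk.symm, mul_zero]
    · exact fun h => absurd (self_mem_row v) h
    · intro k _ hk
      rw [symbolAux_zero_V, if_neg hk, zero_mul]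
    · intro h
      rw [omega_eq_zero (not_not.1 (mt mem_row.2 h)), map_zero, mul_zero]
  | succ n ih =>
    -- A finite set that contains every vector reachable in at most two steps from `v`, so that the
    -- two sums have independent ranges and can be exchanged.
    set F := row v ∪ (row v).biUnion row with hFdef
    have hF : ∀ k ∈ row v, row k ⊆ F := fun k hk =>
      (Finset.subset_biUnion_of_mem row hk).trans Finset.subset_union_right
    calc symbolAux (n + 1 + 1) (V v u)
        = ∑ k ∈ row v, ∑ l ∈ F, TensorAlgebra.ι ℚ (omega l u) * symbolAux n (V k l) *
            TensorAlgebra.ι ℚ (omega v k) := by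
          rw [symbolAux_succ_V]
          refine Finset.sum_congr rfl fun k hk => ?_
          rw [ih, sum_row_of_subset (hF k hk) fun l hl => by rw [hl, map_zero, mul_zero],
            Finset.sum_mul]
      _ = ∑ l ∈ F, TensorAlgebra.ι ℚ (omega l u) * symbolAux (n + 1) (V v l) := by
          rw [Finset.sum_comm]
          refine Finset.sum_congr rfl fun l _ => ?_
          rw [symbolAux_succ_V, Finset.mul_sum]
          exact Finset.sum_congr rfl fun k _ => mul_assoc _ _ _
      _ = _ := (sum_row_of_subset Finset.subset_union_left fun l hl => by
          rw [hl, map_zero, mul_zero]).symm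

end Symbol

end

/-! ### Forms of words and the commutator relation. -/

section

section Words

theorem wTensor_tprod (n : ℕ) (f : Fin n → WeightOne) :
    wTensor (TensorAlgebra.tprod ℚ WeightOne n f) = wordForm n f := by
  rw [wTensor, LinearMap.comp_apply, AlgHom.toLinearMap_apply,
    TensorAlgebra.toDirectSum_tensorPower_tprod, ← DirectSum.lof_eq_of ℚ, DirectSum.toModule_lof,
    PiTensorProduct.lift.tprod]

theorem wordTerm_apply (n : ℕ) (i : Fin n) (f : Fin n → WeightOne) :
    wordTerm n i f = (∏ k ∈ Finset.univ.erase i, weightOnePoly (f k)) •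
      KaehlerDifferential.D ℚ FormRing (weightOnePoly (f i)) := rfl

theorem wordTerm_succ (n : ℕ) (i : Fin n) (f : Fin (n + 1) → WeightOne) :
    wordTerm (n + 1) i.succ f = weightOnePoly (f 0) • wordTerm n i (Fin.tail f) := by
  rw [wordTerm_apply, wordTerm_apply, smul_smul]
  congr 1
  rw [← Finset.mul_prod_erase _ (fun k => weightOnePoly (f k)) (a := 0) (by simp [Fin.succ_ne_zero
      i, eq_comm])]
  congr 1
  have : (Finset.univ.erase i.succ).erase 0 = (Finset.univ.erase i).map (Fin.succEmb n) := by
    ext k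
    cases k using Fin.cases <;> simp
  rw [this, Finset.prod_map]
  rfl

theorem wordTerm_castSucc (n : ℕ) (i : Fin n) (f : Fin (n + 1) → WeightOne) :
    wordTerm (n + 1) i.castSucc f = weightOnePoly (f (Fin.last n)) • wordTerm n i (Fin.init f) := by
  rw [wordTerm_apply, wordTerm_apply, smul_smul]
  congr 1
  rw [← Finset.mul_prod_erase _ (fun k => weightOnePoly (f k)) (a := Fin.last n)
    (by simp [(Fin.castSucc_lt_last i).ne'])]
  congr 1
  have : (Finset.univ.erase i.castSucc).erase (Fin.last n) =
      (Finset.univ.erase i).map Fin.castSuccEmb := by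
    ext k
    cases k using Fin.lastCases <;> simp [(Fin.castSucc_lt_last _).ne]
  rw [this, Finset.prod_map]
  rfl

/-- The form of a word, without the factor `(-1) ^ (n + 1) / n!`. -/
def wordSum (n : ℕ) (f : Fin n → WeightOne) : Form1 :=
  ∑ i : Fin n, ((-1 : ℚ) ^ (i : ℕ) * ((n - 1).choose i : ℚ)) • wordTerm n i f

theorem factorial_smul_wordForm (n : ℕ) (f : Fin n → WeightOne) :
    (n.factorial : ℚ) • wordForm n f = (-1 : ℚ) ^ (n + 1) • wordSum n f := by
  rw [wordForm, smul_apply, sum_apply, smul_smul,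
    mul_div_cancel₀ _ (by exact_mod_cast n.factorial_ne_zero)]
  rfl

/-- Pascal's rule: `choose m i` accounts for the terms with the last factor undifferentiated, and
`choose m (i - 1)`, with the opposite sign, for those with the first factor undifferentiated. -/
theorem wordSum_succ (m : ℕ) (f : Fin (m + 2) → WeightOne) :
    wordSum (m + 2) f = weightOnePoly (f (Fin.last _)) • wordSum (m + 1) (Fin.init f) -
      weightOnePoly (f 0) • wordSum (m + 1) (Fin.tail f) := by
  have h1 : ∑ i : Fin (m + 2), ((-1 : ℚ) ^ (i : ℕ) * (m.choose i : ℚ)) • wordTerm (m + 2) i f =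
      weightOnePoly (f (Fin.last _)) • wordSum (m + 1) (Fin.init f) := by
    -- The summand with the last factor differentiated has coefficient `choose m (m + 1) = 0`.
    rw [Fin.sum_univ_castSucc, wordSum, Finset.smul_sum]
    simp only [Fin.val_last, Nat.choose_succ_self, Nat.cast_zero, mul_zero, zero_smul, add_zero,
      Fin.val_castSucc, wordTerm_castSucc, add_tsub_cancel_right]
    exact Finset.sum_congr rfl fun i _ => smul_comm _ _ _
  have h2 : ∑ i : Fin (m + 1), ((-1 : ℚ) ^ (i : ℕ) * (m.choose i : ℚ)) • wordTerm (m + 2) i.succ f =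
      weightOnePoly (f 0) • wordSum (m + 1) (Fin.tail f) := by
    rw [wordSum, Finset.smul_sum]
    simp only [wordTerm_succ, add_tsub_cancel_right]
    exact Finset.sum_congr rfl fun i _ => smul_comm _ _ _
  rw [← h1, ← h2, wordSum, Fin.sum_univ_succ,
    Fin.sum_univ_succ fun i : Fin (m + 2) =>
      ((-1 : ℚ) ^ (i : ℕ) * (m.choose i : ℚ)) • wordTerm (m + 2) i f,
    add_sub_assoc, ← Finset.sum_sub_distrib]
  congr 1
  · simp
  refine Finset.sum_congr rfl fun i _ => ?_
  rw [← sub_smul]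
  congr 1
  rw [Fin.val_succ, show m + 2 - 1 = m + 1 from rfl, Nat.choose_succ_succ, Nat.cast_add, pow_succ]
  ring

theorem wordForm_succ (m : ℕ) (f : Fin (m + 2) → WeightOne) :
    ((m + 2).factorial : ℚ) • wordForm (m + 2) f =
      weightOnePoly (f 0) • ((m + 1).factorial : ℚ) • wordForm (m + 1) (Fin.tail f) -
      weightOnePoly (f (Fin.last _)) • ((m + 1).factorial : ℚ) • wordForm (m + 1) (Fin.init f) := by
  rw [factorial_smul_wordForm, factorial_smul_wordForm, factorial_smul_wordForm, wordSum_succ,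
    smul_comm (weightOnePoly _) ((-1 : ℚ) ^ _), smul_comm (weightOnePoly _) ((-1 : ℚ) ^ _),
    ← smul_sub, pow_succ _ (m + 1 + 1), mul_neg_one, neg_smul, ← smul_neg, neg_sub]

open TensorAlgebra (ι tprod)

theorem tprod_cons (n : ℕ) (f : Fin (n + 1) → WeightOne) :
    tprod ℚ WeightOne (n + 1) f = ι ℚ (f 0) * tprod ℚ WeightOne n (Fin.tail f) := by
  rw [TensorAlgebra.tprod_apply, TensorAlgebra.tprod_apply, List.ofFn_succ, List.prod_cons]
  rfl

theorem tprod_snoc (n : ℕ) (f : Fin (n + 1) → WeightOne) :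
    tprod ℚ WeightOne (n + 1) f = tprod ℚ WeightOne n (Fin.init f) * ι ℚ (f (Fin.last n)) := by
  rw [TensorAlgebra.tprod_apply, TensorAlgebra.tprod_apply, List.ofFn_succ', List.concat_eq_append,
    List.prod_append, List.prod_singleton]
  rfl

/-- The tensors of degree `n`. -/
def tensors (n : ℕ) : Submodule ℚ (TensorAlgebra ℚ WeightOne) :=
  Submodule.span ℚ (Set.range (tprod ℚ WeightOne n))

theorem wTensor_mul_mul {m : ℕ} {x : TensorAlgebra ℚ WeightOne} (hx : x ∈ tensors m)
    (a b : WeightOne) :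
    ((m + 2).factorial : ℚ) • wTensor (ι ℚ a * x * ι ℚ b) =
      weightOnePoly a • ((m + 1).factorial : ℚ) • wTensor (x * ι ℚ b) -
      weightOnePoly b • ((m + 1).factorial : ℚ) • wTensor (ι ℚ a * x) := by
  induction hx using Submodule.span_induction with
  | mem x hx =>
    obtain ⟨g, rfl⟩ := hx
    have h := wordForm_succ m (Fin.cons a (Fin.snoc g b : Fin (m + 1) → WeightOne))
    have e1 : Fin.init (Fin.cons a (Fin.snoc g b : Fin (m + 1) → WeightOne) :
        Fin (m + 2) → WeightOne) = Fin.cons a g := by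
      rw [Fin.cons_snoc_eq_snoc_cons, Fin.init_snoc]
    have e2 : (Fin.cons a (Fin.snoc g b : Fin (m + 1) → WeightOne) :
        Fin (m + 2) → WeightOne) (Fin.last _) = b := by
      rw [Fin.cons_snoc_eq_snoc_cons, Fin.snoc_last]
    rw [← wTensor_tprod, ← wTensor_tprod, ← wTensor_tprod, e1, e2, tprod_cons (m + 1),
        Fin.tail_cons,
      Fin.cons_zero, tprod_snoc m, Fin.init_snoc, Fin.snoc_last, tprod_cons m, Fin.cons_zero,
      Fin.tail_cons, ← mul_assoc] at h
    exact h
  | zero => simp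
  | add x y _ _ hx hy =>
    simp only [mul_add, add_mul, map_add, smul_add, hx, hy]
    abel
  | smul c x _ hx =>
    simp only [mul_smul_comm, smul_mul_assoc, map_smul]
    rw [smul_comm _ c, hx, smul_sub, smul_comm c (weightOnePoly a), smul_comm c (weightOnePoly b),
      smul_comm c, smul_comm c]

theorem symbolAux_mem (n : ℕ) (x : HSymb) : symbolAux n x ∈ tensors n := by
  induction n generalizing x with
  | zero =>
    have : symbolAux 0 x = MvPolynomial.coeff 0 x • tprod ℚ WeightOne 0 Fin.elim0 := by
      rw [TensorAlgebra.tprod_apply, List.ofFn_zero, List.prod_nil,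
          ← Algebra.algebraMap_eq_smul_one]
      rfl
    rw [this]
    exact Submodule.smul_mem _ _ (Submodule.subset_span ⟨_, rfl⟩)
  | succ n ih =>
    rw [symbolAux_succ]
    generalize coprod x = y
    induction y using TensorProduct.induction_on with
    | zero => simp
    | tmul a b =>
      rw [TensorProduct.map_tmul, LinearMap.mul'_apply, LinearMap.comp_apply, LinearMap.comp_apply]
      have h := ih (weightPart n a)
      generalize symbolAux n (weightPart n a) = z at h
      generalize toWeightOne b = c
      induction h using Submodule.span_induction with
      | mem z hz =>
        obtain ⟨g, rfl⟩ := hz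
        refine Submodule.subset_span ⟨Fin.snoc g c, ?_⟩
        rw [tprod_snoc, Fin.init_snoc, Fin.snoc_last]
      | zero => simp
      | add x y _ _ hx hy => rw [add_mul]; exact add_mem hx hy
      | smul q x _ hx => rw [smul_mul_assoc]; exact Submodule.smul_mem _ _ hx
    | add a b ha hb => rw [map_add, map_add]; exact add_mem ha hb

end Words

section Commutator

theorem wV_eq (n : ℕ) (v u : ZInf) : wV n v u = wTensor (symbolAux n (V v u)) := by
  rw [wV, w, LinearMap.comp_apply, VPart, symbolMap_weightPart]

/-- Write each word with its first letter `omega l u` and its last letter `omega v k` exposed.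
Taking out the first letter and summing over `k` leaves the symbol of `V v l`; taking out the last
and summing over `l` leaves that of `V k u`. By `wTensor_mul_mul` these are the two products in the
commutator. -/
theorem wV_succ (m : ℕ) (v u : ZInf) : ((m + 2).factorial : ℚ) • wV (m + 2) v u =
    ∑ k ∈ row v, Omega k u • ((m + 1).factorial : ℚ) • wV (m + 1) v k -
      ∑ k ∈ row v, Omega v k • ((m + 1).factorial : ℚ) • wV (m + 1) k u := by
  classical
  set F := row v ∪ (row v).biUnion row with hFdef
  have hF : ∀ k ∈ row v, row k ⊆ F := fun k hk =>
    (Finset.subset_biUnion_of_mem row hk).trans Finset.subset_union_right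
  have h1 : symbolAux (m + 2) (V v u) = ∑ k ∈ row v, ∑ l ∈ F,
      TensorAlgebra.ι ℚ (omega l u) * symbolAux m (V k l) * TensorAlgebra.ι ℚ (omega v k) := by
    rw [symbolAux_succ_V]
    refine Finset.sum_congr rfl fun k hk => ?_
    rw [symbolAux_succ_V', sum_row_of_subset (hF k hk) fun l hl => by rw [hl, map_zero, mul_zero],
      Finset.sum_mul]
  have h2 : ∀ l, symbolAux (m + 1) (V v l) =
      ∑ k ∈ row v, symbolAux m (V k l) * TensorAlgebra.ι ℚ (omega v k) := symbolAux_succ_V m v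
  have h3 : ∀ k ∈ row v, symbolAux (m + 1) (V k u) =
      ∑ l ∈ F, TensorAlgebra.ι ℚ (omega l u) * symbolAux m (V k l) := fun k hk => by
    rw [symbolAux_succ_V', sum_row_of_subset (hF k hk) fun l hl => by rw [hl, map_zero, mul_zero]]
  rw [wV_eq, h1]
  simp only [map_sum, Finset.smul_sum, wTensor_mul_mul (symbolAux_mem m _)]
  simp only [Finset.sum_sub_distrib]
  congr 1
  · rw [Finset.sum_comm, sum_row_of_subset (F := F) Finset.subset_union_left fun l hl => by
      rw [wV_eq, hl, map_zero, map_zero, smul_zero, smul_zero]]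
    refine Finset.sum_congr rfl fun l _ => ?_
    rw [wV_eq, h2, map_sum, Finset.smul_sum, Finset.smul_sum]
    rfl
  · refine Finset.sum_congr rfl fun k hk => ?_
    rw [wV_eq, h3 k hk, map_sum, Finset.smul_sum, Finset.smul_sum]
    rfl

theorem Omega_eq_zero {v u : ZInf} (h : V v u = 0) : Omega v u = 0 := by
  rw [Omega, h, map_zero, map_zero]

theorem wV_eq_zero (n : ℕ) {v u : ZInf} (h : V v u = 0) : wV n v u = 0 := by
  rw [wV_eq, h, map_zero, map_zero]

theorem commutator_apply (c : ℚ) (n : ℕ) (v u : ZInf) : commutator (c • wV n) Omega v u =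
    ∑ k ∈ row v, Omega k u • c • wV n v k - ∑ k ∈ row v, Omega v k • c • wV n k u := by
  have h1 : commutator (c • wV n) Omega v u =
      (∑ᶠ k, Omega k u • c • wV n v k) - ∑ᶠ k, Omega v k • c • wV n k u := rfl
  rw [h1, finsum_eq_sum_row v fun k hk => by rw [wV_eq_zero n hk, smul_zero, smul_zero],
    finsum_eq_sum_row v fun k hk => by rw [Omega_eq_zero hk, zero_smul]]

theorem w_elt (s : Symb) : w (ZInf.elt (some s)) = wV s.norm (some s) none := by
  rw [wV, VPart, V_none]
  congr 1
  rw [ZInf.elt, weightPart_monomial, if_pos]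
  simp [ZInf.exponent, Finsupp.weight_single, genWeight]

/-- The entry of the commutator relation in the column of the zero vector, where `V` has the symbol
itself, of pure weight. Cancelling `(m + 1)!` from `(m + 2)!` leaves the factor `s.norm`. -/
theorem w_recurrence (s : Symb) (hs : 2 ≤ s.norm) :
    w (ZInf.elt (some s)) = (1 / (s.norm : ℚ)) •
      ((∑ᶠ u : ZInf, Omega u none • wV (s.norm - 1) (some s) u)
        - ∑ᶠ u : ZInf, Omega (some s) u • wV (s.norm - 1) u none) := by
  rw [w_elt]
  obtain ⟨m, hm⟩ := Nat.exists_eq_add_of_le' hs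
  rw [hm, show m + 2 - 1 = m + 1 from rfl,
    finsum_eq_sum_row (some s) fun k hk => by rw [wV_eq_zero _ hk, smul_zero],
    finsum_eq_sum_row (some s) fun k hk => by rw [Omega_eq_zero hk, zero_smul]]
  have h := wV_succ m (some s) none
  simp only [smul_comm (Omega _ _) ((m + 1).factorial : ℚ), ← Finset.smul_sum, ← smul_sub] at h
  have h1 : ((m + 1).factorial : ℚ) ≠ 0 := by exact_mod_cast (m + 1).factorial_ne_zero
  have h2 : ((m + 2 : ℕ) : ℚ) ≠ 0 := by exact_mod_cast (m + 1).succ_ne_zero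
  rw [Nat.factorial_succ, mul_comm, Nat.cast_mul, mul_smul] at h
  rw [← smul_right_injective _ h1 h, smul_smul, one_div_mul_cancel h2, one_smul]

end Commutator

end

end SymbPolylog

end

open SymbPolylog in
theorem mainTheorem10 :
    -- the variation matrix is well defined and its rows are finite
    (∀ v : ZInf, {u | V v u ≠ 0}.Finite ∧ coprod v.elt = ∑ᶠ u : ZInf, u.elt ⊗ₜ[ℚ] V v u) ∧
    -- the commutator relation
    (∀ n : ℕ, 1 ≤ n →
      ((n + 1).factorial : ℚ) • wV (n + 1) = commutator ((n.factorial : ℚ) • wV n) Omega) ∧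
    -- the recurrence for the form of a symbol `s` of weight at least two
    (∀ s : Symb, 2 ≤ s.norm →
      w (ZInf.elt (some s)) = (1 / (s.norm : ℚ)) •
        ((∑ᶠ u : ZInf, Omega u none • wV (s.norm - 1) (some s) u)
          - ∑ᶠ u : ZInf, Omega (some s) u • wV (s.norm - 1) u none)) := by
  refine ⟨fun v => ⟨finite_row v, coprod_elt_finsum v⟩, fun n hn => ?_, w_recurrence⟩
  obtain ⟨m, rfl⟩ := Nat.exists_eq_add_of_le' hn
  funext v u
  rw [commutator_apply]
  exact wV_succ m v u
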